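/- \textbf{Setting.} Let $\mathfrak g_0$ be a finite-dimensional nonabelian real Lie algebra, $\mathfrak g=\mathfrak g_0\otimes\mathbb C$, and $G_0$, $G$ connected Lie groups (real, resp. complex) with these Lie algebras, acting on $\mathfrak g^*$ by the coadjoint action. Fix a basis of $\mathfrak g_0$ with structure constants $c_{ij}^k$ and let $z=(z_1,\dots,z_n)$ be the corresponding complex coordinates on $\mathfrak g^*$; the bar is the conjugation defined by $\mathfrak g_0$. Let $c=c_{ij}^kz_k\,\partial_{z_i}\wedge\partial_{z_j}$ be the linear Poisson bivector on $\mathfrak g^*$, $R=\max_z\operatorname{rank}c(z)$, $r=n-R$, and $\operatorname{Sing}\mathfrak g^*=\{z:\operatorname{rank}c(z)<R\}$; assume $\operatorname{codim}_{\mathbb C}\operatorname{Sing}\mathfrak g^*\ge 3$. For $\lambda\in\mathbb C^2$ put $\phi_\lambda(z)=\lambda_1z+\lambda_2\bar z$, and let $\mathcal C=\{z:\phi_\lambda(z)\in\operatorname{Sing}\mathfrak g^*\text{ for some }\lambda\ne0\}$. For an open set $W$ let $Z^{hol}_c(W)$ be the set of holomorphic $g$ on $W$ with $\sum_i\frac{\partial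 g}{\partial z_i}\,c_{ij}^kz_k=0$ for all $j$. An open set $W\subset\mathfrak g^*\setminus\operatorname{Sing}\mathfrak g^*$ is \emph{admissible} if there are $g_1,\dots,g_r\in Z_c^{hol}(W)$ whose differentials are linearly independent at every point of $W$. A set $U\subset\mathfrak g^*\setminus\mathcal C$ is \emph{strongly admissible} if for every $\lambda\ne0$ the set $\phi_\lambda(U)$ has an admissible neighbourhood; choose such neighbourhoods $U_\lambda$. A smooth complex-valued function is \emph{functionally generated} by a family $S$ if at every point its differential is a complex linear combination of differentials of members of $S$. For $U$ open in $\mathfrak g^*$, $F_1(U)$ is the set of smooth functions $U\to\mathbb C$ functionally generated by the functions $g$ and $\tilde g=\sum_i\overline{(\partial g/\partial z_i)}\,z_i$ with $g\in Z_c^{hol}(U)$, and $g\circ\phi_\lambda|_U$ with $\lambda_1,\lambda_2\ne0$, $g\in Z_c^{hol}(U_\lambda)$. For $U$ open in a $G$-orbit, $F_1(U)$ is the set of smooth functions on the manifold $U$ functionally generated by the restrictions to $U$ of the same functions, with $Z_c^{hol}(U)$ replaced by $Z_c^{hol}(V)$ for a chosen admissible neighbourhood $V$ of $U$ in $\mathfrak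 g^*$. \textbf{Proposition.} (i) Let $U\subset\mathfrak g^*$ be open and strongly admissible. Then every function in $F_1(U)$ is $G_0$-invariant: it is constant on the connected components (in the orbit topology) of the intersections of $U$ with the $G_0$-orbits; so if $U$ is $G_0$-invariant, then $f(g\cdot z)=f(z)$ for all $f\in F_1(U)$, $g\in G_0$, $z\in U$. (ii) Let $U$ be an open subset of a $G$-orbit $M\subset\mathfrak g^*$ ($M$ with its structure of an immersed submanifold) such that $U'=U/G_0$ is a smooth manifold; that is, there is a surjective submersion $p:U\to U'$ whose fibres are the connected components of the intersections of $U$ with the $G_0$-orbits (these fibres are the $G_0$-orbits if $U$ is $G_0$-invariant). Assume that $U$ is strongly admissible. Then $c|_U$ and $\bar c|_U$ have push-forwards $c'$, $\bar c'$ under $p$. Let $J'=\{\lambda_1c'+\lambda_2\bar c':\lambda\in\mathbb C^2\}$, let $J'_0\subset J'$ be the set of bivectors of maximal rank (the rank of a bivector field being the maximum of its pointwise ranks), and let $F'_0(U')=\sum_{b\in J'_0}Z_b(U')$ be the space of first integrals, where $Z_b(U')$ is the space of smooth complex-valued Casimir functions of $b$ on $U'$. Then the functions on $U'$ functionally generated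 by $F_0'(U')$ are exactly the functions of $F_1(U)$ regarded as functions on $U'$: the map $f\mapsto f\circ p$ is a bijection from the former set onto $F_1(U)$. This holds for all choices of $V$ and of the $U_\lambda$. -/

import Mathlib

open scoped Manifold ContDiff Matrix ComplexConjugate

noncomputable section

/-! ### Complex functions, covectors and bivectors on a smooth manifold -/

section Manifold

variable {B : Type*} [NormedAddCommGroup B] [NormedSpace ℝ B]
  {H : Type*} [TopologicalSpace H] (I : ModelWithCorners ℝ B H)
  {M : Type*} [TopologicalSpace M] [ChartedSpace H M]
  {B' : Type*} [NormedAddCommGroup B'] [NormedSpace ℝ B']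
  {H' : Type*} [TopologicalSpace H'] (I' : ModelWithCorners ℝ B' H')
  {M' : Type*} [TopologicalSpace M'] [ChartedSpace H' M']

/-- The complexified cotangent space at `x`: real-linear maps from the tangent space to `ℂ`. -/
abbrev ComplexCotangent (x : M) : Type _ := TangentSpace I x →L[ℝ] ℂ

/-- The differential at `x` of a complex-valued function. -/
def cdiff (f : M → ℂ) (x : M) : ComplexCotangent I x := mfderiv I 𝓘(ℝ, ℂ) f x

/-- The smooth functions on `U` functionally generated by the family `S`: at every point of `U`
their differential is a complex linear combination of the differentials of members of `S`. -/
def functionallyGenerated (U : Set M) (S : Set (M → ℂ)) : Set (M → ℂ) :=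
  {f | ContMDiffOn I 𝓘(ℝ, ℂ) ∞ f U ∧
    ∀ x ∈ U, cdiff I f x ∈ Submodule.span ℂ ((fun s => cdiff I s x) '' S)}

variable (M) in
/-- Fields of complex bilinear forms on the complexified cotangent spaces; complex bivector fields
are regarded as such fields (the ones used below are skew-symmetric). -/
abbrev BivectorField : Type _ :=
  ∀ x : M, ComplexCotangent I x →ₗ[ℂ] ComplexCotangent I x →ₗ[ℂ] ℂ

variable {I I'} in
/-- `b'` is the push-forward of `b` under `h`, that is `b' (h x) = (∧² h_*) (b x)` for all `x`. -/
def IsPushforward (h : M → M') (b : BivectorField I M) (b' : BivectorField I' M') : Prop :=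
  ∀ (x : M) (α β : ComplexCotangent I' (h x)),
    b' (h x) α β =
      b x (ContinuousLinearMap.comp α (mfderiv I I' h x))
        (ContinuousLinearMap.comp β (mfderiv I I' h x))

variable {I}

/-- The rank of a bivector field: the maximum over all points of the rank of its sharp map. -/
def bivectorRank (b : BivectorField I M) : ℕ :=
  ⨆ x : M, Module.finrank ℂ (LinearMap.range (b x))

/-- The members of maximal rank of a linear family of bivector fields. -/
def maximalRankPart (J : Submodule ℂ (BivectorField I M)) : Set (BivectorField I M) :=
  {b | b ∈ J ∧ ∀ b' ∈ J, bivectorRank b' ≤ bivectorRank b}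

/-- The smooth complex-valued Casimir functions of a bivector field. -/
def casimirs (b : BivectorField I M) : Set (M → ℂ) :=
  {f | ContMDiff I 𝓘(ℝ, ℂ) ∞ f ∧ ∀ x, b x (cdiff I f x) = 0}

/-- The sum of the spaces of Casimir functions of the members of maximal rank of `J`. -/
def firstIntegrals (J : Submodule ℂ (BivectorField I M)) : Submodule ℂ (M → ℂ) :=
  Submodule.span ℂ (⋃ b ∈ maximalRankPart J, casimirs b)

end Manifold

/-! ### The dual of a complexified Lie algebra

`𝔤₀` is a real Lie algebra with basis `e`, `𝔤 = 𝔤₀ ⊗ ℂ`. Elements of `𝔤` and of `𝔤*` are written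
in the complex coordinates `ι → ℂ` given by `e` and its dual basis; the complex conjugations
defined by `𝔤₀` are then coordinatewise. -/

section Lie

variable {ι : Type*} [Fintype ι] [DecidableEq ι] {𝔤₀ : Type*} [LieRing 𝔤₀] [LieAlgebra ℝ 𝔤₀]
  (e : Module.Basis ι ℝ 𝔤₀)

/-- `[e i, e j] = ∑ k, (structureConstant e i j k) • e k`. -/
def structureConstant (i j k : ι) : ℝ := e.repr ⁅e i, e j⁆ k

/-- The coefficients `c_{ij}(z) = ∑ k, c_{ij}^k z_k` of the linear Poisson bivector on `𝔤*`. -/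
def poissonMatrix (z : ι → ℂ) : Matrix ι ι ℂ :=
  Matrix.of fun i j => ∑ k, (structureConstant e i j k : ℂ) * z k

/-- The maximal rank of the linear Poisson bivector. -/
def genericRank : ℕ := ⨆ z : ι → ℂ, (poissonMatrix e z).rank

/-- The rank of the Lie algebra `𝔤`: the corank of its linear Poisson bivector. -/
def lieRank : ℕ := Fintype.card ι - genericRank e

/-- The union of the symplectic leaves of nonmaximal dimension. -/
def singSet : Set (ι → ℂ) := {z | (poissonMatrix e z).rank < genericRank e}

/-- `φ_λ (z) = λ₁ z + λ₂ z̄`. -/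
def phi (l : ℂ × ℂ) (z : ι → ℂ) : ι → ℂ := fun i => l.1 * z i + l.2 * conj (z i)

/-- The incompleteness set. -/
def incompletenessSet : Set (ι → ℂ) := {z | ∃ l : ℂ × ℂ, l ≠ 0 ∧ phi l z ∈ singSet e}

/-- The partial derivative `∂g/∂z_i` of a holomorphic function. -/
def holPartial (g : (ι → ℂ) → ℂ) (i : ι) (z : ι → ℂ) : ℂ := fderiv ℂ g z (Pi.single i 1)

/-- The holomorphic Casimir functions over `W` of the linear Poisson bivector. -/
def holCasimirs (W : Set (ι → ℂ)) : Set ((ι → ℂ) → ℂ) :=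
  {g | DifferentiableOn ℂ g W ∧
    ∀ z ∈ W, ∀ j, ∑ i, holPartial g i z * poissonMatrix e z i j = 0}

/-- Admissible sets. -/
def IsAdmissible (W : Set (ι → ℂ)) : Prop :=
  IsOpen W ∧ Disjoint W (singSet e) ∧
    ∃ g : Fin (lieRank e) → (ι → ℂ) → ℂ, (∀ a, g a ∈ holCasimirs e W) ∧
      ∀ z ∈ W, LinearIndependent ℂ fun a => fderiv ℂ (g a) z

/-- Strong admissibility, for subsets of `𝔤*` that need not be open in `𝔤*`. -/
def IsStronglyAdmissible (U : Set (ι → ℂ)) : Prop :=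
  Disjoint U (incompletenessSet e) ∧
    ∀ l : ℂ × ℂ, l ≠ 0 → ∃ W, IsAdmissible e W ∧ phi l '' U ⊆ W

/-- `g̃ = ∑ i, conj (∂g/∂z_i) z_i`. -/
def tildeFun (g : (ι → ℂ) → ℂ) (z : ι → ℂ) : ℂ := ∑ i, conj (holPartial g i z) * z i

/-- The generators of `F_1`, pulled back along `j : M → 𝔤*` (an inclusion in the applications).
`V` is a neighbourhood of `U = j(M)` and `W l` a neighbourhood of `φ_l(U)`. -/
def F1Generators {M : Type*} (j : M → ι → ℂ) (V : Set (ι → ℂ)) (W : ℂ × ℂ → Set (ι → ℂ)) :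
    Set (M → ℂ) :=
  {f | ∃ g ∈ holCasimirs e V, f = g ∘ j} ∪ {f | ∃ g ∈ holCasimirs e V, f = tildeFun g ∘ j} ∪
    {f | ∃ l : ℂ × ℂ, l.1 ≠ 0 ∧ l.2 ≠ 0 ∧ ∃ g ∈ holCasimirs e (W l), f = g ∘ phi l ∘ j}

/-! ### Coadjoint actions -/

/-- The matrix of `ad* v : 𝔤* → 𝔤*`, `(ad* v z)(u) = z([v, u])`. -/
def coadMatrix (v : ι → ℂ) : Matrix ι ι ℂ :=
  Matrix.of fun j k => ∑ i, v i * (structureConstant e i j k : ℂ)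

/-- `exp (ad* v)` for `v ∈ 𝔤`. -/
def coadExp (v : ι → ℂ) : Matrix ι ι ℂ := NormedSpace.exp (coadMatrix e v)

/-- `exp (ad* (t x))` for `x ∈ 𝔤₀` and real `t`. -/
def realCoadExp (x : ι → ℝ) (t : ℝ) : Matrix ι ι ℂ := coadExp e fun i => ((t * x i : ℝ) : ℂ)

/-- The group of transformations of `𝔤*` by which a connected complex Lie group `G` with Lie
algebra `𝔤` acts: it is generated by the `exp (ad* v)`, a set closed under inversion. -/
def coadjointGroup : Submonoid (Matrix ι ι ℂ) := Submonoid.closure (Set.range (coadExp e))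

/-- The same for a connected Lie group `G₀` with Lie algebra `𝔤₀`, acting on `𝔤*`. -/
def realCoadjointGroup : Submonoid (Matrix ι ι ℂ) :=
  Submonoid.closure (Set.range fun x : ι → ℝ => realCoadExp e x 1)

/-- The `G`-orbit of `z`. -/
def complexOrbit (z : ι → ℂ) : Set (ι → ℂ) := {w | ∃ A ∈ coadjointGroup e, w = A *ᵥ z}

/-- The tangent space at `z` of the `G`-orbit of `z`. -/
def complexOrbitTangent (z : ι → ℂ) : Set (ι → ℂ) := Set.range fun v => coadMatrix e v *ᵥ z

/-- The tangent space at `z` of the `G₀`-orbit of `z`. -/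
def realOrbitTangent (z : ι → ℂ) : Set (ι → ℂ) :=
  Set.range fun x : ι → ℝ => coadMatrix e (fun i => (x i : ℂ)) *ᵥ z

/-- `w` is obtained from `z` by moving inside `U` along a one-parameter subgroup of `G₀`. -/
def RealStep (U : Set (ι → ℂ)) (z w : ι → ℂ) : Prop :=
  ∃ x : ι → ℝ, (∀ t ∈ Set.Icc (0 : ℝ) 1, realCoadExp e x t *ᵥ z ∈ U) ∧ w = realCoadExp e x 1 *ᵥ z

/-- `z` and `w` lie on one connected piece of a `G₀`-orbit in `U`. If `U` is `G₀`-invariant, this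
says that `w` belongs to the `G₀`-orbit of `z`. -/
def SameRealOrbitIn (U : Set (ι → ℂ)) : (ι → ℂ) → (ι → ℂ) → Prop :=
  Relation.ReflTransGen (RealStep e U)

/-- `f` is constant on the connected pieces of the `G₀`-orbits in `U`. -/
def IsRealInvariantOn (U : Set (ι → ℂ)) (f : (ι → ℂ) → ℂ) : Prop :=
  ∀ z ∈ U, ∀ w, SameRealOrbitIn e U z w → f w = f z

/-- The linear map `α ↦ α(v)` on covectors. -/
def evalCovector (v : ι → ℂ) : ((ι → ℂ) →L[ℝ] ℂ) →ₗ[ℂ] ℂ where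
  toFun α := α v
  map_add' _ _ := rfl
  map_smul' _ _ := rfl

/-- `α ↦ α(∂/∂z_i)`. -/
def dz (i : ι) : ((ι → ℂ) →L[ℝ] ℂ) →ₗ[ℂ] ℂ :=
  (1 / 2 : ℂ) • (evalCovector (Pi.single i 1) - Complex.I • evalCovector (Pi.single i Complex.I))

/-- `α ↦ α(∂/∂z̄_i)`. -/
def dzbar (i : ι) : ((ι → ℂ) →L[ℝ] ℂ) →ₗ[ℂ] ℂ :=
  (1 / 2 : ℂ) • (evalCovector (Pi.single i 1) + Complex.I • evalCovector (Pi.single i Complex.I))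

/-- The linear Poisson bivector `c = c_{ij}^k z_k ∂/∂z_i ∧ ∂/∂z_j` on `𝔤*`. -/
def lieBivector : BivectorField 𝓘(ℝ, ι → ℂ) (ι → ℂ) := fun z =>
  ∑ i, ∑ j, poissonMatrix e z i j • (dz i).smulRight (dz j)

/-- The complex conjugate of `c`. -/
def lieBivectorConj : BivectorField 𝓘(ℝ, ι → ℂ) (ι → ℂ) := fun z =>
  ∑ i, ∑ j, conj (poissonMatrix e z i j) • (dzbar i).smulRight (dzbar j)

section Reduction

variable {d m : ℕ} {X : Type*} [TopologicalSpace X] [ChartedSpace (EuclideanSpace ℝ (Fin d)) X]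
  {N : Type*} [TopologicalSpace N] [ChartedSpace (EuclideanSpace ℝ (Fin m)) N]

/-- The manifold `X`, with the inclusion `j`, is an open subset of the `G`-orbit of `z₀`, the orbit
having its structure of an immersed submanifold: `j` is an injective immersion into the orbit,
onto whose tangent spaces it maps those of `X`. -/
structure IsOpenInOrbit (z₀ : ι → ℂ) (j : X → ι → ℂ) : Prop where
  smooth : ContMDiff (𝓡 d) 𝓘(ℝ, ι → ℂ) ∞ j
  injective : Function.Injective j
  mem_orbit : ∀ x, j x ∈ complexOrbit e z₀
  immersion : ∀ x, Function.Injective (mfderiv (𝓡 d) 𝓘(ℝ, ι → ℂ) j x)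
  tangent : ∀ x, Set.range (mfderiv (𝓡 d) 𝓘(ℝ, ι → ℂ) j x) = complexOrbitTangent e (j x)

/-- The manifold `N` is the quotient `U/G₀` of `U = j(X)`, with canonical projection `p`: a
surjective submersion whose fibres are, as sets and as submanifolds, the (connected pieces in `U`
of the) `G₀`-orbits. -/
structure IsRealOrbitQuotient (j : X → ι → ℂ) (p : X → N) : Prop where
  smooth : ContMDiff (𝓡 d) (𝓡 m) ∞ p
  surjective : Function.Surjective p
  submersion : ∀ x, Function.Surjective (mfderiv (𝓡 d) (𝓡 m) p x)
  fibre : ∀ x y, p x = p y ↔ SameRealOrbitIn e (Set.range j) (j x) (j y)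
  fibre_tangent : ∀ (x : X) (v : TangentSpace (𝓡 d) x),
    mfderiv (𝓡 d) (𝓡 m) p x v = 0 ↔
      mfderiv (𝓡 d) 𝓘(ℝ, ι → ℂ) j x v ∈ realOrbitTangent e (j x)

/-- `c₁`, `c₂` are the reductions to `N` of the restrictions to `X` of `c` and of its conjugate:
there are bivector fields on `X` whose images under `j` are `c` and its conjugate (they are unique
if `j` is an immersion) and whose push-forwards under `p` are `c₁`, `c₂`. -/
def IsReduction (j : X → ι → ℂ) (p : X → N) (c₁ c₂ : BivectorField (𝓡 m) N) : Prop :=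
  ∃ b₁ b₂ : BivectorField (𝓡 d) X,
    IsPushforward j b₁ (lieBivector e) ∧ IsPushforward j b₂ (lieBivectorConj e) ∧
      IsPushforward p b₁ c₁ ∧ IsPushforward p b₂ c₂

end Reduction

end Lie

end

/-!
At a point `z` let `C` and `D` be the matrices of `c` at `z` and at `z̄`. The covector
`∑ i, (a i dz_i + b i dz̄_i)` vanishes on the tangent space of the real orbit iff `C a + D b = 0`,
and on that of the complex orbit iff `C a = 0 = D b`. So the cotangent space of the quotient of
the complex orbit is isomorphic to `im C ∩ im D` by `(a, b) ↦ C a = -D b`. On it, the kernel of the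
form induced by `λ₁ c + λ₂ c̄` with `λ₁ ≠ 0` consists of the classes of those `(a, b)` for which
`C a = C t` for some `t` with `(λ₂ C + λ₁ D) t = 0`; if `λ₁ = 0`, the roles of `a` and `b` are
exchanged. Here `λ₂ C + λ₁ D` is the matrix of `c` at `φ_(λ₂, λ₁) z`, so its kernel is spanned by
the gradients of Casimir functions `g` near this point, and its dimension does not depend on `λ`.

If `λ₁, λ₂ ≠ 0`, then the kernel of the form is spanned by the differentials of the functions
`g ∘ φ_(λ₂, λ₁)`. For `λ = (1, 0)` it is spanned by the differentials of the functions `g̃`: the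
covector `a` is a combination of conjugate gradients, and differentiating the Casimir equation of
`g` gives a matching `b`. For `λ = (0, 1)` it is spanned by the conjugates of these differentials,
which are the derivatives at `ε = 0` of the differentials of the functions `g ∘ φ_(1, ε)`.

In particular, the kernels of these forms have the same dimension for all `λ ≠ 0`, so that every
nonzero member of the reduced pencil has maximal rank, and the generators of `F_1` have the same
differentials as the first integrals of the pencil. The reduction exists because `c` is invariant
under the coadjoint action, so that the bracket of two functions on the quotient is constant along
the real orbits.
-/

/-! ### The linear Poisson bivector in coordinates -/

theorem phi_eq {ι : Type*} (l : ℂ × ℂ) (z : ι → ℂ) : phi l z = l.1 • z + l.2 • star z := rfl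

section PoissonMatrix

variable {ι : Type*} [Fintype ι] {𝔤₀ : Type*} [LieRing 𝔤₀] [LieAlgebra ℝ 𝔤₀]
  (e : Module.Basis ι ℝ 𝔤₀)

theorem poissonMatrix_transpose (z : ι → ℂ) : (poissonMatrix e z)ᵀ = -poissonMatrix e z := by
  ext i j
  simp only [poissonMatrix, structureConstant, Matrix.transpose_apply, Matrix.of_apply,
    Matrix.neg_apply, ← Finset.sum_neg_distrib, ← lie_skew (e i) (e j), map_neg,
    Finsupp.neg_apply, Complex.ofReal_neg, neg_mul, neg_neg]

theorem poissonMatrix_add (z w : ι → ℂ) :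
    poissonMatrix e (z + w) = poissonMatrix e z + poissonMatrix e w := by
  ext i j
  simp [poissonMatrix, mul_add, Finset.sum_add_distrib]

theorem poissonMatrix_smul (a : ℂ) (z : ι → ℂ) :
    poissonMatrix e (a • z) = a • poissonMatrix e z := by
  ext i j
  simp [poissonMatrix, Finset.mul_sum, mul_left_comm]

theorem poissonMatrix_star (z : ι → ℂ) :
    poissonMatrix e (star z) = (poissonMatrix e z).map conj := by
  ext i j
  simp [poissonMatrix]

theorem poissonMatrix_star_mulVec (z v : ι → ℂ) :
    poissonMatrix e (star z) *ᵥ star v = star (poissonMatrix e z *ᵥ v) := by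
  ext i
  simp [Matrix.mulVec, dotProduct, poissonMatrix_star]

theorem poissonMatrix_phi (l : ℂ × ℂ) (z : ι → ℂ) :
    poissonMatrix e (phi l z) = l.1 • poissonMatrix e z + l.2 • poissonMatrix e (star z) := by
  rw [phi_eq, poissonMatrix_add, poissonMatrix_smul, poissonMatrix_smul]

theorem coadMatrix_mulVec (v z : ι → ℂ) : coadMatrix e v *ᵥ z = -(poissonMatrix e z *ᵥ v) := by
  rw [← Matrix.neg_mulVec, ← poissonMatrix_transpose, Matrix.mulVec_transpose]
  ext j
  simp only [coadMatrix, poissonMatrix, Matrix.mulVec, Matrix.vecMul, dotProduct, Matrix.of_apply,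
    Finset.sum_mul, Finset.mul_sum, mul_assoc]
  exact Finset.sum_comm

/-- The Lie bracket of `𝔤 = ℂ ⊗ 𝔤₀` in the coordinates given by `e`. -/
noncomputable def coordBracket (u v : ι → ℂ) : ι → ℂ :=
  (e.baseChange ℂ).equivFun ⁅(e.baseChange ℂ).equivFun.symm u, (e.baseChange ℂ).equivFun.symm v⁆

theorem coordBracket_leibniz (u v w : ι → ℂ) :
    coordBracket e u (coordBracket e v w) =
      coordBracket e (coordBracket e u v) w + coordBracket e v (coordBracket e u w) := by
  simp only [coordBracket, LinearEquiv.symm_apply_apply, ← map_add, ← leibniz_lie]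

theorem coordBracket_apply (u v : ι → ℂ) (k : ι) :
    coordBracket e u v k = ∑ i, ∑ j, u i * v j * (structureConstant e i j k : ℂ) := by
  rw [Finset.sum_comm]
  simp only [coordBracket, Module.Basis.equivFun_symm_apply, Module.Basis.baseChange_apply,
    sum_lie, lie_sum, smul_lie, lie_smul, LieAlgebra.ExtendScalars.bracket_tmul, mul_one, map_sum,
    map_smul, Module.Basis.equivFun_apply, Module.Basis.baseChange_repr_tmul, Finset.sum_apply,
    Pi.smul_apply, smul_eq_mul, structureConstant, mul_assoc, Complex.real_smul,
    Finset.mul_sum, mul_left_comm]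

theorem dotProduct_poissonMatrix_mulVec (z u v : ι → ℂ) :
    u ⬝ᵥ poissonMatrix e z *ᵥ v = z ⬝ᵥ coordBracket e u v := by
  simp only [dotProduct, Matrix.mulVec, poissonMatrix, Matrix.of_apply, coordBracket_apply,
    Finset.mul_sum, Finset.sum_mul]
  rw [Finset.sum_comm_cycle]
  exact Finset.sum_congr rfl fun _ _ => Finset.sum_congr rfl fun _ _ =>
    Finset.sum_congr rfl fun _ _ => by ring

theorem coadMatrix_mulVec_dotProduct (v z u : ι → ℂ) :
    coadMatrix e v *ᵥ z ⬝ᵥ u = z ⬝ᵥ coordBracket e v u := by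
  rw [coadMatrix_mulVec, ← Matrix.neg_mulVec, ← poissonMatrix_transpose, Matrix.mulVec_transpose,
    ← Matrix.dotProduct_mulVec, dotProduct_poissonMatrix_mulVec]

theorem transpose_coadMatrix_mulVec (v u : ι → ℂ) :
    (coadMatrix e v)ᵀ *ᵥ u = coordBracket e v u :=
  dotProduct_eq _ _ fun z => by
    rw [Matrix.mulVec_transpose, ← Matrix.dotProduct_mulVec, dotProduct_comm,
      coadMatrix_mulVec_dotProduct, dotProduct_comm]

/-- The linear Poisson bivector is invariant under the coadjoint action. -/
theorem poissonMatrix_coadMatrix_mulVec (v z : ι → ℂ) :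
    poissonMatrix e (coadMatrix e v *ᵥ z) =
      coadMatrix e v * poissonMatrix e z + poissonMatrix e z * (coadMatrix e v)ᵀ := by
  classical
  refine Matrix.ext_of_mulVec_single fun k => dotProduct_eq _ _ fun u => ?_
  rw [dotProduct_comm, dotProduct_comm _ u, dotProduct_poissonMatrix_mulVec,
    coadMatrix_mulVec_dotProduct, coordBracket_leibniz, Matrix.add_mulVec, dotProduct_add,
    dotProduct_add, ← Matrix.mulVec_mulVec, ← Matrix.mulVec_mulVec, Matrix.dotProduct_mulVec u,
    ← Matrix.mulVec_transpose, transpose_coadMatrix_mulVec, transpose_coadMatrix_mulVec,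
    dotProduct_poissonMatrix_mulVec, dotProduct_poissonMatrix_mulVec]

end PoissonMatrix

/-! ### Covectors in coordinates -/

section SkewMatrix

variable {ι R : Type*} [Fintype ι] [CommRing R]

theorem dotProduct_mulVec_of_transpose_eq_neg {C : Matrix ι ι R} (hC : Cᵀ = -C) (v w : ι → R) :
    v ⬝ᵥ C *ᵥ w = -(C *ᵥ v ⬝ᵥ w) := by
  rw [Matrix.dotProduct_mulVec, ← Matrix.mulVec_transpose, hC, Matrix.neg_mulVec, neg_dotProduct]

end SkewMatrix

/-- The complex conjugate of a covector. -/
noncomputable def conjCovector {E : Type*} [AddCommGroup E] [Module ℝ E] [TopologicalSpace E]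
    (α : E →L[ℝ] ℂ) : E →L[ℝ] ℂ :=
  (Complex.conjCLE : ℂ →L[ℝ] ℂ).comp α

section Covector

variable {ι : Type*} [Fintype ι]

/-- The covector `∑ i, (a i dz_i + b i dz̄_i)`, as a function of the pair `(a, b)`. -/
noncomputable def ofCoeff : ((ι → ℂ) × (ι → ℂ)) →ₗ[ℂ] ((ι → ℂ) →L[ℝ] ℂ) where
  toFun q := LinearMap.toContinuousLinearMap
    { toFun := fun w => q.1 ⬝ᵥ w + q.2 ⬝ᵥ star w
      map_add' := fun v w => by simp only [star_add, dotProduct_add]; ring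
      map_smul' := fun c w => by
        simp only [star_smul, star_trivial, dotProduct_smul, RingHom.id_apply, smul_add] }
  map_add' q q' := by ext w; simp [add_dotProduct, add_add_add_comm]
  map_smul' c q := by ext w; simp [smul_dotProduct, mul_add]

theorem ofCoeff_apply (q : (ι → ℂ) × (ι → ℂ)) (w : ι → ℂ) :
    ofCoeff q w = q.1 ⬝ᵥ w + q.2 ⬝ᵥ star w := rfl

variable [DecidableEq ι]

/-- The coefficients of a covector with respect to the `dz_i`. -/
noncomputable def holCoeff : ((ι → ℂ) →L[ℝ] ℂ) →ₗ[ℂ] (ι → ℂ) := LinearMap.pi dz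

/-- The coefficients of a covector with respect to the `dz̄_i`. -/
noncomputable def antiholCoeff : ((ι → ℂ) →L[ℝ] ℂ) →ₗ[ℂ] (ι → ℂ) := LinearMap.pi dzbar

omit [Fintype ι] in
theorem holCoeff_apply (α : (ι → ℂ) →L[ℝ] ℂ) (i : ι) : holCoeff α i =
    1 / 2 * (α (Pi.single i 1) - Complex.I * α (Pi.single i Complex.I)) := rfl

omit [Fintype ι] in
theorem antiholCoeff_apply (α : (ι → ℂ) →L[ℝ] ℂ) (i : ι) : antiholCoeff α i =
    1 / 2 * (α (Pi.single i 1) + Complex.I * α (Pi.single i Complex.I)) := rfl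

theorem holCoeff_ofCoeff (q : (ι → ℂ) × (ι → ℂ)) : holCoeff (ofCoeff q) = q.1 := by
  ext i
  simp only [holCoeff_apply, ofCoeff_apply, ← Pi.single_star, star_one, Complex.star_def,
    Complex.conj_I, dotProduct_single]
  linear_combination (-1 / 2 * q.1 i + 1 / 2 * q.2 i) * Complex.I_mul_I

theorem antiholCoeff_ofCoeff (q : (ι → ℂ) × (ι → ℂ)) : antiholCoeff (ofCoeff q) = q.2 := by
  ext i
  simp only [antiholCoeff_apply, ofCoeff_apply, ← Pi.single_star, star_one, Complex.star_def,
    Complex.conj_I, dotProduct_single]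
  linear_combination (1 / 2 * q.1 i - 1 / 2 * q.2 i) * Complex.I_mul_I

theorem ofCoeff_holCoeff_antiholCoeff (α : (ι → ℂ) →L[ℝ] ℂ) :
    ofCoeff (holCoeff α, antiholCoeff α) = α := by
  have hI (i : ι) : (Pi.single i Complex.I : ι → ℂ) = Complex.I • Pi.single i 1 := by
    rw [← Pi.single_smul, smul_eq_mul, mul_one]
  ext w
  have hw : w = ∑ i, ((w i).re • (Pi.single i 1 : ι → ℂ) +
      (w i).im • (Pi.single i Complex.I : ι → ℂ)) := by
    ext k
    simp [hI, Pi.single_apply, Finset.sum_add_distrib, Complex.re_add_im]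
  conv_rhs => rw [hw]
  simp only [ofCoeff_apply, map_sum, map_add, map_smul, dotProduct, ← Finset.sum_add_distrib,
    Pi.star_apply, holCoeff_apply, antiholCoeff_apply]
  refine Finset.sum_congr rfl fun i _ => ?_
  rw [← Complex.re_add_im (w i)]
  simp only [Complex.star_def, map_add, map_mul, Complex.conj_ofReal, Complex.conj_I,
    Complex.real_smul, Complex.add_re, Complex.add_im, Complex.ofReal_re, Complex.ofReal_im,
    Complex.re_ofReal_mul, Complex.im_ofReal_mul, Complex.I_re, Complex.I_im, mul_zero, mul_one,
    add_zero, zero_add]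
  linear_combination -((w i).im * α (Pi.single i Complex.I)) * Complex.I_mul_I

theorem covector_apply (α : (ι → ℂ) →L[ℝ] ℂ) (w : ι → ℂ) :
    α w = holCoeff α ⬝ᵥ w + antiholCoeff α ⬝ᵥ star w := by
  conv_lhs => rw [← ofCoeff_holCoeff_antiholCoeff α, ofCoeff_apply]

omit [Fintype ι] in
theorem antiholCoeff_eq_star_holCoeff (α : (ι → ℂ) →L[ℝ] ℂ) :
    antiholCoeff α = star (holCoeff (conjCovector α)) := by
  ext i
  simp [antiholCoeff_apply, holCoeff_apply, conjCovector]

end Covector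

theorem sum_smulRight_apply {ι E : Type*} [Fintype ι] [AddCommGroup E] [Module ℂ E]
    (A : Matrix ι ι ℂ) (f : ι → E →ₗ[ℂ] ℂ) (α β : E) :
    (∑ i, ∑ j, A i j • (f i).smulRight (f j)) α β =
      (fun i => f i α) ⬝ᵥ A *ᵥ (fun i => f i β) := by
  simp only [LinearMap.sum_apply, LinearMap.smul_apply, LinearMap.smulRight_apply, dotProduct,
    Matrix.mulVec, Finset.mul_sum, smul_eq_mul, mul_left_comm]

section OrbitCovector

variable {ι : Type*} [Fintype ι] {𝔤₀ : Type*} [LieRing 𝔤₀] [LieAlgebra ℝ 𝔤₀]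
  (e : Module.Basis ι ℝ 𝔤₀)

theorem realOrbitTangent_subset_complexOrbitTangent (z : ι → ℂ) :
    realOrbitTangent e z ⊆ complexOrbitTangent e z := by
  rintro _ ⟨x, rfl⟩
  exact ⟨_, rfl⟩

variable [DecidableEq ι]

theorem lieBivector_apply (z : ι → ℂ) (α β : (ι → ℂ) →L[ℝ] ℂ) :
    lieBivector e z α β = holCoeff α ⬝ᵥ poissonMatrix e z *ᵥ holCoeff β :=
  sum_smulRight_apply (poissonMatrix e z) dz α β

theorem lieBivectorConj_apply (z : ι → ℂ) (α β : (ι → ℂ) →L[ℝ] ℂ) :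
    lieBivectorConj e z α β = antiholCoeff α ⬝ᵥ poissonMatrix e (star z) *ᵥ antiholCoeff β := by
  rw [poissonMatrix_star]
  exact sum_smulRight_apply ((poissonMatrix e z).map conj) dzbar α β

theorem lieBivectorConj_eq_conj (z : ι → ℂ) (α β : (ι → ℂ) →L[ℝ] ℂ) :
    lieBivectorConj e z α β = conj (lieBivector e z (conjCovector α) (conjCovector β)) := by
  refine (lieBivectorConj_apply e z α β).trans
    (Eq.trans ?_ (congrArg conj (lieBivector_apply e z (conjCovector α) (conjCovector β))).symm)
  rw [antiholCoeff_eq_star_holCoeff, antiholCoeff_eq_star_holCoeff, poissonMatrix_star_mulVec,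
    Matrix.star_dotProduct_star, dotProduct_comm, Complex.star_def]

theorem covector_coadMatrix_mulVec (α : (ι → ℂ) →L[ℝ] ℂ) (z v : ι → ℂ) :
    α (coadMatrix e v *ᵥ z) = poissonMatrix e z *ᵥ holCoeff α ⬝ᵥ v +
      poissonMatrix e (star z) *ᵥ antiholCoeff α ⬝ᵥ star v := by
  rw [covector_apply, coadMatrix_mulVec, star_neg, ← poissonMatrix_star_mulVec, dotProduct_neg,
    dotProduct_neg, dotProduct_mulVec_of_transpose_eq_neg (poissonMatrix_transpose e z),
    dotProduct_mulVec_of_transpose_eq_neg (poissonMatrix_transpose e (star z)), neg_neg, neg_neg]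

theorem covector_vanishes_real_iff (α : (ι → ℂ) →L[ℝ] ℂ) (z : ι → ℂ) :
    (∀ v ∈ realOrbitTangent e z, α v = 0) ↔
      poissonMatrix e z *ᵥ holCoeff α + poissonMatrix e (star z) *ᵥ antiholCoeff α = 0 := by
  have star_ofReal (x : ι → ℝ) : star (fun i => (x i : ℂ)) = fun i => (x i : ℂ) := by ext i; simp
  simp only [realOrbitTangent, Set.forall_mem_range, covector_coadMatrix_mulVec, star_ofReal,
    ← add_dotProduct]
  refine ⟨fun h => funext fun i => ?_, fun h x => by rw [h, zero_dotProduct]⟩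
  simpa [Pi.single_apply, dotProduct, apply_ite Complex.ofReal] using h (Pi.single i 1)

theorem covector_vanishes_iff (α : (ι → ℂ) →L[ℝ] ℂ) (z : ι → ℂ) :
    (∀ v ∈ complexOrbitTangent e z, α v = 0) ↔
      poissonMatrix e z *ᵥ holCoeff α = 0 ∧ poissonMatrix e (star z) *ᵥ antiholCoeff α = 0 := by
  set q := (poissonMatrix e z *ᵥ holCoeff α, poissonMatrix e (star z) *ᵥ antiholCoeff α) with hq
  rw [← Prod.mk_eq_zero, ← hq, complexOrbitTangent, Set.forall_mem_range]
  have ofCoeff_q (v : ι → ℂ) : α (coadMatrix e v *ᵥ z) = ofCoeff q v :=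
    covector_coadMatrix_mulVec e α z v
  simp only [ofCoeff_q]
  refine ⟨fun h => ?_, fun h v => by rw [h, map_zero]; rfl⟩
  have h0 : ofCoeff q = 0 := ContinuousLinearMap.ext h
  ext1
  · rw [← holCoeff_ofCoeff q, h0, map_zero, Prod.fst_zero]
  · rw [← antiholCoeff_ofCoeff q, h0, map_zero, Prod.snd_zero]

end OrbitCovector

/-! ### Pencils of skew-symmetric matrices -/

theorem finrank_map_add_finrank_ker_inf {K E F : Type*} [DivisionRing K] [AddCommGroup E]
    [Module K E] [FiniteDimensional K E] [AddCommGroup F] [Module K F] (f : E →ₗ[K] F)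
    (S : Submodule K E) :
    Module.finrank K (S.map f) + Module.finrank K (LinearMap.ker f ⊓ S : Submodule K E) =
      Module.finrank K S := by
  rw [← LinearMap.finrank_range_add_finrank_ker (f.domRestrict S), LinearMap.range_domRestrict,
    LinearMap.ker_domRestrict, ← Submodule.finrank_map_subtype_eq S, Submodule.map_comap_subtype,
    inf_comm]

section Pencil

variable {ι K : Type*} [Fintype ι] [Field K] {C D : Matrix ι ι K}

theorem annihilates_range_inf_iff (hC : Cᵀ = -C) (hD : Dᵀ = -D) (q : ι → K) :
    (∀ a b, C *ᵥ a + D *ᵥ b = 0 → q ⬝ᵥ C *ᵥ a = 0) ↔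
      ∃ u v, C *ᵥ u = 0 ∧ D *ᵥ v = 0 ∧ u + v = q := by
  classical
  constructor
  · intro hq
    let E := dotProductEquiv K ι
    have mulVec_eq_zero {A : Matrix ι ι K} (hA : Aᵀ = -A) {χ : Module.Dual K (ι → K)}
        (hχ : χ ∈ (LinearMap.range A.mulVecLin).dualAnnihilator) : A *ᵥ E.symm χ = 0 := by
      refine dotProduct_eq_zero _ fun w => neg_eq_zero.1 ?_
      rw [← dotProduct_mulVec_of_transpose_eq_neg hA, ← dotProductEquiv_apply_apply,
        LinearEquiv.apply_symm_apply]
      exact (Submodule.mem_dualAnnihilator χ).1 hχ _ ⟨w, rfl⟩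
    have hmem : E q ∈
        (LinearMap.range C.mulVecLin ⊓ LinearMap.range D.mulVecLin).dualAnnihilator := by
      rw [Submodule.mem_dualAnnihilator]
      rintro _ ⟨⟨a, rfl⟩, ⟨b, hb⟩⟩
      refine hq a (-b) ?_
      rw [Matrix.mulVec_neg, ← Matrix.mulVecLin_apply, ← hb, Matrix.mulVecLin_apply, add_neg_cancel]
    rw [Subspace.dualAnnihilator_inf_eq, Submodule.mem_sup] at hmem
    obtain ⟨φ, hφ, ψ, hψ, hsum⟩ := hmem
    exact ⟨E.symm φ, E.symm ψ, mulVec_eq_zero hC hφ, mulVec_eq_zero hD hψ,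
      by rw [← map_add, hsum, E.symm_apply_apply]⟩
  · rintro ⟨u, v, hu, hv, rfl⟩ a b hab
    rw [add_dotProduct, dotProduct_mulVec_of_transpose_eq_neg hC, hu,
      eq_neg_of_add_eq_zero_left hab, dotProduct_neg, dotProduct_mulVec_of_transpose_eq_neg hD, hv]
    simp

variable {V : Type*} [AddCommGroup V] [Module K V] {A B : V →ₗ[K] ι → K}

/-- `V` is identified by `A` and `B` with the space of the pairs `(a, b)` such that
`C a + D b = 0`, modulo the pairs such that `C a = 0` and `D b = 0`. Equivalently, `C ∘ A = -D ∘ B`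
is an isomorphism of `V` onto the intersection of the images of `C` and `D`. -/
structure IsPencilReduction (C D : Matrix ι ι K) (A B : V →ₗ[K] ι → K) : Prop where
  skew_left : Cᵀ = -C
  skew_right : Dᵀ = -D
  rel : ∀ α, C *ᵥ A α + D *ᵥ B α = 0
  inj : ∀ α, C *ᵥ A α = 0 → α = 0
  surj : ∀ a b, C *ᵥ a + D *ᵥ b = 0 → ∃ α, C *ᵥ A α = C *ᵥ a

/-- The pencil of forms on `V` induced by the forms with matrices `C` and `D`. -/
noncomputable def pencilForm (C D : Matrix ι ι K) (A B : V →ₗ[K] ι → K) (l : K × K) :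
    V →ₗ[K] V →ₗ[K] K :=
  l.1 • (dotProductBilin K K).compl₁₂ A (C.mulVecLin ∘ₗ A) +
    l.2 • (dotProductBilin K K).compl₁₂ B (D.mulVecLin ∘ₗ B)

theorem pencilForm_apply (l : K × K) (α β : V) : pencilForm C D A B l α β =
    l.1 * (A α ⬝ᵥ C *ᵥ A β) + l.2 * (B α ⬝ᵥ D *ᵥ B β) := rfl

theorem pencilForm_swap (l : K × K) : pencilForm D C B A l.swap = pencilForm C D A B l :=
  add_comm _ _

namespace IsPencilReduction

theorem mulVec_right (h : IsPencilReduction C D A B) (α : V) : D *ᵥ B α = -(C *ᵥ A α) :=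
  eq_neg_of_add_eq_zero_right (h.rel α)

theorem symm (h : IsPencilReduction C D A B) : IsPencilReduction D C B A where
  skew_left := h.skew_right
  skew_right := h.skew_left
  rel α := by rw [add_comm, h.rel]
  inj α hα := h.inj α (by rw [← neg_eq_zero, ← h.mulVec_right, hα])
  surj b a hab := by
    obtain ⟨α, hα⟩ := h.surj a b (by rw [add_comm, hab])
    exact ⟨α, by rw [h.mulVec_right, hα, eq_neg_of_add_eq_zero_right hab, neg_neg]⟩

theorem injective (h : IsPencilReduction C D A B) : Function.Injective (C.mulVecLin ∘ₗ A) :=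
  (injective_iff_map_eq_zero _).2 h.inj

theorem finite (h : IsPencilReduction C D A B) : Module.Finite K V :=
  Module.Finite.of_injective _ h.injective

theorem pencilForm_eq (h : IsPencilReduction C D A B) (l : K × K) (α β : V) :
    pencilForm C D A B l α β = (l.1 • A α - l.2 • B α) ⬝ᵥ C *ᵥ A β := by
  rw [pencilForm_apply, h.mulVec_right, sub_dotProduct, smul_dotProduct, smul_dotProduct,
    dotProduct_neg, mul_neg, ← sub_eq_add_neg, smul_eq_mul, smul_eq_mul]

theorem pencilForm_eq_zero_iff (h : IsPencilReduction C D A B) {l : K × K} (hl : l.1 ≠ 0) (α : V) :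
    pencilForm C D A B l α = 0 ↔
      ∃ t, (l.2 • C + l.1 • D) *ᵥ t = 0 ∧ C *ᵥ A α = C *ᵥ t := by
  have annihilates_iff : pencilForm C D A B l α = 0 ↔
      ∀ a b, C *ᵥ a + D *ᵥ b = 0 → (l.1 • A α - l.2 • B α) ⬝ᵥ C *ᵥ a = 0 := by
    simp only [LinearMap.ext_iff, h.pencilForm_eq, LinearMap.zero_apply]
    refine ⟨fun h0 a b hab => ?_, fun h0 β => h0 _ _ (h.rel β)⟩
    obtain ⟨β, hβ⟩ := h.surj a b hab
    rw [← hβ, h0]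
  simp only [annihilates_iff, annihilates_range_inf_iff h.skew_left h.skew_right,
    Matrix.add_mulVec, Matrix.smul_mulVec]
  constructor
  · rintro ⟨u, v, hu, hv, huv⟩
    have hCt : C *ᵥ (A α - l.1⁻¹ • u) = C *ᵥ A α := by
      rw [Matrix.mulVec_sub, Matrix.mulVec_smul, hu, smul_zero, sub_zero]
    have ht : l.1 • (A α - l.1⁻¹ • u) = l.2 • B α + v := by
      rw [smul_sub, smul_inv_smul₀ hl, sub_eq_iff_eq_add, add_assoc, add_comm v u, huv,
        add_sub_cancel]
    refine ⟨A α - l.1⁻¹ • u, ?_, hCt.symm⟩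
    rw [hCt, ← Matrix.mulVec_smul D, ht, Matrix.mulVec_add, hv, Matrix.mulVec_smul, h.mulVec_right,
      smul_neg, add_zero, add_neg_cancel]
  · rintro ⟨t, ht, hCt⟩
    refine ⟨l.1 • (A α - t), l.1 • t - l.2 • B α, ?_, ?_, by rw [smul_sub, sub_add_sub_cancel]⟩
    · rw [Matrix.mulVec_smul, Matrix.mulVec_sub, hCt, sub_self, smul_zero]
    · rw [Matrix.mulVec_sub, Matrix.mulVec_smul, Matrix.mulVec_smul, h.mulVec_right, hCt, smul_neg,
        sub_neg_eq_add, add_comm, ht]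

theorem map_ker_pencilForm (h : IsPencilReduction C D A B) {l : K × K} (hl : l.1 ≠ 0)
    (hker : ∀ v, D *ᵥ v = 0 → ∃ w, C *ᵥ v + D *ᵥ w = 0) :
    (LinearMap.ker (pencilForm C D A B l)).map (C.mulVecLin ∘ₗ A) =
      (LinearMap.ker (l.2 • C + l.1 • D).mulVecLin).map C.mulVecLin := by
  ext w
  constructor
  · rintro ⟨α, hα, rfl⟩
    obtain ⟨t, ht, hCt⟩ := (h.pencilForm_eq_zero_iff hl α).1 hα
    exact ⟨t, ht, hCt.symm⟩
  · rintro ⟨t, ht, rfl⟩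
    obtain ⟨s, hs⟩ : ∃ s, C *ᵥ t + D *ᵥ s = 0 := by
      have ht' : l.2 • C *ᵥ t + l.1 • D *ᵥ t = 0 := by
        rw [← Matrix.smul_mulVec, ← Matrix.smul_mulVec, ← Matrix.add_mulVec]
        exact ht
      by_cases h2 : l.2 = 0
      · rw [h2, zero_smul, zero_add] at ht'
        exact hker t ((smul_eq_zero.1 ht').resolve_left hl)
      · refine ⟨(l.2⁻¹ * l.1) • t, ?_⟩
        rw [Matrix.mulVec_smul, mul_smul, eq_neg_of_add_eq_zero_right ht', smul_neg,
          inv_smul_smul₀ h2, add_neg_cancel]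
    obtain ⟨α, hα⟩ := h.surj t s hs
    exact ⟨α, (h.pencilForm_eq_zero_iff hl α).2 ⟨t, ht, hα⟩, hα⟩

theorem finrank_ker_pencilForm_of_left (h : IsPencilReduction C D A B) {l : K × K} (hl : l.1 ≠ 0)
    (hker : ∀ v, D *ᵥ v = 0 → ∃ w, C *ᵥ v + D *ᵥ w = 0) :
    Module.finrank K (LinearMap.ker (pencilForm C D A B l)) +
        Module.finrank K (LinearMap.ker C.mulVecLin ⊓ LinearMap.ker D.mulVecLin : Submodule K _) =
      Module.finrank K (LinearMap.ker (l.2 • C + l.1 • D).mulVecLin) := by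
  have hinf : LinearMap.ker C.mulVecLin ⊓ LinearMap.ker D.mulVecLin =
      LinearMap.ker C.mulVecLin ⊓ LinearMap.ker (l.2 • C + l.1 • D).mulVecLin := by
    ext t
    simp only [Submodule.mem_inf, LinearMap.mem_ker, Matrix.mulVecLin_apply, Matrix.add_mulVec,
      Matrix.smul_mulVec]
    refine and_congr_right fun hC => ?_
    rw [hC, smul_zero, zero_add, smul_eq_zero, or_iff_right hl]
  rw [(Submodule.equivMapOfInjective _ h.injective _).finrank_eq, h.map_ker_pencilForm hl hker,
    hinf, finrank_map_add_finrank_ker_inf]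

theorem finrank_ker_pencilForm (h : IsPencilReduction C D A B)
    (hD : ∀ v, D *ᵥ v = 0 → ∃ w, C *ᵥ v + D *ᵥ w = 0)
    (hC : ∀ w, C *ᵥ w = 0 → ∃ v, C *ᵥ v + D *ᵥ w = 0) {l : K × K} (hl : l ≠ 0) :
    Module.finrank K (LinearMap.ker (pencilForm C D A B l)) +
        Module.finrank K (LinearMap.ker C.mulVecLin ⊓ LinearMap.ker D.mulVecLin : Submodule K _) =
      Module.finrank K (LinearMap.ker (l.2 • C + l.1 • D).mulVecLin) := by
  by_cases h1 : l.1 = 0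
  · have h2 : l.swap.1 ≠ 0 := fun h2 => hl (Prod.ext h1 h2)
    have := h.symm.finrank_ker_pencilForm_of_left h2 fun w hw =>
      (hC w hw).imp fun v hv => (add_comm _ _).trans hv
    rwa [pencilForm_swap, inf_comm, add_comm (l.swap.2 • D)] at this
  · exact h.finrank_ker_pencilForm_of_left h1 hD

theorem finrank_range_pencilForm_eq (h : IsPencilReduction C D A B)
    (hD : ∀ v, D *ᵥ v = 0 → ∃ w, C *ᵥ v + D *ᵥ w = 0)
    (hC : ∀ w, C *ᵥ w = 0 → ∃ v, C *ᵥ v + D *ᵥ w = 0) {r : ℕ}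
    (hr : ∀ l : K × K, l ≠ 0 → Module.finrank K (LinearMap.ker (l.1 • C + l.2 • D).mulVecLin) = r)
    {l l' : K × K} (hl : l ≠ 0) (hl' : l' ≠ 0) :
    Module.finrank K (LinearMap.range (pencilForm C D A B l)) =
      Module.finrank K (LinearMap.range (pencilForm C D A B l')) := by
  have := h.finite
  have swap_ne_zero {l : K × K} (hl : l ≠ 0) : l.swap ≠ 0 :=
    fun h0 => hl (Prod.swap_injective h0)
  have ker_l := h.finrank_ker_pencilForm hD hC hl
  have ker_l' := h.finrank_ker_pencilForm hD hC hl'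
  have const_l := hr _ (swap_ne_zero hl)
  have const_l' := hr _ (swap_ne_zero hl')
  have rank_l := LinearMap.finrank_range_add_finrank_ker (pencilForm C D A B l)
  have rank_l' := LinearMap.finrank_range_add_finrank_ker (pencilForm C D A B l')
  simp only [Prod.fst_swap, Prod.snd_swap] at const_l const_l'
  omega

end IsPencilReduction

end Pencil

/-! ### Reduction at a point -/

/-- Composition of covectors with a linear map. -/
noncomputable def pullCovector {E F : Type*} [NormedAddCommGroup E] [NormedSpace ℝ E]
    [NormedAddCommGroup F] [NormedSpace ℝ F] (P : E →L[ℝ] F) :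
    (F →L[ℝ] ℂ) →ₗ[ℂ] (E →L[ℝ] ℂ) where
  toFun α := α.comp P
  map_add' _ _ := rfl
  map_smul' _ _ := rfl

section PullCovector

variable {E F G : Type*} [NormedAddCommGroup E] [NormedSpace ℝ E]
  [NormedAddCommGroup F] [NormedSpace ℝ F] [NormedAddCommGroup G] [NormedSpace ℝ G]

theorem pullCovector_apply (P : E →L[ℝ] F) (α : F →L[ℝ] ℂ) (v : E) :
    pullCovector P α v = α (P v) := rfl

theorem pullCovector_injective {P : E →L[ℝ] F} (hP : Function.Surjective P) :
    Function.Injective (pullCovector P) := fun _ _ h =>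
  ContinuousLinearMap.ext (hP.forall.2 (ContinuousLinearMap.ext_iff.1 h))

theorem exists_pullCovector_eq [FiniteDimensional ℝ F] {P : E →L[ℝ] F}
    (hP : Function.Surjective P) {α : E →L[ℝ] ℂ} (hα : ∀ v, P v = 0 → α v = 0) :
    ∃ β, pullCovector P β = α := by
  obtain ⟨S, hS⟩ := P.exists_rightInverse_of_surjective (LinearMap.range_eq_top.2 hP)
  refine ⟨α.comp S, ContinuousLinearMap.ext fun v => ?_⟩
  have hPS (w : F) : P (S w) = w := congrArg (· w) hS
  have : α (S (P v) - v) = 0 := hα _ (by rw [map_sub, hPS, sub_self])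
  rwa [map_sub, sub_eq_zero] at this

variable [FiniteDimensional ℝ F]

/-- Extension of covectors along an injective linear map, by means of a chosen left inverse of the
map. -/
noncomputable def extendCovector (J : E →L[ℝ] F) : (E →L[ℝ] ℂ) →ₗ[ℂ] (F →L[ℝ] ℂ) :=
  pullCovector (LinearMap.toContinuousLinearMap (J : E →ₗ[ℝ] F).leftInverse)

theorem pullCovector_extendCovector {J : E →L[ℝ] F} (hJ : Function.Injective J)
    (α : E →L[ℝ] ℂ) : pullCovector J (extendCovector J α) = α :=
  ContinuousLinearMap.ext fun v =>
    congrArg α (LinearMap.leftInverse_apply_of_inj (LinearMap.ker_eq_bot.2 hJ) v)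

/-- The form induced by `B` on the covectors on `G`, where the covectors on `E` are regarded as
covectors on `F` modulo those that vanish on the image of `J`. -/
noncomputable def reducedForm (B : (F →L[ℝ] ℂ) →ₗ[ℂ] (F →L[ℝ] ℂ) →ₗ[ℂ] ℂ) (J : E →L[ℝ] F)
    (P : E →L[ℝ] G) : (G →L[ℝ] ℂ) →ₗ[ℂ] (G →L[ℝ] ℂ) →ₗ[ℂ] ℂ :=
  B.compl₁₂ (extendCovector J ∘ₗ pullCovector P) (extendCovector J ∘ₗ pullCovector P)

end PullCovector

section Pointwise

variable {ι : Type*} [Fintype ι] {𝔤₀ : Type*} [LieRing 𝔤₀] [LieAlgebra ℝ 𝔤₀]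
  (e : Module.Basis ι ℝ 𝔤₀)
  {T : Type*} [NormedAddCommGroup T] [NormedSpace ℝ T]
  {Q : Type*} [NormedAddCommGroup Q] [NormedSpace ℝ Q]

/-- `J` is an isomorphism onto the tangent space of the complex orbit at `z`, and `P` is a
projection along the tangent space of the real orbit. -/
structure IsReductionAt (z : ι → ℂ) (J : T →L[ℝ] (ι → ℂ)) (P : T →L[ℝ] Q) : Prop where
  inj : Function.Injective J
  range : Set.range J = complexOrbitTangent e z
  surj : Function.Surjective P
  ker : ∀ v, P v = 0 ↔ J v ∈ realOrbitTangent e z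

variable {e} {z : ι → ℂ} {J : T →L[ℝ] (ι → ℂ)} {P : T →L[ℝ] Q}

theorem IsReductionAt.pullCovector_vanishes (h : IsReductionAt e z J P) {α : Q →L[ℝ] ℂ}
    {β : (ι → ℂ) →L[ℝ] ℂ} (hβ : pullCovector J β = pullCovector P α) :
    ∀ w ∈ realOrbitTangent e z, β w = 0 := fun w hw => by
  obtain ⟨v, rfl⟩ : w ∈ Set.range J := h.range ▸ realOrbitTangent_subset_complexOrbitTangent e z hw
  rw [← pullCovector_apply, hβ, pullCovector_apply, (h.ker v).2 hw, map_zero]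

variable [DecidableEq ι]

theorem pullCovector_eq_iff_of_range (hJ : Set.range J = complexOrbitTangent e z)
    {α β : (ι → ℂ) →L[ℝ] ℂ} : pullCovector J α = pullCovector J β ↔
      poissonMatrix e z *ᵥ holCoeff α = poissonMatrix e z *ᵥ holCoeff β ∧
      poissonMatrix e (star z) *ᵥ antiholCoeff α = poissonMatrix e (star z) *ᵥ antiholCoeff β := by
  have h := covector_vanishes_iff e (α - β) z
  rw [map_sub, map_sub, Matrix.mulVec_sub, Matrix.mulVec_sub, sub_eq_zero, sub_eq_zero, ← hJ] at h
  rw [← h, Set.forall_mem_range, ← sub_eq_zero, ← map_sub, ContinuousLinearMap.ext_iff]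
  rfl

omit [DecidableEq ι] in
theorem pullCovector_ofCoeff_congr (hJ : Set.range J = complexOrbitTangent e z)
    {q q' : (ι → ℂ) × (ι → ℂ)} (h1 : poissonMatrix e z *ᵥ q.1 = poissonMatrix e z *ᵥ q'.1)
    (h2 : poissonMatrix e (star z) *ᵥ q.2 = poissonMatrix e (star z) *ᵥ q'.2) :
    pullCovector J (ofCoeff q) = pullCovector J (ofCoeff q') := by
  classical
  rw [pullCovector_eq_iff_of_range hJ]
  simp only [holCoeff_ofCoeff, antiholCoeff_ofCoeff]
  exact ⟨h1, h2⟩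

theorem lieBivector_congr (hJ : Set.range J = complexOrbitTangent e z)
    {α α' β β' : (ι → ℂ) →L[ℝ] ℂ} (hα : pullCovector J α = pullCovector J α')
    (hβ : pullCovector J β = pullCovector J β') :
    lieBivector e z α β = lieBivector e z α' β' := by
  have skew := dotProduct_mulVec_of_transpose_eq_neg (poissonMatrix_transpose e z)
  rw [lieBivector_apply, lieBivector_apply, ((pullCovector_eq_iff_of_range hJ).1 hβ).1, skew,
    ((pullCovector_eq_iff_of_range hJ).1 hα).1, ← skew]

theorem lieBivectorConj_congr (hJ : Set.range J = complexOrbitTangent e z)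
    {α α' β β' : (ι → ℂ) →L[ℝ] ℂ} (hα : pullCovector J α = pullCovector J α')
    (hβ : pullCovector J β = pullCovector J β') :
    lieBivectorConj e z α β = lieBivectorConj e z α' β' := by
  rw [lieBivectorConj_eq_conj, lieBivectorConj_eq_conj]
  exact congrArg conj (lieBivector_congr hJ (congrArg conjCovector hα) (congrArg conjCovector hβ))

/-- The pencil spanned by the reductions at `z` of the linear Poisson bivector and of its
conjugate. -/
noncomputable def reducedPencil (e : Module.Basis ι ℝ 𝔤₀) (z : ι → ℂ) (J : T →L[ℝ] (ι → ℂ))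
    (P : T →L[ℝ] Q) (l : ℂ × ℂ) : (Q →L[ℝ] ℂ) →ₗ[ℂ] (Q →L[ℝ] ℂ) →ₗ[ℂ] ℂ :=
  l.1 • reducedForm (lieBivector e z) J P + l.2 • reducedForm (lieBivectorConj e z) J P

theorem reducedPencil_eq_pencilForm (l : ℂ × ℂ) : reducedPencil e z J P l =
    pencilForm (poissonMatrix e z) (poissonMatrix e (star z))
      (holCoeff ∘ₗ extendCovector J ∘ₗ pullCovector P)
      (antiholCoeff ∘ₗ extendCovector J ∘ₗ pullCovector P) l :=
  LinearMap.ext₂ fun α β => congrArg₂ (l.1 * · + l.2 * ·)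
    (lieBivector_apply e z (extendCovector J (pullCovector P α))
      (extendCovector J (pullCovector P β)))
    (lieBivectorConj_apply e z (extendCovector J (pullCovector P α))
      (extendCovector J (pullCovector P β)))

theorem pullCovector_ofCoeff_extendCovector (hJ : Function.Injective J) (α : T →L[ℝ] ℂ) :
    pullCovector J (ofCoeff (holCoeff (extendCovector J α), antiholCoeff (extendCovector J α))) =
      α := by
  rw [ofCoeff_holCoeff_antiholCoeff, pullCovector_extendCovector hJ]

theorem IsReductionAt.isPencilReduction [FiniteDimensional ℝ Q] (h : IsReductionAt e z J P) :
    IsPencilReduction (poissonMatrix e z) (poissonMatrix e (star z))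
      (holCoeff ∘ₗ extendCovector J ∘ₗ pullCovector P)
      (antiholCoeff ∘ₗ extendCovector J ∘ₗ pullCovector P) := by
  have rel (α : Q →L[ℝ] ℂ) :
      poissonMatrix e z *ᵥ holCoeff (extendCovector J (pullCovector P α)) +
        poissonMatrix e (star z) *ᵥ antiholCoeff (extendCovector J (pullCovector P α)) = 0 :=
    (covector_vanishes_real_iff e _ z).1
      (h.pullCovector_vanishes (pullCovector_extendCovector h.inj _))
  refine ⟨poissonMatrix_transpose e z, poissonMatrix_transpose e (star z), rel,
    fun α hα => ?_, fun a b hab => ?_⟩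
  · have hα' := rel α
    rw [LinearMap.comp_apply, LinearMap.comp_apply] at hα
    rw [hα, zero_add] at hα'
    have h0 : pullCovector J (extendCovector J (pullCovector P α)) = pullCovector J 0 := by
      rw [pullCovector_eq_iff_of_range h.range, map_zero, map_zero, Matrix.mulVec_zero,
        Matrix.mulVec_zero]
      exact ⟨hα, hα'⟩
    rw [pullCovector_extendCovector h.inj, map_zero] at h0
    exact pullCovector_injective h.surj (h0.trans (map_zero _).symm)
  · have hv := (covector_vanishes_real_iff e (ofCoeff (a, b)) z).2
      (by rw [holCoeff_ofCoeff, antiholCoeff_ofCoeff, hab])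
    obtain ⟨α, hα⟩ := exists_pullCovector_eq h.surj (α := pullCovector J (ofCoeff (a, b)))
      fun v hv' => hv _ ((h.ker v).1 hv')
    rw [← pullCovector_extendCovector h.inj (pullCovector P α),
      pullCovector_eq_iff_of_range h.range, holCoeff_ofCoeff] at hα
    exact ⟨α, hα.1⟩

end Pointwise

/-! ### Holomorphic functions of several variables -/

section Holomorphic

open Metric

variable {E : Type*} [NormedAddCommGroup E] [NormedSpace ℂ E] {f : E → ℂ} {U : Set E}

theorem exists_norm_fderiv_le_of_differentiableOn (hU : IsOpen U) (hf : DifferentiableOn ℂ f U)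
    {z : E} (hz : z ∈ U) :
    ∃ R > 0, ball z R ⊆ U ∧ ∃ C, ∀ x ∈ ball z R, ‖fderiv ℂ f x‖ ≤ C := by
  obtain ⟨r, hr, hball⟩ := Metric.isOpen_iff.1
    (hf.continuousOn.isOpen_inter_preimage hU ((isOpen_ball : IsOpen (ball (f z) (1 / 2))))) z
    ⟨hz, mem_ball_self one_half_pos⟩
  have ball_half_subset {x : E} (hx : x ∈ ball z (r / 2)) : ball x (r / 2) ⊆ ball z r :=
    ball_subset_ball' (by linarith [mem_ball.1 hx])
  refine ⟨r / 2, half_pos hr, fun x hx => ?_, 1 / (r / 2), fun x hx => ?_⟩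
  · exact (hball (ball_half_subset hx (mem_ball_self (half_pos hr)))).1
  · refine Complex.norm_fderiv_le_div_of_mapsTo_ball
      (hf.mono fun y hy => (hball (ball_half_subset hx hy)).1) (fun y hy => ?_) (half_pos hr)
    have hfy : f y ∈ ball (f z) (1 / 2) := (hball (ball_half_subset hx hy)).2
    have hfx : f x ∈ ball (f z) (1 / 2) :=
      (hball (ball_half_subset hx (mem_ball_self (half_pos hr)))).2
    rw [mem_ball] at hfx hfy
    rw [mem_closedBall]
    linarith [dist_triangle_right (f y) (f x) (f z)]

theorem fderiv_apply_eq_circleIntegral (hU : IsOpen U) (hf : DifferentiableOn ℂ f U) {x w : E}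
    {δ : ℝ} (hδ : 0 < δ) (hmem : ∀ t ∈ closedBall (0 : ℂ) δ, x + t • w ∈ U) :
    fderiv ℂ f x w = (2 * Real.pi * Complex.I)⁻¹ *
      ∮ t in C(0, δ), t⁻¹ ^ 2 * f (x + t • w) := by
  have hline (t : ℂ) : HasDerivAt (fun t : ℂ => x + t • w) w t := by
    simpa using ((hasDerivAt_id t).smul_const w).const_add x
  have hcomp {t : ℂ} (ht : t ∈ closedBall (0 : ℂ) δ) :
      HasDerivAt (fun t : ℂ => f (x + t • w)) (fderiv ℂ f (x + t • w) w) t :=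
    (hf.differentiableAt (hU.mem_nhds (hmem t ht))).hasFDerivAt.comp_hasDerivAt t (hline t)
  have hon : DifferentiableOn ℂ (fun t : ℂ => f (x + t • w)) (closedBall 0 δ) := fun t ht =>
    (hcomp ht).differentiableAt.differentiableWithinAt
  have cauchy := hon.deriv_eq_smul_circleIntegral hδ
  rw [(hcomp (mem_closedBall_self hδ.le)).deriv, zero_smul, add_zero] at cauchy
  rw [eq_inv_mul_iff_mul_eq₀ Complex.two_pi_I_ne_zero, ← smul_eq_mul, ← cauchy]
  simp only [sub_zero, smul_eq_mul, one_div, inv_pow]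

theorem differentiableAt_circleIntegral_comp_add [FiniteDimensional ℂ E] (hU : IsOpen U)
    (hf : DifferentiableOn ℂ f U) {C : ℝ} (hC : ∀ x ∈ U, ‖fderiv ℂ f x‖ ≤ C) {k : ℂ → ℂ}
    {γ : ℂ → E} {δ R : ℝ} {z : E} (hδ : 0 < δ) (hk : ContinuousOn k (sphere 0 δ))
    (hγ : Continuous γ) (hR : 0 < R) (hmem : ∀ x ∈ ball z R, ∀ t ∈ sphere (0 : ℂ) δ, x + γ t ∈ U) :
    DifferentiableAt ℂ (fun x => ∮ t in C(0, δ), k t * f (x + γ t)) z := by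
  borelize E
  borelize (E →L[ℂ] ℂ)
  have : ProperSpace (E →L[ℂ] ℂ) := FiniteDimensional.proper ℂ _
  have hsphere (θ : ℝ) : circleMap 0 δ θ ∈ sphere (0 : ℂ) δ := circleMap_mem_sphere 0 hδ.le θ
  have hmemU {x : E} (hx : x ∈ ball z R) (θ : ℝ) : x + γ (circleMap 0 δ θ) ∈ U :=
    hmem x hx _ (hsphere θ)
  have hfU {y : E} (hy : y ∈ U) : DifferentiableAt ℂ f y := hf.differentiableAt (hU.mem_nhds hy)
  have hγc : Continuous fun θ => γ (circleMap 0 δ θ) := hγ.comp (continuous_circleMap 0 δ)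
  let κ : ℝ → ℂ := fun θ => deriv (circleMap 0 δ) θ * k (circleMap 0 δ θ)
  have hκ : Continuous κ := by
    simp only [κ, deriv_circleMap]
    exact ((continuous_circleMap 0 δ).mul continuous_const).mul
      (hk.comp_continuous (continuous_circleMap 0 δ) hsphere)
  have hcont {x : E} (hx : x ∈ ball z R) :
      Continuous fun θ : ℝ => κ θ * f (x + γ (circleMap 0 δ θ)) :=
    hκ.mul (hf.continuousOn.comp_continuous (continuous_const.add hγc) (hmemU hx))
  have hderiv := intervalIntegral.hasFDerivAt_integral_of_dominated_of_fderiv_le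
    (μ := MeasureTheory.volume) (a := 0) (b := 2 * Real.pi)
    (F := fun x θ => κ θ * f (x + γ (circleMap 0 δ θ)))
    (F' := fun x θ => κ θ • fderiv ℂ f (x + γ (circleMap 0 δ θ)))
    (bound := fun θ => ‖κ θ‖ * C) (ball_mem_nhds z hR)
    (by filter_upwards [ball_mem_nhds z hR] with x hx using (hcont hx).aestronglyMeasurable)
    ((hcont (mem_ball_self hR)).intervalIntegrable _ _)
    (hκ.aestronglyMeasurable.smul
      ((measurable_fderiv ℂ f).comp (continuous_const.add hγc).measurable).aestronglyMeasurable)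
    (.of_forall fun θ _ x hx => by
      rw [norm_smul]
      exact mul_le_mul_of_nonneg_left (hC _ (hmemU hx θ)) (norm_nonneg _))
    ((hκ.norm.mul continuous_const).intervalIntegrable _ _)
    (.of_forall fun θ _ x hx =>
      ((hfU (hmemU hx θ)).hasFDerivAt.comp x ((hasFDerivAt_id x).add_const _)).const_mul (κ θ))
  refine hderiv.differentiableAt.congr_of_eventuallyEq (.of_forall fun x => ?_)
  simp only [circleIntegral, κ, smul_eq_mul, mul_assoc]

theorem differentiableOn_fderiv_apply [FiniteDimensional ℂ E] (hU : IsOpen U)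
    (hf : DifferentiableOn ℂ f U) (w : E) : DifferentiableOn ℂ (fun x => fderiv ℂ f x w) U := by
  intro z hz
  refine DifferentiableAt.differentiableWithinAt ?_
  obtain ⟨R, hR, hball, C, hC⟩ := exists_norm_fderiv_le_of_differentiableOn hU hf hz
  replace hf := hf.mono hball
  obtain ⟨δ, hδ, hδw⟩ : ∃ δ > 0, δ * ‖w‖ < R / 2 := by
    refine ⟨R / 2 / (‖w‖ + 1), by positivity, ?_⟩
    rw [div_mul_eq_mul_div, div_lt_iff₀ (by positivity)]
    exact mul_lt_mul_of_pos_left (lt_add_one _) (half_pos hR)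
  have hmem (x : E) (hx : x ∈ ball z (R / 2)) (t : ℂ) (ht : t ∈ closedBall (0 : ℂ) δ) :
      x + t • w ∈ ball z R := by
    rw [mem_ball_iff_norm] at hx ⊢
    have htw : ‖t • w‖ ≤ δ * ‖w‖ := by
      rw [norm_smul]
      exact mul_le_mul_of_nonneg_right (mem_closedBall_zero_iff.1 ht) (norm_nonneg w)
    rw [add_sub_right_comm]
    linarith [norm_add_le (x - z) (t • w)]
  have inv_continuousOn : ContinuousOn (fun t : ℂ => t⁻¹ ^ 2) (sphere 0 δ) :=
    (continuousOn_id.inv₀ fun t ht => ne_of_mem_sphere ht hδ.ne').pow 2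
  refine ((differentiableAt_circleIntegral_comp_add isOpen_ball hf hC hδ inv_continuousOn
    (continuous_id.smul continuous_const) (half_pos hR)
    fun x hx t ht => hmem x hx t (sphere_subset_closedBall ht)).const_mul
      (2 * Real.pi * Complex.I)⁻¹).congr_of_eventuallyEq ?_
  filter_upwards [ball_mem_nhds z (half_pos hR)] with x hx
  exact fderiv_apply_eq_circleIntegral isOpen_ball hf hδ (hmem x hx)

theorem contDiffOn_of_isOpen_of_differentiableOn [FiniteDimensional ℂ E] (hU : IsOpen U)
    (hf : DifferentiableOn ℂ f U) : ContDiffOn ℂ ∞ f U := by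
  rw [contDiffOn_infty]
  intro n
  induction n generalizing f with
  | zero => exact contDiffOn_zero.2 hf.continuousOn
  | succ n ih =>
    push_cast
    refine contDiffOn_succ_of_fderiv_apply hf (by simp) fun y => ?_
    refine (ih (differentiableOn_fderiv_apply hU hf y)).congr fun x hx => ?_
    rw [fderivWithin_of_isOpen hU hx]

end Holomorphic

/-! ### The maps `φ_l` -/

section Phi

variable {ι : Type*} {W : Set (ι → ℂ)} {g : (ι → ℂ) → ℂ} {z : ι → ℂ}

/-- `φ_l` as a real-linear map. -/
noncomputable def phiCLM (l : ℂ × ℂ) : (ι → ℂ) →L[ℝ] (ι → ℂ) :=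
  l.1 • .id ℝ (ι → ℂ) + l.2 • (starL' ℝ : (ι → ℂ) ≃L[ℝ] (ι → ℂ)).toContinuousLinearMap

theorem hasFDerivAt_phi (l : ℂ × ℂ) (z : ι → ℂ) : HasFDerivAt (phi l) (phiCLM l) z :=
  (phiCLM l).hasFDerivAt

theorem contDiff_phi [Fintype ι] (l : ℂ × ℂ) : ContDiff ℝ ∞ (phi l : (ι → ℂ) → ι → ℂ) :=
  (phiCLM l : (ι → ℂ) →L[ℝ] (ι → ℂ)).contDiff

theorem contDiffAt_of_isOpen_of_differentiableOn [Fintype ι] (hW : IsOpen W)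
    (hg : DifferentiableOn ℂ g W) (hz : z ∈ W) : ContDiffAt ℝ ∞ g z :=
  ((contDiffOn_of_isOpen_of_differentiableOn hW hg).contDiffAt
    (hW.mem_nhds hz)).restrict_scalars ℝ

theorem contDiffAt_comp_phi [Fintype ι] (hW : IsOpen W) (hg : DifferentiableOn ℂ g W) (l : ℂ × ℂ)
    (hz : phi l z ∈ W) : ContDiffAt ℝ ∞ (g ∘ phi l) z :=
  (contDiffAt_of_isOpen_of_differentiableOn hW hg hz).comp z (contDiff_phi l).contDiffAt

end Phi

/-! ### Holomorphic Casimir functions -/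

section HolGrad

variable {ι : Type*} [DecidableEq ι] {W : Set (ι → ℂ)} {g : (ι → ℂ) → ℂ} {z : ι → ℂ}

/-- The holomorphic gradient `(∂g/∂z_i)_i`. -/
noncomputable def holGrad (g : (ι → ℂ) → ℂ) (z : ι → ℂ) : ι → ℂ := fun i => holPartial g i z

theorem differentiableOn_holGrad [Finite ι] (hW : IsOpen W) (hg : DifferentiableOn ℂ g W) :
    DifferentiableOn ℂ (holGrad g) W :=
  have := Fintype.ofFinite ι
  differentiableOn_pi.2 fun _ => differentiableOn_fderiv_apply hW hg _

theorem hasFDerivAt_holGrad [Finite ι] (hW : IsOpen W) (hg : DifferentiableOn ℂ g W)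
    (hz : z ∈ W) : HasFDerivAt (holGrad g) (fderiv ℂ (holGrad g) z) z :=
  ((differentiableOn_holGrad hW hg).differentiableAt (hW.mem_nhds hz)).hasFDerivAt

variable [Fintype ι]

theorem fderiv_apply_eq_holGrad_dotProduct (g : (ι → ℂ) → ℂ) (z w : ι → ℂ) :
    fderiv ℂ g z w = holGrad g z ⬝ᵥ w := by
  conv_lhs => rw [pi_eq_sum_univ' w]
  simp only [map_sum, map_smul, smul_eq_mul, dotProduct, holGrad, holPartial, mul_comm]

theorem fderiv_holGrad_symm (hW : IsOpen W) (hg : DifferentiableOn ℂ g W) (hz : z ∈ W)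
    (v w : ι → ℂ) :
    v ⬝ᵥ fderiv ℂ (holGrad g) z w = w ⬝ᵥ fderiv ℂ (holGrad g) z v := by
  have hc : ContDiffAt ℂ 2 g z := ((contDiffOn_of_isOpen_of_differentiableOn hW hg).contDiffAt
    (hW.mem_nhds hz)).of_le (by norm_cast)
  have hd : DifferentiableAt ℂ (fderiv ℂ g) z :=
    (hc.fderiv_right (m := 1) (by norm_num)).differentiableAt (by norm_num)
  have second_derivative (v w : ι → ℂ) :
      fderiv ℂ (holGrad g) z v ⬝ᵥ w = fderiv ℂ (fderiv ℂ g) z v w := by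
    have h1 := hd.hasFDerivAt.clm_apply (hasFDerivAt_const w z)
    have h2 := (dotProductBilin ℂ ℂ).toContinuousBilinearMap.hasFDerivAt_of_bilinear
      (hasFDerivAt_holGrad hW hg hz) (hasFDerivAt_const w z)
    simp only [fderiv_apply_eq_holGrad_dotProduct g] at h1
    simpa using congrArg (· v) (h2.unique h1)
  rw [dotProduct_comm, second_derivative, dotProduct_comm, second_derivative]
  exact (hc.isSymmSndFDerivAt (by simp)).eq _ _

omit [Fintype ι] in
theorem linearIndependent_holGrad [Finite ι] {κ : Type*} {g : κ → (ι → ℂ) → ℂ}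
    (h : LinearIndependent ℂ fun a => fderiv ℂ (g a) z) :
    LinearIndependent ℂ fun a => holGrad (g a) z := by
  have := Fintype.ofFinite ι
  let D : (ι → ℂ) →ₗ[ℂ] ((ι → ℂ) →L[ℂ] ℂ) :=
    { toFun := fun u => LinearMap.toContinuousLinearMap (dotProductBilin ℂ ℂ u)
      map_add' := fun u v => by ext; simp
      map_smul' := fun c u => by ext; simp }
  have hD : D ∘ (fun a => holGrad (g a) z) = fun a => fderiv ℂ (g a) z := by
    ext a w
    exact (fderiv_apply_eq_holGrad_dotProduct _ _ _).symm
  exact LinearIndependent.of_comp D (hD ▸ h)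

end HolGrad

section Rank

variable {ι : Type*} [Fintype ι] {𝔤₀ : Type*} [LieRing 𝔤₀] [LieAlgebra ℝ 𝔤₀]
  {e : Module.Basis ι ℝ 𝔤₀} {z : ι → ℂ}

theorem rank_poissonMatrix_le (z : ι → ℂ) : (poissonMatrix e z).rank ≤ genericRank e :=
  le_ciSup (f := fun z => (poissonMatrix e z).rank)
    ⟨Fintype.card ι, by rintro _ ⟨z, rfl⟩; exact Matrix.rank_le_card_width _⟩ z

theorem finrank_ker_poissonMatrix (hz : z ∉ singSet e) :
    Module.finrank ℂ (LinearMap.ker (poissonMatrix e z).mulVecLin) = lieRank e := by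
  have rank_eq : (poissonMatrix e z).rank = genericRank e :=
    le_antisymm (rank_poissonMatrix_le z) (not_lt.1 hz)
  have rank_nullity := LinearMap.finrank_range_add_finrank_ker (poissonMatrix e z).mulVecLin
  rw [Module.finrank_fintype_fun_eq_card] at rank_nullity
  rw [lieRank, ← rank_eq, Matrix.rank]
  omega

end Rank

section Casimir

variable {ι : Type*} [Fintype ι] [DecidableEq ι] {𝔤₀ : Type*} [LieRing 𝔤₀] [LieAlgebra ℝ 𝔤₀]
  {e : Module.Basis ι ℝ 𝔤₀} {W : Set (ι → ℂ)} {g : (ι → ℂ) → ℂ} {z : ι → ℂ}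

theorem poissonMatrix_mulVec_holGrad (hg : g ∈ holCasimirs e W) (hz : z ∈ W) :
    poissonMatrix e z *ᵥ holGrad g z = 0 := by
  have casimir : holGrad g z ᵥ* poissonMatrix e z = 0 := funext (hg.2 z hz)
  rw [← neg_eq_zero, ← Matrix.neg_mulVec, ← poissonMatrix_transpose, Matrix.mulVec_transpose,
    casimir]

theorem poissonMatrix_mulVec_fderiv_holGrad (hW : IsOpen W) (hg : g ∈ holCasimirs e W)
    (hz : z ∈ W) (v : ι → ℂ) :
    poissonMatrix e z *ᵥ fderiv ℂ (holGrad g) z v + poissonMatrix e v *ᵥ holGrad g z = 0 := by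
  have hline : HasDerivAt (fun t : ℂ => z + t • v) v 0 := by
    simpa using ((hasDerivAt_id (0 : ℂ)).smul_const v).const_add z
  have hline0 : z + (0 : ℂ) • v = z := by simp
  have hgrad : HasDerivAt (fun t : ℂ => holGrad g (z + t • v)) (fderiv ℂ (holGrad g) z v) 0 := by
    refine HasFDerivAt.comp_hasDerivAt (0 : ℂ) (l := holGrad g) ?_ hline
    rw [hline0]
    exact hasFDerivAt_holGrad hW hg.1 hz
  have hmulVec (w : ι → ℂ) : HasDerivAt (fun t : ℂ => poissonMatrix e w *ᵥ holGrad g (z + t • v))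
      (poissonMatrix e w *ᵥ fderiv ℂ (holGrad g) z v) 0 :=
    (poissonMatrix e w).mulVecLin.toContinuousLinearMap.hasFDerivAt.comp_hasDerivAt (0 : ℂ) hgrad
  have hsum := (hmulVec z).add ((hasDerivAt_id (0 : ℂ)).smul (hmulVec v))
  have hzero : HasDerivAt (fun t : ℂ => poissonMatrix e z *ᵥ holGrad g (z + t • v) +
      t • poissonMatrix e v *ᵥ holGrad g (z + t • v)) 0 0 := by
    refine (hasDerivAt_const (0 : ℂ) (0 : ι → ℂ)).congr_of_eventuallyEq ?_
    have hmem : ∀ᶠ t in nhds (0 : ℂ), z + t • v ∈ W :=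
      hline.continuousAt.eventually_mem (by rw [hline0]; exact hW.mem_nhds hz)
    filter_upwards [hmem] with t ht
    rw [← Matrix.smul_mulVec, ← Matrix.add_mulVec, ← poissonMatrix_smul, ← poissonMatrix_add,
      poissonMatrix_mulVec_holGrad hg ht]
  simpa [hline0] using hsum.unique hzero

/-! ### Differentials of the generators -/

theorem hasFDerivAt_holomorphic (hW : IsOpen W) (hg : DifferentiableOn ℂ g W) (hz : z ∈ W) :
    HasFDerivAt g (ofCoeff (holGrad g z, 0)) z := by
  refine ((hg.differentiableAt (hW.mem_nhds hz)).hasFDerivAt.restrictScalars ℝ).congr_fderiv ?_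
  ext w
  rw [ofCoeff_apply, zero_dotProduct, add_zero]
  exact fderiv_apply_eq_holGrad_dotProduct g z w

theorem hasFDerivAt_comp_phi (hW : IsOpen W) (hg : DifferentiableOn ℂ g W) (l : ℂ × ℂ)
    (hz : phi l z ∈ W) :
    HasFDerivAt (g ∘ phi l)
      (ofCoeff (l.1 • holGrad g (phi l z), l.2 • holGrad g (phi l z))) z := by
  have hg' := ((hg.differentiableAt (hW.mem_nhds hz)).hasFDerivAt).restrictScalars ℝ
  refine (hg'.comp z (hasFDerivAt_phi l z)).congr_fderiv ?_
  ext w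
  change fderiv ℂ g (phi l z) (phi l w) = _
  rw [fderiv_apply_eq_holGrad_dotProduct, ofCoeff_apply, phi_eq l w]
  simp only [dotProduct_add, dotProduct_smul, smul_dotProduct]

/-- The `dz̄_k`-coefficients of the differential of `g̃`. The `k`-th one is
`∑ i, conj (∂²g/∂z_i∂z_k) z_i`, written as the conjugate of the Hessian of `g` applied to `z̄`. -/
noncomputable def tildeCoeff (g : (ι → ℂ) → ℂ) (z : ι → ℂ) : ι → ℂ :=
  star (fderiv ℂ (holGrad g) z (star z))

theorem contDiffAt_tildeFun (hW : IsOpen W) (hg : DifferentiableOn ℂ g W) (hz : z ∈ W) :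
    ContDiffAt ℝ ∞ (tildeFun g) z := by
  refine ContDiffAt.sum fun i _ => ContDiffAt.mul ?_ (contDiff_apply ℝ ℂ i).contDiffAt
  exact Complex.conjCLE.contDiff.contDiffAt.comp z
    (contDiffAt_of_isOpen_of_differentiableOn hW (differentiableOn_fderiv_apply hW hg _) hz)

theorem hasFDerivAt_tildeFun (hW : IsOpen W) (hg : DifferentiableOn ℂ g W) (hz : z ∈ W) :
    HasFDerivAt (tildeFun g) (ofCoeff (star (holGrad g z), tildeCoeff g z)) z := by
  have hstar : HasFDerivAt (fun w => star (holGrad g w))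
      ((starL' ℝ : (ι → ℂ) ≃L[ℝ] (ι → ℂ)).toContinuousLinearMap.comp
        ((fderiv ℂ (holGrad g) z).restrictScalars ℝ)) z :=
    (starL' ℝ : (ι → ℂ) ≃L[ℝ] (ι → ℂ)).hasFDerivAt.comp z
      ((hasFDerivAt_holGrad hW hg hz).restrictScalars ℝ)
  refine ((dotProductBilin ℝ ℝ).toContinuousBilinearMap.hasFDerivAt_of_bilinear hstar
    (hasFDerivAt_id z)).congr_fderiv ?_
  ext w
  have hessian : star (fderiv ℂ (holGrad g) z w) ⬝ᵥ z = tildeCoeff g z ⬝ᵥ star w := by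
    rw [tildeCoeff, Matrix.star_dotProduct_star, Matrix.star_dotProduct,
      fderiv_holGrad_symm hW hg hz]
  rw [ofCoeff_apply]
  exact congrArg (star (holGrad g z) ⬝ᵥ w + ·) hessian

theorem poissonMatrix_mulVec_tildeCoeff (hW : IsOpen W) (hg : g ∈ holCasimirs e W) (hz : z ∈ W) :
    poissonMatrix e z *ᵥ star (holGrad g z) + poissonMatrix e (star z) *ᵥ tildeCoeff g z = 0 := by
  have h := poissonMatrix_mulVec_fderiv_holGrad hW hg hz (star z)
  rw [tildeCoeff, poissonMatrix_star_mulVec, eq_neg_of_add_eq_zero_left h, star_neg,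
    ← poissonMatrix_star_mulVec, star_star, add_neg_cancel]

omit [Fintype ι] in
/-- The limit is the pair of coefficients of the complex conjugate of the differential of `g̃`. -/
theorem hasDerivAt_holGrad_phi [Finite ι] (hW : IsOpen W) (hg : DifferentiableOn ℂ g W)
    (hz : z ∈ W) :
    HasDerivAt (fun ε : ℝ => (holGrad g (phi (1, ε) z), (ε : ℂ) • holGrad g (phi (1, ε) z)))
      (star (tildeCoeff g z), holGrad g z) 0 := by
  have := Fintype.ofFinite ι
  have hε : HasDerivAt (fun ε : ℝ => (ε : ℂ)) 1 0 := Complex.ofRealCLM.hasDerivAt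
  have hphi : HasDerivAt (fun ε : ℝ => phi (1, ε) z) (star z) 0 := by
    simpa only [phi_eq, one_smul] using (hε.smul_const (star z)).const_add z
  have hphi0 : phi (1, ((0 : ℝ) : ℂ)) z = z := by simp [phi_eq]
  have hgrad : HasDerivAt (fun ε : ℝ => holGrad g (phi (1, ε) z)) (star (tildeCoeff g z)) 0 := by
    rw [tildeCoeff, star_star]
    refine HasFDerivAt.comp_hasDerivAt (0 : ℝ) (l := holGrad g)
      (l' := (fderiv ℂ (holGrad g) z).restrictScalars ℝ) ?_ hphi
    rw [hphi0]
    exact (hasFDerivAt_holGrad hW hg hz).restrictScalars ℝ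
  refine hgrad.prodMk ((hε.smul hgrad).congr_deriv ?_)
  rw [hphi0]
  simp

theorem mem_of_hasDerivAt {F : Type*} [NormedAddCommGroup F] [NormedSpace ℂ F]
    [FiniteDimensional ℂ F] (S : Submodule ℂ F) {γ : ℝ → F} {γ' : F} (h : HasDerivAt γ γ' 0)
    (hγ : ∀ᶠ ε in nhds 0, γ ε ∈ S) : γ' ∈ S := by
  refine S.closed_of_finiteDimensional.mem_of_tendsto (hasDerivAt_iff_tendsto_slope.1 h) ?_
  filter_upwards [nhdsWithin_le_nhds hγ] with ε hε
  exact (S.restrictScalars ℝ).smul_mem _ (Submodule.sub_mem S hε hγ.self_of_nhds)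

/-! ### Casimir functions on admissible sets -/

theorem IsAdmissible.mem_span_holGrad (hW : IsAdmissible e W) (hz : z ∈ W)
    {u : ι → ℂ} (hu : poissonMatrix e z *ᵥ u = 0) :
    u ∈ Submodule.span ℂ ((fun g => holGrad g z) '' holCasimirs e W) := by
  obtain ⟨-, hdisj, g, hg, hind⟩ := hW
  have hle : Submodule.span ℂ (Set.range fun a => holGrad (g a) z) ≤
      LinearMap.ker (poissonMatrix e z).mulVecLin :=
    Submodule.span_le.2 <| Set.range_subset_iff.2 fun a => poissonMatrix_mulVec_holGrad (hg a) hz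
  have heq := Submodule.eq_of_le_of_finrank_eq hle (by
    rw [finrank_span_eq_card (linearIndependent_holGrad (hind z hz)),
      finrank_ker_poissonMatrix (Set.disjoint_left.1 hdisj hz), Fintype.card_fin])
  have hmem : u ∈ LinearMap.ker (poissonMatrix e z).mulVecLin := hu
  rw [← heq] at hmem
  refine Submodule.span_mono ?_ hmem
  rintro _ ⟨a, rfl⟩
  exact ⟨g a, hg a, rfl⟩

end Casimir

/-! ### One-parameter groups of coadjoint transformations -/

section Flow

variable {ι : Type*} [Fintype ι] [DecidableEq ι]

open scoped Matrix.Norms.Operator in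
theorem hasDerivAt_exp_smul_mulVec (B : Matrix ι ι ℂ) (z : ι → ℂ) (t : ℝ) :
    HasDerivAt (fun s : ℝ => NormedSpace.exp (s • B) *ᵥ z)
      (B *ᵥ (NormedSpace.exp (t • B) *ᵥ z)) t := by
  refine (((Matrix.mulVecBilin ℝ ℝ).flip z).toContinuousLinearMap.hasFDerivAt.comp_hasDerivAt t
    (hasDerivAt_exp_smul_const' (𝕂 := ℝ) B t)).congr_deriv ?_
  exact (Matrix.mulVec_mulVec _ _ _).symm

variable {𝔤₀ : Type*} [LieRing 𝔤₀] [LieAlgebra ℝ 𝔤₀] (e : Module.Basis ι ℝ 𝔤₀)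

theorem realCoadExp_eq (x : ι → ℝ) (t : ℝ) :
    realCoadExp e x t = NormedSpace.exp (t • coadMatrix e fun i => (x i : ℂ)) := by
  rw [realCoadExp, coadExp]
  congr 1
  ext j k
  simp only [coadMatrix, Matrix.of_apply, Matrix.smul_apply, Complex.real_smul, Finset.mul_sum,
    Complex.ofReal_mul, mul_assoc]

theorem hasDerivAt_realCoadExp_mulVec (x : ι → ℝ) (z : ι → ℂ) (t : ℝ) :
    HasDerivAt (fun s => realCoadExp e x s *ᵥ z)
      (coadMatrix e (fun i => (x i : ℂ)) *ᵥ (realCoadExp e x t *ᵥ z)) t := by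
  simpa only [realCoadExp_eq] using hasDerivAt_exp_smul_mulVec _ z t

theorem realCoadExp_zero_mulVec (x : ι → ℝ) (z : ι → ℂ) : realCoadExp e x 0 *ᵥ z = z := by
  rw [realCoadExp_eq, zero_smul, NormedSpace.exp_zero, Matrix.one_mulVec]

theorem realCoadExp_mem (x : ι → ℝ) (t : ℝ) : realCoadExp e x t ∈ realCoadjointGroup e := by
  refine Submonoid.subset_closure ⟨fun i => t * x i, ?_⟩
  simp [realCoadExp]

theorem eq_realCoadExp_mulVec (x : ι → ℝ) (z : ι → ℂ) {γ : ℝ → ι → ℂ} {a b t₀ : ℝ}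
    (ht₀ : t₀ ∈ Set.Ioo a b)
    (hγ : ∀ t ∈ Set.Ioo a b, HasDerivAt γ (coadMatrix e (fun i => (x i : ℂ)) *ᵥ γ t) t)
    (h₀ : γ t₀ = realCoadExp e x t₀ *ᵥ z) :
    ∀ t ∈ Set.Ioo a b, γ t = realCoadExp e x t *ᵥ z := by
  let L : (ι → ℂ) →L[ℂ] (ι → ℂ) :=
    LinearMap.toContinuousLinearMap (coadMatrix e fun i => (x i : ℂ)).mulVecLin
  exact ODE_solution_unique_of_mem_Ioo (v := fun _ y => L y) (s := fun _ => Set.univ)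
    (K := ‖L‖₊) (fun t _ => L.lipschitz.lipschitzOnWith) ht₀
    (fun t ht => ⟨hγ t ht, trivial⟩)
    (fun t _ => ⟨hasDerivAt_realCoadExp_mulVec e x z t, trivial⟩) h₀

variable {e}

theorem eq_of_fderiv_eq_zero_along_realCoadExp (x : ι → ℝ) (z : ι → ℂ) (h : ℝ → ℂ)
    (hh : ∀ t ∈ Set.Icc (0 : ℝ) 1, ∃ F : (ι → ℂ) → ℂ,
      DifferentiableAt ℝ F (realCoadExp e x t *ᵥ z) ∧
      (∀ v ∈ realOrbitTangent e (realCoadExp e x t *ᵥ z),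
        fderiv ℝ F (realCoadExp e x t *ᵥ z) v = 0) ∧
      ∀ᶠ s in nhdsWithin t (Set.Icc 0 1), h s = F (realCoadExp e x s *ᵥ z)) :
    h 1 = h 0 := by
  have hder (t : ℝ) (ht : t ∈ Set.Icc (0 : ℝ) 1) : HasDerivWithinAt h 0 (Set.Icc 0 1) t := by
    obtain ⟨F, hF, hF0, heq⟩ := hh t ht
    have hcomp := hF.hasFDerivAt.comp_hasDerivAt t (hasDerivAt_realCoadExp_mulVec e x z t)
    rw [hF0 _ ⟨x, rfl⟩] at hcomp
    exact hcomp.hasDerivWithinAt.congr_of_eventuallyEq heq (heq.self_of_nhdsWithin ht)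
  refine constant_of_has_deriv_right_zero (fun t ht => (hder t ht).continuousWithinAt)
    (fun t ht => ?_) 1 (Set.right_mem_Icc.2 zero_le_one)
  exact (hder t (Set.Ico_subset_Icc_self ht)).mono_of_mem_nhdsWithin (Icc_mem_nhdsGE_of_mem ht)

theorem isRealInvariantOn_of_fderiv_eq_zero {U : Set (ι → ℂ)} {f : (ι → ℂ) → ℂ}
    (hf : ∀ z ∈ U, DifferentiableAt ℝ f z)
    (hf' : ∀ z ∈ U, ∀ v ∈ realOrbitTangent e z, fderiv ℝ f z v = 0) : IsRealInvariantOn e U f := by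
  have constant_on_step {z w : ι → ℂ} (hzw : RealStep e U z w) : f w = f z := by
    obtain ⟨x, hx, rfl⟩ := hzw
    have h := eq_of_fderiv_eq_zero_along_realCoadExp (e := e) x z
      (fun t => f (realCoadExp e x t *ᵥ z)) fun t ht =>
        ⟨f, hf _ (hx t ht), hf' _ (hx t ht), .of_forall fun _ => rfl⟩
    simpa only [realCoadExp_zero_mulVec] using h
  intro z _ w hzw
  induction hzw with
  | refl => rfl
  | tail _ h ih => rw [constant_on_step h, ih]

theorem IsRealInvariantOn.apply_mulVec {U : Set (ι → ℂ)} {f : (ι → ℂ) → ℂ}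
    (hf : IsRealInvariantOn e U f) (hU : ∀ A ∈ realCoadjointGroup e, ∀ z ∈ U, A *ᵥ z ∈ U)
    {A : Matrix ι ι ℂ} (hA : A ∈ realCoadjointGroup e) {z : ι → ℂ} (hz : z ∈ U) :
    f (A *ᵥ z) = f z := by
  induction hA using Submonoid.closure_induction generalizing z with
  | mem A hA =>
    obtain ⟨x, rfl⟩ := hA
    exact hf z hz _ (.single ⟨x, fun t _ => hU _ (realCoadExp_mem e x t) z hz, rfl⟩)
  | one => rw [Matrix.one_mulVec]
  | mul A B _ hB ihA ihB => rw [← Matrix.mulVec_mulVec, ihA (hU B hB z hz), ihB hz]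

end Flow

/-! ### The generators of `F_1` -/

section Generators

variable {ι : Type*} [Fintype ι] [DecidableEq ι] {𝔤₀ : Type*} [LieRing 𝔤₀] [LieAlgebra ℝ 𝔤₀]
  {e : Module.Basis ι ℝ 𝔤₀} {V : Set (ι → ℂ)} {W : ℂ × ℂ → Set (ι → ℂ)} {z : ι → ℂ}
  {F : (ι → ℂ) → ℂ}

theorem mem_F1Generators_iff {M : Type*} {j : M → ι → ℂ} {f : M → ℂ} :
    f ∈ F1Generators e j V W ↔
      (∃ g ∈ holCasimirs e V, f = g ∘ j) ∨ (∃ g ∈ holCasimirs e V, f = tildeFun g ∘ j) ∨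
        ∃ l : ℂ × ℂ, l.1 ≠ 0 ∧ l.2 ≠ 0 ∧ ∃ g ∈ holCasimirs e (W l), f = g ∘ phi l ∘ j :=
  or_assoc

theorem F1Generators_eq_image {M : Type*} (j : M → ι → ℂ) :
    F1Generators e j V W = (· ∘ j) '' F1Generators e id V W := by
  ext f
  simp only [Set.mem_image, mem_F1Generators_iff, Function.comp_id]
  constructor
  · rintro (⟨g, hg, rfl⟩ | ⟨g, hg, rfl⟩ | ⟨l, h1, h2, g, hg, rfl⟩)
    · exact ⟨g, .inl ⟨g, hg, rfl⟩, rfl⟩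
    · exact ⟨tildeFun g, .inr (.inl ⟨g, hg, rfl⟩), rfl⟩
    · exact ⟨g ∘ phi l, .inr (.inr ⟨l, h1, h2, g, hg, rfl⟩), rfl⟩
  · rintro ⟨F, ⟨_, hF, rfl⟩ | ⟨g, hg, rfl⟩ | ⟨l, h1, h2, g, hg, rfl⟩, rfl⟩
    · exact .inl ⟨F, hF, rfl⟩
    · exact .inr (.inl ⟨g, hg, rfl⟩)
    · exact .inr (.inr ⟨l, h1, h2, g, hg, rfl⟩)

/-- `V` and the `W l` are open sets on which the functions entering the generators of `F_1` are
defined, such that these generators are defined near `z`. -/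
structure IsGeneratorDomain (V : Set (ι → ℂ)) (W : ℂ × ℂ → Set (ι → ℂ)) (z : ι → ℂ) : Prop where
  isOpen : IsOpen V
  mem : z ∈ V
  isOpen_twist : ∀ l ≠ 0, IsOpen (W l)
  phi_mem : ∀ l ≠ 0, phi l z ∈ W l

theorem IsGeneratorDomain.contDiffAt (h : IsGeneratorDomain V W z)
    (hF : F ∈ F1Generators e id V W) : ContDiffAt ℝ ∞ F z := by
  obtain ⟨g, hg, rfl⟩ | ⟨g, hg, rfl⟩ | ⟨l, hl1, -, g, hg, rfl⟩ := mem_F1Generators_iff.1 hF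
  · exact contDiffAt_of_isOpen_of_differentiableOn h.isOpen hg.1 h.mem
  · exact contDiffAt_tildeFun h.isOpen hg.1 h.mem
  · have hl : l ≠ 0 := fun h0 => hl1 (congrArg Prod.fst h0)
    exact contDiffAt_comp_phi (h.isOpen_twist l hl) hg.1 l (h.phi_mem l hl)

theorem IsGeneratorDomain.exists_hasFDerivAt (h : IsGeneratorDomain V W z)
    (hF : F ∈ F1Generators e id V W) :
    ∃ q, HasFDerivAt F (ofCoeff q) z ∧
      poissonMatrix e z *ᵥ q.1 + poissonMatrix e (star z) *ᵥ q.2 = 0 := by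
  obtain ⟨g, hg, rfl⟩ | ⟨g, hg, rfl⟩ | ⟨l, hl1, -, g, hg, rfl⟩ := mem_F1Generators_iff.1 hF
  · refine ⟨(holGrad g z, 0), hasFDerivAt_holomorphic h.isOpen hg.1 h.mem, ?_⟩
    rw [poissonMatrix_mulVec_holGrad hg h.mem, Matrix.mulVec_zero, add_zero]
  · exact ⟨_, hasFDerivAt_tildeFun h.isOpen hg.1 h.mem,
      poissonMatrix_mulVec_tildeCoeff h.isOpen hg h.mem⟩
  · have hl : l ≠ 0 := fun h0 => hl1 (congrArg Prod.fst h0)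
    refine ⟨_, hasFDerivAt_comp_phi (h.isOpen_twist l hl) hg.1 l (h.phi_mem l hl), ?_⟩
    rw [Matrix.mulVec_smul, Matrix.mulVec_smul, ← Matrix.smul_mulVec, ← Matrix.smul_mulVec,
      ← Matrix.add_mulVec, ← poissonMatrix_phi, poissonMatrix_mulVec_holGrad hg (h.phi_mem l hl)]

theorem IsGeneratorDomain.fderiv_eq_zero (h : IsGeneratorDomain V W z)
    (hF : F ∈ F1Generators e id V W) : ∀ v ∈ realOrbitTangent e z, fderiv ℝ F z v = 0 := by
  obtain ⟨q, hFq, hq⟩ := h.exists_hasFDerivAt hF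
  rwa [hFq.fderiv, covector_vanishes_real_iff, holCoeff_ofCoeff, antiholCoeff_ofCoeff]

theorem isRealInvariantOn_of_mem_functionallyGenerated {U : Set (ι → ℂ)} (hU : IsOpen U)
    (hW : ∀ l ≠ 0, IsOpen (W l) ∧ phi l '' U ⊆ W l) {f : (ι → ℂ) → ℂ}
    (hf : f ∈ functionallyGenerated 𝓘(ℝ, ι → ℂ) U (F1Generators e id U W)) :
    IsRealInvariantOn e U f := by
  refine isRealInvariantOn_of_fderiv_eq_zero (fun z hz => ?_) fun z hz v hv => ?_
  · exact ((contMDiffOn_iff_contDiffOn.1 hf.1).contDiffAt (hU.mem_nhds hz)).differentiableAt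
      (by simp)
  · have hdom : IsGeneratorDomain U W z := ⟨hU, hz, fun l hl => (hW l hl).1,
      fun l hl => (hW l hl).2 ⟨z, hz, rfl⟩⟩
    have hspan := hf.2 z hz
    simp only [cdiff, mfderiv_eq_fderiv] at hspan
    have hle : Submodule.span ℂ ((fun s => fderiv ℝ s z) '' F1Generators e id U W) ≤
        LinearMap.ker (evalCovector v) := by
      rw [Submodule.span_le]
      rintro _ ⟨F, hF, rfl⟩
      exact hdom.fderiv_eq_zero hF v hv
    exact hle hspan

end Generators

/-! ### Local inverses of immersions and submersions -/

section LocalInverse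

open Filter Topology

section NormedSpace

variable {𝕜 : Type*} [RCLike 𝕜] {E : Type*} [NormedAddCommGroup E] [NormedSpace 𝕜 E]
  {F : Type*} [NormedAddCommGroup F] [NormedSpace 𝕜 F] {n : WithTop ℕ∞} {f : E → F} {a : E}

theorem exists_contDiffAt_localInverse [CompleteSpace E] {f' : E ≃L[𝕜] F}
    (hf : ContDiffAt 𝕜 n f a) (hf' : HasFDerivAt f (f' : E →L[𝕜] F) a) (hn : n ≠ 0) :
    ∃ g : F → E, ContDiffAt 𝕜 n g (f a) ∧ g (f a) = a ∧ (∀ᶠ x in 𝓝 a, g (f x) = x) ∧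
      ∀ᶠ y in 𝓝 (f a), f (g y) = y :=
  have hs := hf.hasStrictFDerivAt' hf' hn
  ⟨hf.localInverse hf' hn, hf.to_localInverse hf' hn, hs.localInverse_apply_image,
    hs.eventually_left_inverse, hs.eventually_right_inverse⟩

theorem exists_contDiffAt_leftInverse [CompleteSpace E] {f' : E →L[𝕜] F} {L : F →L[𝕜] E}
    (hf : ContDiffAt 𝕜 n f a) (hf' : HasFDerivAt f f' a) (hn : n ≠ 0)
    (hL : Function.LeftInverse L f') :
    ∃ g : F → E, ContDiffAt 𝕜 n g (f a) ∧ g (f a) = a ∧ ∀ᶠ x in 𝓝 a, g (f x) = x := by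
  have hLf' : HasFDerivAt (L ∘ f) ((ContinuousLinearEquiv.refl 𝕜 E : E ≃L[𝕜] E) : E →L[𝕜] E) a :=
    (L.hasFDerivAt.comp a hf').congr_fderiv (ContinuousLinearMap.ext hL)
  obtain ⟨g, hg, hga, hgf, -⟩ :=
    exists_contDiffAt_localInverse (L.contDiff.contDiffAt.comp a hf) hLf' hn
  exact ⟨g ∘ L, hg.comp (f a) L.contDiff.contDiffAt, hga, hgf⟩

theorem exists_contDiffAt_rightInverse [CompleteSpace F] {f' : E →L[𝕜] F} {S : F →L[𝕜] E}
    (hf : ContDiffAt 𝕜 n f a) (hf' : HasFDerivAt f f' a) (hn : n ≠ 0)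
    (hS : Function.RightInverse S f') :
    ∃ g : F → E, ContDiffAt 𝕜 n g (f a) ∧ g (f a) = a ∧ ∀ᶠ y in 𝓝 (f a), f (g y) = y := by
  let s : F → E := fun v => a + S v
  have hs0 : s 0 = a := by simp only [s, map_zero, add_zero]
  have hs : ContDiff 𝕜 n s := contDiff_const.add S.contDiff
  rw [← hs0] at hf hf'
  have hfs' : HasFDerivAt (f ∘ s) ((ContinuousLinearEquiv.refl 𝕜 F : F ≃L[𝕜] F) : F →L[𝕜] F) 0 :=
    (hf'.comp 0 (S.hasFDerivAt.const_add a)).congr_fderiv (ContinuousLinearMap.ext hS)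
  obtain ⟨g, hg, hg0, -, hfg⟩ :=
    exists_contDiffAt_localInverse (hf.comp 0 hs.contDiffAt) hfs' hn
  rw [Function.comp_apply, hs0] at hg hg0 hfg
  exact ⟨s ∘ g, hs.contDiffAt.comp _ hg, (congrArg s hg0).trans hs0, hfg⟩

end NormedSpace

variable {E : Type*} [NormedAddCommGroup E] [NormedSpace ℝ E]
  {H : Type*} [TopologicalSpace H] {I : ModelWithCorners ℝ E H} [I.Boundaryless]
  {M : Type*} [TopologicalSpace M] [ChartedSpace H M]
  {E' : Type*} [NormedAddCommGroup E'] [NormedSpace ℝ E']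
  {H' : Type*} [TopologicalSpace H'] {I' : ModelWithCorners ℝ E' H'}
  {M' : Type*} [TopologicalSpace M'] [ChartedSpace H' M']
  {n : WithTop ℕ∞} {f : M → M'} {x : M}

theorem hasFDerivAt_writtenInExtChartAt (hf : MDifferentiableAt I I' f x) :
    HasFDerivAt (writtenInExtChartAt I I' x f) (mfderiv I I' f x : E →L[ℝ] E')
      (extChartAt I x x) := by
  have h := hf.hasMFDerivAt.2
  rw [ModelWithCorners.range_eq_univ] at h
  exact hasFDerivWithinAt_univ.1 h

theorem contDiffAt_writtenInExtChartAt (hf : ContMDiffAt I I' n f x) :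
    ContDiffAt ℝ n (writtenInExtChartAt I I' x f) (extChartAt I x x) := by
  have h := (contMDiffAt_iff.1 hf).2
  rw [ModelWithCorners.range_eq_univ] at h
  exact contDiffWithinAt_univ.1 h

omit [I.Boundaryless] in
theorem writtenInExtChartAt_apply_self :
    writtenInExtChartAt I I' x f (extChartAt I x x) = extChartAt I' (f x) (f x) :=
  congrArg (fun y => extChartAt I' (f x) (f y)) (extChartAt_to_inv x)

theorem contMDiffAt_extChartAt_symm_comp [IsManifold I n M] {g : M' → E} {y : M'}
    (hg : ContMDiffAt I' 𝓘(ℝ, E) n g y) (hgy : g y = extChartAt I x x) :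
    ContMDiffAt I' I n ((extChartAt I x).symm ∘ g) y := by
  refine ContMDiffAt.comp y ((contMDiffOn_extChartAt_symm x).contMDiffAt ?_) hg
  rw [hgy]
  exact extChartAt_target_mem_nhds x

theorem exists_contMDiffAt_leftInverse_of_injective_mfderiv [FiniteDimensional ℝ E']
    [IsManifold I n M] (hf : ContMDiffAt I I' n f x) (hn : n ≠ 0)
    (hinj : Function.Injective (mfderiv I I' f x)) :
    ∃ r : M' → M, ContMDiffAt I' I n r (f x) ∧ ∀ᶠ y in 𝓝 x, r (f y) = y := by
  let f' : E →L[ℝ] E' := mfderiv I I' f x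
  have : FiniteDimensional ℝ E := FiniteDimensional.of_injective (f' : E →ₗ[ℝ] E') hinj
  obtain ⟨g, hg, hgx, hgf⟩ := exists_contDiffAt_leftInverse (contDiffAt_writtenInExtChartAt hf)
    (hasFDerivAt_writtenInExtChartAt (hf.mdifferentiableAt hn)) hn
    (L := LinearMap.toContinuousLinearMap (f' : E →ₗ[ℝ] E').leftInverse)
    fun v => LinearMap.leftInverse_apply_of_inj (LinearMap.ker_eq_bot.2 hinj) v
  rw [writtenInExtChartAt_apply_self] at hg hgx
  refine ⟨(extChartAt I x).symm ∘ g ∘ extChartAt I' (f x), contMDiffAt_extChartAt_symm_comp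
    (hg.contMDiffAt.comp (f x) contMDiffAt_extChartAt) hgx, ?_⟩
  filter_upwards [(continuousAt_extChartAt x).eventually hgf, extChartAt_source_mem_nhds (I := I) x]
    with y hy hys
  rw [writtenInExtChartAt, Function.comp_apply, Function.comp_apply,
    (extChartAt I x).left_inv hys] at hy
  rw [Function.comp_apply, Function.comp_apply, hy, (extChartAt I x).left_inv hys]

theorem exists_contMDiffAt_rightInverse_of_surjective_mfderiv [FiniteDimensional ℝ E']
    [IsManifold I n M] (hf : ContMDiffAt I I' n f x) (hn : n ≠ 0)
    (hsurj : Function.Surjective (mfderiv I I' f x)) :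
    ∃ s : M' → M, ContMDiffAt I' I n s (f x) ∧ s (f x) = x ∧ ∀ᶠ y in 𝓝 (f x), f (s y) = y := by
  let f' : E →L[ℝ] E' := mfderiv I I' f x
  obtain ⟨S, hS⟩ := f'.exists_rightInverse_of_surjective (LinearMap.range_eq_top.2 hsurj)
  obtain ⟨g, hg, hgx, hfg⟩ := exists_contDiffAt_rightInverse (contDiffAt_writtenInExtChartAt hf)
    (hasFDerivAt_writtenInExtChartAt (hf.mdifferentiableAt hn)) hn (S := S)
    fun v => congrArg (fun A : E' →L[ℝ] E' => A v) hS
  rw [writtenInExtChartAt_apply_self] at hg hgx hfg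
  set s := (extChartAt I x).symm ∘ g ∘ extChartAt I' (f x) with hs_def
  have hs : ContMDiffAt I' I n s (f x) := contMDiffAt_extChartAt_symm_comp
    (hg.contMDiffAt.comp (f x) contMDiffAt_extChartAt) hgx
  have hsx : s (f x) = x := by
    rw [hs_def, Function.comp_apply, Function.comp_apply, hgx, extChartAt_to_inv]
  have hfs : ∀ᶠ y in 𝓝 (f x), f (s y) ∈ (extChartAt I' (f x)).source := by
    have hcont : ContinuousAt (f ∘ s) (f x) :=
      ContinuousAt.comp (by rw [hsx]; exact hf.continuousAt) hs.continuousAt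
    refine hcont.eventually_mem ?_
    rw [Function.comp_apply, hsx]
    exact extChartAt_source_mem_nhds _
  refine ⟨s, hs, hsx, ?_⟩
  filter_upwards [(continuousAt_extChartAt (f x)).eventually hfg, hfs,
    extChartAt_source_mem_nhds (I := I') (f x)] with y hy hsy hys
  exact (extChartAt I' (f x)).injOn hsy hys hy

end LocalInverse

/-! ### Integral curves in immersed submanifolds -/

section IntegralCurve

open Filter Topology

variable {E : Type*} [NormedAddCommGroup E] [NormedSpace ℝ E]
  {F : Type*} [NormedAddCommGroup F] [NormedSpace ℝ F] {Y : F → F}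

theorem exists_integralCurve_of_mem_range_fderiv [CompleteSpace E] {f : E → F} {a : E}
    (hf : ContDiffAt ℝ 2 f a) {L : F →L[ℝ] E} (hL : Function.LeftInverse L (fderiv ℝ f a))
    (hY : ContDiffAt ℝ 1 Y (f a)) (hYf : ∀ᶠ u in 𝓝 a, Y (f u) ∈ Set.range (fderiv ℝ f u))
    (t₀ : ℝ) :
    ∃ α : ℝ → E, α t₀ = a ∧ ContinuousAt α t₀ ∧
      ∀ᶠ t in 𝓝 t₀, HasDerivAt (f ∘ α) (Y (f (α t))) t := by
  obtain ⟨g, hg, -, hgf⟩ := exists_contDiffAt_leftInverse hf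
    (hf.differentiableAt two_ne_zero).hasFDerivAt two_ne_zero hL
  let ξ : E → E := fun u => fderiv ℝ g (f u) (Y (f u))
  have hf₁ : ContDiffAt ℝ 1 f a := hf.of_le one_le_two
  have hξ : ContDiffAt ℝ 1 ξ a :=
    ((hg.fderiv_right (m := 1) le_rfl).comp a hf₁).clm_apply (hY.comp a hf₁)
  have hfξ : ∀ᶠ u in 𝓝 a, HasFDerivAt f (fderiv ℝ f u) u ∧ fderiv ℝ f u (ξ u) = Y (f u) := by
    have hg₁ := (hg.eventually (by simp)).mono fun y hy => hy.differentiableAt two_ne_zero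
    filter_upwards [hYf, hgf.eventually_nhds, hf.eventually (by simp),
      hf.continuousAt.eventually hg₁] with u ⟨w, hw⟩ hu hfu hgu
    have hfu' := (hfu.differentiableAt two_ne_zero).hasFDerivAt
    have hid : (fderiv ℝ g (f u)).comp (fderiv ℝ f u) = .id ℝ E :=
      (hgu.hasFDerivAt.comp u hfu').unique ((hasFDerivAt_id u).congr_of_eventuallyEq hu)
    have hξu : ξ u = w := by
      simp only [ξ, ← hw]
      exact congrArg (fun A : E →L[ℝ] E => A w) hid
    exact ⟨hfu', by rw [hξu, hw]⟩
  obtain ⟨α, hα₀, ε, hε, hα⟩ :=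
    hξ.exists_forall_mem_closedBall_exists_eq_forall_mem_Ioo_hasDerivAt₀ t₀
  have hα_cont : ContinuousAt α t₀ := (hα t₀ (by simp [hε])).continuousAt
  refine ⟨α, hα₀, hα_cont, ?_⟩
  filter_upwards [hα_cont.eventually (by rwa [hα₀]),
    Ioo_mem_nhds (sub_lt_self t₀ hε) (lt_add_of_pos_right t₀ hε)] with t ⟨hft, hYt⟩ ht
  exact (hft.comp_hasDerivAt t (hα t ht)).congr_deriv hYt

variable {H : Type*} [TopologicalSpace H] {I : ModelWithCorners ℝ E H} [I.Boundaryless]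
  {M : Type*} [TopologicalSpace M] [ChartedSpace H M] {f : M → F} {x : M}

theorem contDiffAt_comp_extChartAt_symm {n : WithTop ℕ∞} [IsManifold I n M]
    (hf : ContMDiff I 𝓘(ℝ, F) n f) {u : E} (hu : u ∈ (extChartAt I x).target) :
    ContDiffAt ℝ n (f ∘ (extChartAt I x).symm) u :=
  (hf.contMDiffAt.comp u ((contMDiffOn_extChartAt_symm x).contMDiffAt
    ((isOpen_extChartAt_target x).mem_nhds hu))).contDiffAt

theorem range_mfderiv_subset_range_fderiv_comp_extChartAt_symm [IsManifold I 1 M] {u : E}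
    (hu : u ∈ (extChartAt I x).target)
    (hf : MDifferentiableAt I 𝓘(ℝ, F) f ((extChartAt I x).symm u)) :
    Set.range (mfderiv I 𝓘(ℝ, F) f ((extChartAt I x).symm u)) ⊆
      Set.range (fderiv ℝ (f ∘ (extChartAt I x).symm) u) := by
  have hsymm := mdifferentiableWithinAt_extChartAt_symm hu
  have hinv := mfderivWithin_extChartAt_symm_comp_mfderiv_extChartAt hu
  rw [ModelWithCorners.range_eq_univ] at hsymm hinv
  rw [mfderivWithin_univ] at hinv
  rw [← mfderiv_eq_fderiv, mfderiv_comp u hf (mdifferentiableWithinAt_univ.1 hsymm)]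
  rintro _ ⟨v, rfl⟩
  exact ⟨mfderiv I 𝓘(ℝ, E) (extChartAt I x) ((extChartAt I x).symm u) v,
    congrArg (mfderiv I 𝓘(ℝ, F) f ((extChartAt I x).symm u)) (congrArg (· v) hinv)⟩

theorem exists_integralCurve_of_mem_range_mfderiv [FiniteDimensional ℝ F] [IsManifold I 2 M]
    (hf : ContMDiff I 𝓘(ℝ, F) 2 f) (hinj : Function.Injective (mfderiv I 𝓘(ℝ, F) f x))
    (hY : ContDiffAt ℝ 1 Y (f x)) (hYf : ∀ y, Y (f y) ∈ Set.range (mfderiv I 𝓘(ℝ, F) f y))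
    (t₀ : ℝ) :
    ∃ α : ℝ → M, α t₀ = x ∧ ContinuousAt α t₀ ∧
      ∀ᶠ t in 𝓝 t₀, HasDerivAt (f ∘ α) (Y (f (α t))) t := by
  have : IsManifold I 1 M := .of_le one_le_two
  let φ := extChartAt I x
  have hφx : φ.symm (φ x) = x := extChartAt_to_inv x
  have hdf : MDifferentiable I 𝓘(ℝ, F) f := hf.mdifferentiable two_ne_zero
  let f' : E →L[ℝ] F := mfderiv I 𝓘(ℝ, F) f x
  have : FiniteDimensional ℝ E := FiniteDimensional.of_injective (f' : E →ₗ[ℝ] F) hinj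
  have hcomplete : CompleteSpace E := FiniteDimensional.complete ℝ E
  have hderiv : HasFDerivAt (f ∘ φ.symm) f' (φ x) := hasFDerivAt_writtenInExtChartAt (hdf x)
  obtain ⟨α, hα₀, hα_cont, hα⟩ := exists_integralCurve_of_mem_range_fderiv (Y := Y)
    (L := LinearMap.toContinuousLinearMap (f' : E →ₗ[ℝ] F).leftInverse)
    (contDiffAt_comp_extChartAt_symm hf (mem_extChartAt_target x))
    (by
      rw [hderiv.fderiv]
      exact fun v => LinearMap.leftInverse_apply_of_inj (LinearMap.ker_eq_bot.2 hinj) v)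
    (by rwa [Function.comp_apply, hφx])
    (Filter.mem_of_superset (extChartAt_target_mem_nhds x) fun u hu =>
      range_mfderiv_subset_range_fderiv_comp_extChartAt_symm hu (hdf _) (hYf _)) t₀
  refine ⟨φ.symm ∘ α, by rw [Function.comp_apply, hα₀, hφx], ?_, hα⟩
  exact ContinuousAt.comp (by rw [hα₀]; exact continuousAt_extChartAt_symm x) hα_cont

end IntegralCurve

/-! ### Derivatives on manifolds and constancy along the real orbits -/

section VecDeriv

open Filter Topology

variable {E : Type*} [NormedAddCommGroup E] [NormedSpace ℝ E]
  {H : Type*} [TopologicalSpace H] (I : ModelWithCorners ℝ E H)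
  {M : Type*} [TopologicalSpace M] [ChartedSpace H M]
  {E' : Type*} [NormedAddCommGroup E'] [NormedSpace ℝ E']
  {H' : Type*} [TopologicalSpace H'] (I' : ModelWithCorners ℝ E' H')
  {M' : Type*} [TopologicalSpace M'] [ChartedSpace H' M']
  {F : Type*} [NormedAddCommGroup F] [NormedSpace ℝ F]
  {F' : Type*} [NormedAddCommGroup F'] [NormedSpace ℝ F'] {f g : M → F} {x : M}

/-- The derivative of a vector-valued function on a manifold, as a map from the model space, so
that the derivatives at different points can be compared. -/
noncomputable def vecDeriv (f : M → F) (x : M) : E →L[ℝ] F := mfderiv I 𝓘(ℝ, F) f x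

/-- The derivative of a map between manifolds, as a map between the model spaces. -/
noncomputable def mapDeriv (p : M → M') (x : M) : E →L[ℝ] E' := mfderiv I I' p x

variable {I I'}

theorem vecDeriv_comp (hf : MDifferentiableAt I 𝓘(ℝ, F) f x) {G : F → F'}
    (hG : DifferentiableAt ℝ G (f x)) :
    vecDeriv I (G ∘ f) x = (fderiv ℝ G (f x)).comp (vecDeriv I f x) := by
  unfold vecDeriv
  rw [mfderiv_comp x hG.mdifferentiableAt hf, mfderiv_eq_fderiv]
  rfl

theorem vecDeriv_congr (h : f =ᶠ[𝓝 x] g) : vecDeriv I f x = vecDeriv I g x := h.mfderiv_eq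

theorem vecDeriv_comp_map {p : M → M'} (hp : MDifferentiableAt I I' p x) {f : M' → F}
    (hf : MDifferentiableAt I' 𝓘(ℝ, F) f (p x)) :
    vecDeriv I (f ∘ p) x = (vecDeriv I' f (p x)).comp (mapDeriv I I' p x) :=
  mfderiv_comp x hf hp

end VecDeriv

section Fibres

open Filter Topology

variable {ι : Type*} [Fintype ι] [DecidableEq ι] {𝔤₀ : Type*} [LieRing 𝔤₀] [LieAlgebra ℝ 𝔤₀]
  {e : Module.Basis ι ℝ 𝔤₀} {d : ℕ} {X : Type*} [TopologicalSpace X]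
  [ChartedSpace (EuclideanSpace ℝ (Fin d)) X] {z₀ : ι → ℂ} {j : X → ι → ℂ}

theorem IsOpenInOrbit.mdifferentiableAt (hj : IsOpenInOrbit (d := d) e z₀ j) (x : X) :
    MDifferentiableAt (𝓡 d) 𝓘(ℝ, ι → ℂ) j x :=
  (hj.smooth x).mdifferentiableAt (by simp)

theorem IsOpenInOrbit.vecDeriv_injective (hj : IsOpenInOrbit (d := d) e z₀ j) (x : X) :
    Function.Injective (vecDeriv (𝓡 d) j x) :=
  hj.immersion x

theorem IsOpenInOrbit.range_vecDeriv (hj : IsOpenInOrbit (d := d) e z₀ j) (x : X) :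
    Set.range (vecDeriv (𝓡 d) j x) = complexOrbitTangent e (j x) :=
  hj.tangent x

/-- By uniqueness and the injectivity of `j`, `γ` is near `t₀` the integral curve of the coadjoint
vector field induced on `X`. -/
theorem IsOpenInOrbit.continuousWithinAt [IsManifold (𝓡 d) ∞ X]
    (hj : IsOpenInOrbit (d := d) e z₀ j) (x : ι → ℝ) (z : ι → ℂ) {γ : ℝ → X} {s : Set ℝ}
    (hγ : ∀ t ∈ s, j (γ t) = realCoadExp e x t *ᵥ z) {t₀ : ℝ} (ht₀ : t₀ ∈ s) :
    ContinuousWithinAt γ s t₀ := by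
  have : IsManifold (𝓡 d) 2 X := .of_le (n := ∞) (by norm_cast)
  let B := coadMatrix e fun i => (x i : ℂ)
  have hB : ContDiff ℝ 1 (B *ᵥ ·) := B.mulVecLin.toContinuousLinearMap.contDiff.restrict_scalars ℝ
  obtain ⟨α, hα₀, hα_cont, hα⟩ := exists_integralCurve_of_mem_range_mfderiv
    (hj.smooth.of_le (by norm_cast)) (hj.immersion (γ t₀)) hB.contDiffAt
    (fun y => by rw [hj.tangent]; exact ⟨_, rfl⟩) t₀
  obtain ⟨a, b, hab, hα⟩ := mem_nhds_iff_exists_Ioo_subset.1 hα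
  have hflow := eq_realCoadExp_mulVec e x z hab hα
    ((congrArg j hα₀).trans (hγ t₀ ht₀))
  refine hα_cont.continuousWithinAt.congr_of_eventuallyEq ?_ hα₀.symm
  filter_upwards [self_mem_nhdsWithin, nhdsWithin_le_nhds (Ioo_mem_nhds hab.1 hab.2)] with t hts ht
  exact hj.injective ((hγ t hts).trans (hflow t ht).symm)

theorem RealStep.of_mem_Icc {U : Set (ι → ℂ)} {z : ι → ℂ} {x : ι → ℝ}
    (hx : ∀ t ∈ Set.Icc (0 : ℝ) 1, realCoadExp e x t *ᵥ z ∈ U) {t : ℝ}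
    (ht : t ∈ Set.Icc (0 : ℝ) 1) : RealStep e U z (realCoadExp e x t *ᵥ z) := by
  have h (s : ℝ) : realCoadExp e (fun i => t * x i) s = realCoadExp e x (s * t) := by
    simp only [realCoadExp, mul_assoc]
  refine ⟨fun i => t * x i, fun s hs => ?_, by rw [h, one_mul]⟩
  rw [h]
  exact hx _ ⟨mul_nonneg hs.1 ht.1, mul_le_one₀ hs.2 ht.1 ht.2⟩

theorem IsOpenInOrbit.eq_of_sameRealOrbitIn [IsManifold (𝓡 d) ∞ X]
    (hj : IsOpenInOrbit (d := d) e z₀ j) {x₀ : X} (h : X → ℂ)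
    (hloc : ∀ x, SameRealOrbitIn e (Set.range j) (j x₀) (j x) → ∃ F : (ι → ℂ) → ℂ,
      DifferentiableAt ℝ F (j x) ∧ (∀ v ∈ realOrbitTangent e (j x), fderiv ℝ F (j x) v = 0) ∧
        ∀ᶠ x' in 𝓝 x, h x' = F (j x'))
    {x₁ : X} (hx₁ : SameRealOrbitIn e (Set.range j) (j x₀) (j x₁)) : h x₁ = h x₀ := by
  suffices ∀ w, SameRealOrbitIn e (Set.range j) (j x₀) w → ∀ x, j x = w → h x = h x₀ from
    this _ hx₁ _ rfl
  intro w hw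
  induction hw with
  | refl => exact fun x hx => congrArg h (hj.injective hx)
  | @tail y w hzy hyw ih =>
    obtain ⟨x, hx, rfl⟩ := hyw
    have : Nonempty X := ⟨x₀⟩
    choose! γ hγ using id hx
    have h_ends : h (γ 1) = h (γ 0) := by
      refine eq_of_fderiv_eq_zero_along_realCoadExp (e := e) x y (h ∘ γ) fun t ht => ?_
      obtain ⟨F, hF, hF0, heq⟩ := hloc (γ t) <| by
        rw [hγ t ht]
        exact .tail hzy (.of_mem_Icc hx ht)
      rw [hγ t ht] at hF hF0
      refine ⟨F, hF, hF0, ?_⟩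
      filter_upwards [(hj.continuousWithinAt x y hγ ht).eventually heq, self_mem_nhdsWithin]
        with s hs hs'
      rw [Function.comp_apply, hs, hγ s hs']
    intro x' hx'
    have hγ₁ : x' = γ 1 := hj.injective (by rw [hx', hγ 1 (by simp)])
    rw [hγ₁, h_ends, ih (γ 0) (by rw [hγ 0 (by simp), realCoadExp_zero_mulVec])]

end Fibres

/-! ### Invariance of the linear Poisson bivector -/

section Invariance

open Filter Topology

variable {ι : Type*} [Fintype ι]

/-- A complex matrix as a real-linear endomorphism of `ℂⁿ`. -/
noncomputable def mulVecCLM (B : Matrix ι ι ℂ) : (ι → ℂ) →L[ℝ] (ι → ℂ) :=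
  B.mulVecLin.toContinuousLinearMap.restrictScalars ℝ

theorem mulVecCLM_apply (B : Matrix ι ι ℂ) (w : ι → ℂ) : mulVecCLM B w = B *ᵥ w := rfl

variable [DecidableEq ι]

theorem holCoeff_pullCovector_mulVecCLM (B : Matrix ι ι ℂ) (η : (ι → ℂ) →L[ℝ] ℂ) :
    holCoeff (pullCovector (mulVecCLM B) η) = Bᵀ *ᵥ holCoeff η := by
  have h : pullCovector (mulVecCLM B) η =
      ofCoeff (Bᵀ *ᵥ holCoeff η, Bᴴ *ᵥ antiholCoeff η) := by
    ext w
    rw [pullCovector_apply, mulVecCLM_apply, covector_apply, ofCoeff_apply, Matrix.star_mulVec,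
      Matrix.dotProduct_mulVec, Matrix.mulVec_transpose, dotProduct_comm _ (_ ᵥ* _)]
    exact congrArg _ ((Matrix.dotProduct_mulVec _ _ _).symm.trans (dotProduct_comm _ _))
  rw [h, holCoeff_ofCoeff]

variable {𝔤₀ : Type*} [LieRing 𝔤₀] [LieAlgebra ℝ 𝔤₀] {e : Module.Basis ι ℝ 𝔤₀}

theorem lieBivector_coadMatrix_mulVec (v z : ι → ℂ) (η η' : (ι → ℂ) →L[ℝ] ℂ) :
    lieBivector e (coadMatrix e v *ᵥ z) η η' =
      lieBivector e z (pullCovector (mulVecCLM (coadMatrix e v)) η) η' +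
        lieBivector e z η (pullCovector (mulVecCLM (coadMatrix e v)) η') := by
  simp only [lieBivector_apply, holCoeff_pullCovector_mulVecCLM]
  rw [poissonMatrix_coadMatrix_mulVec, Matrix.add_mulVec, dotProduct_add, ← Matrix.mulVec_mulVec,
    ← Matrix.mulVec_mulVec, Matrix.dotProduct_mulVec, ← Matrix.mulVec_transpose]

theorem lieBivector_coadMatrix_mulVec_add_eq_zero {T : Type*} [NormedAddCommGroup T]
    [NormedSpace ℝ T] {z : ι → ℂ} {J : T →L[ℝ] (ι → ℂ)}
    (hJ : Set.range J = complexOrbitTangent e z) {v : ι → ℂ} {η ξ η' ξ' : (ι → ℂ) →L[ℝ] ℂ}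
    (h : pullCovector J (ξ + pullCovector (mulVecCLM (coadMatrix e v)) η) = 0)
    (h' : pullCovector J (ξ' + pullCovector (mulVecCLM (coadMatrix e v)) η') = 0) :
    lieBivector e (coadMatrix e v *ᵥ z) η η' + lieBivector e z ξ η' + lieBivector e z η ξ' = 0 := by
  have left := (LinearMap.map_add₂ (lieBivector e z) _ _ _).symm.trans <|
    (lieBivector_congr hJ (h.trans (map_zero _).symm) (Eq.refl (pullCovector J η'))).trans
      (LinearMap.map_zero₂ _ _)
  have right := (LinearMap.map_add (lieBivector e z η) _ _).symm.trans <|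
    (lieBivector_congr hJ (Eq.refl (pullCovector J η)) (h'.trans (map_zero _).symm)).trans
      (LinearMap.map_zero _)
  rw [lieBivector_coadMatrix_mulVec]
  linear_combination left + right

theorem hasFDerivAt_lieBivector {a a' : (ι → ℂ) → (ι → ℂ) →L[ℝ] ℂ}
    {A A' : (ι → ℂ) →L[ℝ] (ι → ℂ) →L[ℝ] ℂ} {z : ι → ℂ} (ha : HasFDerivAt a A z)
    (ha' : HasFDerivAt a' A' z) :
    ∃ D : (ι → ℂ) →L[ℝ] ℂ, HasFDerivAt (fun w => lieBivector e w (a w) (a' w)) D z ∧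
      ∀ u, D u = lieBivector e u (a z) (a' z) + lieBivector e z (A u) (a' z) +
        lieBivector e z (a z) (A' u) := by
  let M : (ι → ℂ) →L[ℝ] ((ι → ℂ) →L[ℝ] ℂ) →L[ℝ] (ι → ℂ) :=
    LinearMap.toContinuousBilinearMap (LinearMap.mk₂ ℝ (fun w η => poissonMatrix e w *ᵥ holCoeff η)
      (fun w w' η => by rw [poissonMatrix_add, Matrix.add_mulVec])
      (fun c w η => by
        rw [← Complex.coe_smul, poissonMatrix_smul, Matrix.smul_mulVec, Complex.coe_smul])
      (fun w η η' => by rw [map_add, Matrix.mulVec_add])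
      (fun c w η => by
        rw [← Complex.coe_smul, map_smul, Matrix.mulVec_smul, Complex.coe_smul]))
  let K : ((ι → ℂ) →L[ℝ] ℂ) →L[ℝ] (ι → ℂ) →L[ℝ] ℂ :=
    LinearMap.toContinuousBilinearMap (LinearMap.mk₂ ℝ (fun η y => holCoeff η ⬝ᵥ y)
      (fun η η' y => by rw [map_add, add_dotProduct])
      (fun c η y => by
        rw [← Complex.coe_smul, map_smul, smul_dotProduct, Complex.coe_smul])
      (fun η y y' => dotProduct_add _ _ _)
      (fun c η y => dotProduct_smul _ _ _))
  have hD := (K.hasFDerivAt.comp z ha).clm_apply (M.hasFDerivAt.clm_apply ha')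
  refine ⟨_, hD.congr_of_eventuallyEq (.of_forall fun w => lieBivector_apply e w (a w) (a' w)),
    fun u => ?_⟩
  simp only [lieBivector_apply]
  change holCoeff (a z) ⬝ᵥ (poissonMatrix e z *ᵥ holCoeff (A' u) +
    poissonMatrix e u *ᵥ holCoeff (a' z)) +
      holCoeff (A u) ⬝ᵥ poissonMatrix e z *ᵥ holCoeff (a' z) = _
  rw [dotProduct_add]
  ring

variable {d : ℕ} {X : Type*} [TopologicalSpace X] [ChartedSpace (EuclideanSpace ℝ (Fin d)) X]
  {z₀ : ι → ℂ} {j : X → ι → ℂ}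

theorem IsOpenInOrbit.pullCovector_fderiv_fderiv (hj : IsOpenInOrbit (d := d) e z₀ j) {x : X}
    {f : (ι → ℂ) → ℂ} (hf : ContDiffAt ℝ 2 f (j x))
    (hf₀ : ∀ᶠ x' in 𝓝 x, ∀ w ∈ realOrbitTangent e (j x'), fderiv ℝ f (j x') w = 0)
    (B : Matrix ι ι ℂ) (hB : ∀ w, B *ᵥ w ∈ realOrbitTangent e w) :
    pullCovector (vecDeriv (𝓡 d) j x)
      (fderiv ℝ (fderiv ℝ f) (j x) (B *ᵥ j x) +
        pullCovector (mulVecCLM B) (fderiv ℝ f (j x))) = 0 := by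
  have hd : DifferentiableAt ℝ (fderiv ℝ f) (j x) :=
    (hf.fderiv_right (m := 1) (by norm_num)).differentiableAt one_ne_zero
  have hq := hd.hasFDerivAt.clm_apply ((mulVecCLM B).hasFDerivAt (x := j x))
  have hq₀ : vecDeriv (𝓡 d) ((fun w => fderiv ℝ f w (mulVecCLM B w)) ∘ j) x = 0 :=
    (vecDeriv_congr (g := fun _ => 0) (hf₀.mono fun x' h => h _ (hB _))).trans mfderiv_const
  rw [vecDeriv_comp (hj.mdifferentiableAt x) hq.differentiableAt, hq.fderiv] at hq₀
  refine Eq.trans (ContinuousLinearMap.ext fun u => ?_) hq₀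
  exact (congrArg (· + _) ((hf.isSymmSndFDerivAt (by simp)).eq _ _)).trans (add_comm _ _)

theorem IsOpenInOrbit.fderiv_lieBivector_fderiv_eq_zero (hj : IsOpenInOrbit (d := d) e z₀ j) {x : X}
    {f g : (ι → ℂ) → ℂ} (hf : ContDiffAt ℝ 2 f (j x)) (hg : ContDiffAt ℝ 2 g (j x))
    (hf₀ : ∀ᶠ x' in 𝓝 x, ∀ w ∈ realOrbitTangent e (j x'), fderiv ℝ f (j x') w = 0)
    (hg₀ : ∀ᶠ x' in 𝓝 x, ∀ w ∈ realOrbitTangent e (j x'), fderiv ℝ g (j x') w = 0) :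
    DifferentiableAt ℝ (fun w => lieBivector e w (fderiv ℝ f w) (fderiv ℝ g w)) (j x) ∧
      ∀ w ∈ realOrbitTangent e (j x),
        fderiv ℝ (fun w => lieBivector e w (fderiv ℝ f w) (fderiv ℝ g w)) (j x) w = 0 := by
  have hd {f : (ι → ℂ) → ℂ} (hf : ContDiffAt ℝ 2 f (j x)) : DifferentiableAt ℝ (fderiv ℝ f) (j x) :=
    (hf.fderiv_right (m := 1) (by norm_num)).differentiableAt one_ne_zero
  obtain ⟨D, hD, hDu⟩ := hasFDerivAt_lieBivector (e := e) (hd hf).hasFDerivAt (hd hg).hasFDerivAt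
  refine ⟨hD.differentiableAt, ?_⟩
  rintro _ ⟨ξ, rfl⟩
  exact (DFunLike.congr_fun hD.fderiv _).trans <| (hDu _).trans <|
    lieBivector_coadMatrix_mulVec_add_eq_zero (hj.range_vecDeriv x)
      (hj.pullCovector_fderiv_fderiv hf hf₀ _ fun w => ⟨ξ, rfl⟩)
      (hj.pullCovector_fderiv_fderiv hg hg₀ _ fun w => ⟨ξ, rfl⟩)

end Invariance

/-! ### Reduction along the real orbits -/

section Reduction

open Filter Topology

variable {ι : Type*} [Fintype ι] [DecidableEq ι] {𝔤₀ : Type*} [LieRing 𝔤₀] [LieAlgebra ℝ 𝔤₀]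
  {e : Module.Basis ι ℝ 𝔤₀}
  {d m : ℕ} {X : Type*} [TopologicalSpace X] [ChartedSpace (EuclideanSpace ℝ (Fin d)) X]
  {N : Type*} [TopologicalSpace N] [ChartedSpace (EuclideanSpace ℝ (Fin m)) N]
  {z₀ : ι → ℂ} {j : X → ι → ℂ} {p : X → N}

theorem IsRealOrbitQuotient.mdifferentiableAt (hp : IsRealOrbitQuotient (d := d) (m := m) e j p)
    (x : X) : MDifferentiableAt (𝓡 d) (𝓡 m) p x :=
  (hp.smooth x).mdifferentiableAt (by simp)

theorem IsRealOrbitQuotient.isReductionAt (hp : IsRealOrbitQuotient (d := d) (m := m) e j p)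
    (hj : IsOpenInOrbit (d := d) e z₀ j) (x : X) :
    IsReductionAt e (j x) (vecDeriv (𝓡 d) j x) (mapDeriv (𝓡 d) (𝓡 m) p x) where
  inj := hj.vecDeriv_injective x
  range := hj.range_vecDeriv x
  surj := hp.submersion x
  ker := hp.fibre_tangent x

theorem reducedForm_lieBivectorConj {T Q : Type*} [NormedAddCommGroup T] [NormedSpace ℝ T]
    [NormedAddCommGroup Q] [NormedSpace ℝ Q] (z : ι → ℂ) (J : T →L[ℝ] (ι → ℂ)) (P : T →L[ℝ] Q)
    (α β : Q →L[ℝ] ℂ) : reducedForm (lieBivectorConj e z) J P α β =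
      conj (reducedForm (lieBivector e z) J P (conjCovector α) (conjCovector β)) :=
  lieBivectorConj_eq_conj e z _ _

variable [IsManifold (𝓡 d) ∞ X]

theorem IsOpenInOrbit.exists_contDiffAt_eventually_apply_eq
    (hj : IsOpenInOrbit (d := d) e z₀ j) {x : X} {u : X → ℂ}
    (hu : ContMDiffAt (𝓡 d) 𝓘(ℝ, ℂ) ∞ u x) :
    ∃ f : (ι → ℂ) → ℂ, ContDiffAt ℝ ∞ f (j x) ∧ ∀ᶠ x' in 𝓝 x, f (j x') = u x' := by
  obtain ⟨r, hr, hrj⟩ := exists_contMDiffAt_leftInverse_of_injective_mfderiv (hj.smooth x)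
    (by simp) (hj.immersion x)
  refine ⟨u ∘ r, ?_, hrj.mono fun x' h => congrArg u h⟩
  rw [← hrj.self_of_nhds] at hu
  exact (hu.comp (j x) hr).contDiffAt

theorem IsRealOrbitQuotient.exists_contDiffAt_pullCovector_fderiv_eq
    (hp : IsRealOrbitQuotient (d := d) (m := m) e j p) (hj : IsOpenInOrbit (d := d) e z₀ j)
    [IsManifold (𝓡 m) ∞ N] {x : X} {k : N → ℂ} (hk : ContMDiffAt (𝓡 m) 𝓘(ℝ, ℂ) ∞ k (p x)) :
    ∃ f : (ι → ℂ) → ℂ, ContDiffAt ℝ 2 f (j x) ∧ ∀ᶠ x' in 𝓝 x,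
      pullCovector (vecDeriv (𝓡 d) j x') (fderiv ℝ f (j x')) =
        pullCovector (mapDeriv (𝓡 d) (𝓡 m) p x') (vecDeriv (𝓡 m) k (p x')) := by
  obtain ⟨f, hf, hfj⟩ := hj.exists_contDiffAt_eventually_apply_eq (hk.comp x (hp.smooth x))
  have hf1 : ∀ᶠ x' in 𝓝 x, ContDiffAt ℝ 1 f (j x') := (hj.smooth x).continuousAt.eventually
    ((hf.of_le (by norm_cast)).eventually (by simp))
  have hk1 : ∀ᶠ x' in 𝓝 x, ContMDiffAt (𝓡 m) 𝓘(ℝ, ℂ) 1 k (p x') :=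
    have : IsManifold (𝓡 m) 1 N := .of_le (n := ∞) (by norm_cast)
    (hp.smooth x).continuousAt.eventually
      ((contMDiffAt_iff_contMDiffAt_nhds (by simp)).1 (hk.of_le (by norm_cast)))
  refine ⟨f, hf.of_le (by norm_cast), ?_⟩
  filter_upwards [hfj.eventually_nhds, hf1, hk1] with x' h hf' hk'
  refine (vecDeriv_comp (hj.mdifferentiableAt x') (hf'.differentiableAt one_ne_zero)).symm.trans
    ((vecDeriv_congr h).trans
      (vecDeriv_comp_map (hp.mdifferentiableAt x') (hk'.mdifferentiableAt one_ne_zero)))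

variable [IsManifold (𝓡 m) ∞ N]

/-- Locally, functions on the quotient extend to functions on `𝔤*` whose differentials vanish on the
real orbits, and the bracket of such functions is invariant. -/
theorem IsRealOrbitQuotient.reducedForm_lieBivector_vecDeriv_eq
    (hp : IsRealOrbitQuotient (d := d) (m := m) e j p) (hj : IsOpenInOrbit (d := d) e z₀ j)
    {x₀ x₁ : X} (hx : p x₀ = p x₁) {k₁ k₂ : N → ℂ}
    (hk₁ : ContMDiffAt (𝓡 m) 𝓘(ℝ, ℂ) ∞ k₁ (p x₀)) (hk₂ : ContMDiffAt (𝓡 m) 𝓘(ℝ, ℂ) ∞ k₂ (p x₀)) :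
    reducedForm (lieBivector e (j x₁)) (vecDeriv (𝓡 d) j x₁) (mapDeriv (𝓡 d) (𝓡 m) p x₁)
        (vecDeriv (𝓡 m) k₁ (p x₁)) (vecDeriv (𝓡 m) k₂ (p x₁)) =
      reducedForm (lieBivector e (j x₀)) (vecDeriv (𝓡 d) j x₀) (mapDeriv (𝓡 d) (𝓡 m) p x₀)
        (vecDeriv (𝓡 m) k₁ (p x₀)) (vecDeriv (𝓡 m) k₂ (p x₀)) := by
  refine hj.eq_of_sameRealOrbitIn (fun x => reducedForm (lieBivector e (j x))
    (vecDeriv (𝓡 d) j x) (mapDeriv (𝓡 d) (𝓡 m) p x) (vecDeriv (𝓡 m) k₁ (p x))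
      (vecDeriv (𝓡 m) k₂ (p x))) (fun x hx' => ?_) ((hp.fibre x₀ x₁).1 hx)
  rw [(hp.fibre x₀ x).2 hx'] at hk₁ hk₂
  obtain ⟨f, hf, hfk⟩ := hp.exists_contDiffAt_pullCovector_fderiv_eq hj hk₁
  obtain ⟨g, hg, hgk⟩ := hp.exists_contDiffAt_pullCovector_fderiv_eq hj hk₂
  obtain ⟨hd, hd₀⟩ := hj.fderiv_lieBivector_fderiv_eq_zero hf hg
    (hfk.mono fun x' h => (hp.isReductionAt hj x').pullCovector_vanishes h)
    (hgk.mono fun x' h => (hp.isReductionAt hj x').pullCovector_vanishes h)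
  refine ⟨_, hd, hd₀, ?_⟩
  filter_upwards [hfk, hgk] with x' hf' hg'
  exact lieBivector_congr (hj.range_vecDeriv x')
    ((pullCovector_extendCovector (hj.vecDeriv_injective x') _).trans hf'.symm)
    ((pullCovector_extendCovector (hj.vecDeriv_injective x') _).trans hg'.symm)

theorem exists_contMDiffAt_vecDeriv_eq (y : N) (α : EuclideanSpace ℝ (Fin m) →L[ℝ] ℂ) :
    ∃ k : N → ℂ, ContMDiffAt (𝓡 m) 𝓘(ℝ, ℂ) ∞ k y ∧ vecDeriv (𝓡 m) k y = α := by
  have hψ : ContMDiffAt (𝓡 m) 𝓘(ℝ, EuclideanSpace ℝ (Fin m)) ∞ (extChartAt (𝓡 m) y) y :=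
    contMDiffAt_extChartAt
  refine ⟨α ∘ extChartAt (𝓡 m) y, α.contMDiff.contMDiffAt.comp y hψ, ?_⟩
  rw [vecDeriv_comp (hψ.mdifferentiableAt (by simp)) α.differentiableAt, α.fderiv]
  exact (congrArg α.comp mfderiv_extChartAt_self).trans α.comp_id

theorem IsRealOrbitQuotient.reducedForm_lieBivector_eq
    (hp : IsRealOrbitQuotient (d := d) (m := m) e j p) (hj : IsOpenInOrbit (d := d) e z₀ j)
    {x₀ x₁ : X} (hx : p x₀ = p x₁) :
    reducedForm (lieBivector e (j x₁)) (vecDeriv (𝓡 d) j x₁) (mapDeriv (𝓡 d) (𝓡 m) p x₁) =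
      reducedForm (lieBivector e (j x₀)) (vecDeriv (𝓡 d) j x₀) (mapDeriv (𝓡 d) (𝓡 m) p x₀) := by
  refine LinearMap.ext₂ fun α β => ?_
  obtain ⟨k₁, hk₁, rfl⟩ := exists_contMDiffAt_vecDeriv_eq (p x₀) α
  obtain ⟨k₂, hk₂, rfl⟩ := exists_contMDiffAt_vecDeriv_eq (p x₀) β
  have h := hp.reducedForm_lieBivector_vecDeriv_eq hj hx hk₁ hk₂
  rwa [← hx] at h

theorem IsRealOrbitQuotient.reducedForm_lieBivectorConj_eq
    (hp : IsRealOrbitQuotient (d := d) (m := m) e j p) (hj : IsOpenInOrbit (d := d) e z₀ j)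
    {x₀ x₁ : X} (hx : p x₀ = p x₁) :
    reducedForm (lieBivectorConj e (j x₁)) (vecDeriv (𝓡 d) j x₁) (mapDeriv (𝓡 d) (𝓡 m) p x₁) =
      reducedForm (lieBivectorConj e (j x₀)) (vecDeriv (𝓡 d) j x₀) (mapDeriv (𝓡 d) (𝓡 m) p x₀) :=
  LinearMap.ext₂ fun α β => by
    rw [reducedForm_lieBivectorConj, reducedForm_lieBivectorConj,
      hp.reducedForm_lieBivector_eq hj hx]

end Reduction

/-! ### The covectors spanned by the generators -/

section Kernels

open Filter Topology

variable {ι : Type*} [Fintype ι] {𝔤₀ : Type*} [LieRing 𝔤₀] [LieAlgebra ℝ 𝔤₀]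

theorem poissonMatrix_star_mulVec_add_star_eq_zero (e : Module.Basis ι ℝ 𝔤₀) {z a b : ι → ℂ}
    (h : poissonMatrix e z *ᵥ a + poissonMatrix e (star z) *ᵥ b = 0) :
    poissonMatrix e z *ᵥ star b + poissonMatrix e (star z) *ᵥ star a = 0 := by
  have h' := congrArg star h
  rwa [star_add, star_zero, ← poissonMatrix_star_mulVec, ← poissonMatrix_star_mulVec, star_star,
    add_comm] at h'

variable [DecidableEq ι] {e : Module.Basis ι ℝ 𝔤₀} {V : Set (ι → ℂ)}
  {W : ℂ × ℂ → Set (ι → ℂ)} {z : ι → ℂ}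

theorem IsAdmissible.mem_span_star_holGrad (hV : IsAdmissible e V) (hz : z ∈ V) {v : ι → ℂ}
    (hv : poissonMatrix e (star z) *ᵥ v = 0) :
    v ∈ Submodule.span ℂ ((fun g => star (holGrad g z)) '' holCasimirs e V) := by
  have hv' : poissonMatrix e z *ᵥ star v = 0 := by
    simpa only [star_star, hv, star_zero] using poissonMatrix_star_mulVec e (star z) v
  have hle : Submodule.span ℂ ((fun g => holGrad g z) '' holCasimirs e V) ≤
      (Submodule.span ℂ ((fun g => star (holGrad g z)) '' holCasimirs e V)).comap
        (starLinearEquiv ℂ : (ι → ℂ) ≃ₗ⋆[ℂ] (ι → ℂ)).toLinearMap :=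
    Submodule.span_le.2 <| Set.image_subset_iff.2 fun g hg => Submodule.subset_span ⟨g, hg, rfl⟩
  simpa only [Submodule.mem_comap, LinearEquiv.coe_coe, starLinearEquiv_apply, star_star] using
    hle (hV.mem_span_holGrad hz hv')

theorem IsAdmissible.exists_mulVec_add_mulVec_right_eq_zero (hV : IsAdmissible e V) (hz : z ∈ V)
    (v : ι → ℂ) (hv : poissonMatrix e (star z) *ᵥ v = 0) :
    ∃ w, poissonMatrix e z *ᵥ v + poissonMatrix e (star z) *ᵥ w = 0 := by
  have hle : Submodule.span ℂ ((fun g => star (holGrad g z)) '' holCasimirs e V) ≤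
      (LinearMap.range (poissonMatrix e (star z)).mulVecLin).comap
        (poissonMatrix e z).mulVecLin :=
    Submodule.span_le.2 <| Set.image_subset_iff.2 fun g hg => ⟨-tildeCoeff g z,
      (Matrix.mulVec_neg _ _).trans
        (eq_neg_of_add_eq_zero_left (poissonMatrix_mulVec_tildeCoeff hV.1 hg hz)).symm⟩
  obtain ⟨w, hw⟩ := hle (hV.mem_span_star_holGrad hz hv)
  refine ⟨-w, ?_⟩
  rw [Matrix.mulVec_neg, ← sub_eq_add_neg, sub_eq_zero]
  exact hw.symm

theorem IsAdmissible.exists_mulVec_add_mulVec_left_eq_zero (hV : IsAdmissible e V) (hz : z ∈ V)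
    (w : ι → ℂ) (hw : poissonMatrix e z *ᵥ w = 0) :
    ∃ v, poissonMatrix e z *ᵥ v + poissonMatrix e (star z) *ᵥ w = 0 := by
  obtain ⟨v, hv⟩ := hV.exists_mulVec_add_mulVec_right_eq_zero hz (star w)
    (by rw [poissonMatrix_star_mulVec, hw, star_zero])
  exact ⟨star v, by simpa only [star_star] using poissonMatrix_star_mulVec_add_star_eq_zero e hv⟩

/-- The generators of `F_1` defined by means of `V` and the `W l` are defined near `z`, and there
are enough of them: `V` and the `W l` are admissible. -/
structure IsAdmissibleDomain (e : Module.Basis ι ℝ 𝔤₀) (V : Set (ι → ℂ))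
    (W : ℂ × ℂ → Set (ι → ℂ)) (z : ι → ℂ) : Prop where
  isAdmissible : IsAdmissible e V
  mem : z ∈ V
  isAdmissible_twist : ∀ l ≠ 0, IsAdmissible e (W l)
  phi_mem : ∀ l ≠ 0, phi l z ∈ W l

theorem IsAdmissibleDomain.isGeneratorDomain (h : IsAdmissibleDomain e V W z) :
    IsGeneratorDomain V W z :=
  ⟨h.isAdmissible.1, h.mem, fun l hl => (h.isAdmissible_twist l hl).1, h.phi_mem⟩

theorem IsAdmissibleDomain.phi_notMem_singSet (h : IsAdmissibleDomain e V W z) {l : ℂ × ℂ}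
    (hl : l ≠ 0) : phi l z ∉ singSet e :=
  (h.isAdmissible_twist l hl).2.1.notMem_of_mem_left (h.phi_mem l hl)

variable {T : Type*} [NormedAddCommGroup T] [NormedSpace ℝ T]

variable (e V W z) in
/-- The span of the restrictions along `J` of the differentials at `z` of the generators
of `F_1`. -/
noncomputable def generatorSpan (J : T →L[ℝ] (ι → ℂ)) : Submodule ℂ (T →L[ℝ] ℂ) :=
  Submodule.span ℂ ((fun G => pullCovector J (fderiv ℝ G z)) '' F1Generators e id V W)

variable {J : T →L[ℝ] (ι → ℂ)}

theorem pullCovector_mem_generatorSpan {F : (ι → ℂ) → ℂ} (hF : F ∈ F1Generators e id V W)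
    {η : (ι → ℂ) →L[ℝ] ℂ} (hη : HasFDerivAt F η z) :
    pullCovector J η ∈ generatorSpan e V W z J :=
  Submodule.subset_span ⟨F, hF, congrArg (pullCovector J) hη.fderiv⟩

theorem pullCovector_ofCoeff_smul_mem_generatorSpan {l : ℂ × ℂ} (h1 : l.1 ≠ 0) (h2 : l.2 ≠ 0)
    (hW : IsAdmissible e (W l)) (hz : phi l z ∈ W l) {u : ι → ℂ}
    (hu : poissonMatrix e (phi l z) *ᵥ u = 0) :
    pullCovector J (ofCoeff (l.1 • u, l.2 • u)) ∈ generatorSpan e V W z J := by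
  have hle : Submodule.span ℂ ((fun g => holGrad g (phi l z)) '' holCasimirs e (W l)) ≤
      (generatorSpan e V W z J).comap (pullCovector J ∘ₗ ofCoeff ∘ₗ
        (l.1 • LinearMap.id).prod (l.2 • LinearMap.id)) :=
    Submodule.span_le.2 <| Set.image_subset_iff.2 fun g hg =>
      pullCovector_mem_generatorSpan (mem_F1Generators_iff.2 (.inr (.inr ⟨l, h1, h2, g, hg, rfl⟩)))
        (hasFDerivAt_comp_phi hW.1 hg.1 l hz)
  exact hle (hW.mem_span_holGrad hz hu)

omit [DecidableEq ι] in
theorem pullCovector_ofCoeff_mem_of_mem_span_left (hJ : Set.range J = complexOrbitTangent e z)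
    {S : Submodule ℂ (T →L[ℝ] ℂ)} {s : Set (ι → ℂ)}
    (hs : ∀ v ∈ s, ∃ w, poissonMatrix e z *ᵥ v + poissonMatrix e (star z) *ᵥ w = 0 ∧
      pullCovector J (ofCoeff (v, w)) ∈ S) {v w : ι → ℂ} (hv : v ∈ Submodule.span ℂ s)
    (hvw : poissonMatrix e z *ᵥ v + poissonMatrix e (star z) *ᵥ w = 0) :
    pullCovector J (ofCoeff (v, w)) ∈ S := by
  have hle : Submodule.span ℂ s ≤ (LinearMap.ker ((poissonMatrix e z).mulVecLin.coprod
      (poissonMatrix e (star z)).mulVecLin) ⊓ S.comap (pullCovector J ∘ₗ ofCoeff)).map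
        (LinearMap.fst ℂ _ _) :=
    Submodule.span_le.2 fun v hv =>
      have ⟨w, hw, hS⟩ := hs v hv
      ⟨(v, w), ⟨hw, hS⟩, rfl⟩
  obtain ⟨⟨v, w'⟩, ⟨hw', hS⟩, (rfl : v = _)⟩ := hle hv
  rwa [pullCovector_ofCoeff_congr hJ (q := (v, w)) (q' := (v, w')) rfl
    (add_left_cancel (hvw.trans hw'.symm))]

omit [DecidableEq ι] in
theorem pullCovector_ofCoeff_mem_of_mem_span_right (hJ : Set.range J = complexOrbitTangent e z)
    {S : Submodule ℂ (T →L[ℝ] ℂ)} {s : Set (ι → ℂ)}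
    (hs : ∀ w ∈ s, ∃ v, poissonMatrix e z *ᵥ v + poissonMatrix e (star z) *ᵥ w = 0 ∧
      pullCovector J (ofCoeff (v, w)) ∈ S) {v w : ι → ℂ} (hw : w ∈ Submodule.span ℂ s)
    (hvw : poissonMatrix e z *ᵥ v + poissonMatrix e (star z) *ᵥ w = 0) :
    pullCovector J (ofCoeff (v, w)) ∈ S := by
  have hle : Submodule.span ℂ s ≤ (LinearMap.ker ((poissonMatrix e z).mulVecLin.coprod
      (poissonMatrix e (star z)).mulVecLin) ⊓ S.comap (pullCovector J ∘ₗ ofCoeff)).map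
        (LinearMap.snd ℂ _ _) :=
    Submodule.span_le.2 fun w hw =>
      have ⟨v, hv, hS⟩ := hs w hw
      ⟨(v, w), ⟨hv, hS⟩, rfl⟩
  obtain ⟨⟨v', w⟩, ⟨hv', hS⟩, (rfl : w = _)⟩ := hle hw
  rwa [pullCovector_ofCoeff_congr hJ (q := (v, w)) (q' := (v', w))
    (add_right_cancel (hvw.trans hv'.symm)) rfl]

namespace IsAdmissibleDomain

theorem pullCovector_ofCoeff_mem_of_left (h : IsAdmissibleDomain e V W z)
    (hJ : Set.range J = complexOrbitTangent e z) {v w : ι → ℂ}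
    (hv : poissonMatrix e (star z) *ᵥ v = 0)
    (hvw : poissonMatrix e z *ᵥ v + poissonMatrix e (star z) *ᵥ w = 0) :
    pullCovector J (ofCoeff (v, w)) ∈ generatorSpan e V W z J := by
  refine pullCovector_ofCoeff_mem_of_mem_span_left hJ ?_
    (h.isAdmissible.mem_span_star_holGrad h.mem hv) hvw
  rintro _ ⟨g, hg, rfl⟩
  exact ⟨tildeCoeff g z, poissonMatrix_mulVec_tildeCoeff h.isAdmissible.1 hg h.mem,
    pullCovector_mem_generatorSpan (mem_F1Generators_iff.2 (.inr (.inl ⟨g, hg, rfl⟩)))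
      (hasFDerivAt_tildeFun h.isAdmissible.1 hg.1 h.mem)⟩

theorem pullCovector_ofCoeff_star_tildeCoeff_mem (h : IsAdmissibleDomain e V W z)
    (hJ : Set.range J = complexOrbitTangent e z) {g : (ι → ℂ) → ℂ} (hg : g ∈ holCasimirs e V) :
    pullCovector J (ofCoeff (star (tildeCoeff g z), holGrad g z)) ∈ generatorSpan e V W z J := by
  refine mem_of_hasDerivAt ((generatorSpan e V W z J).comap (pullCovector J ∘ₗ ofCoeff))
    (hasDerivAt_holGrad_phi h.isAdmissible.1 hg.1 h.mem) ?_
  have phi_zero : phi (1, ((0 : ℝ) : ℂ)) z = z := by simp [phi_eq]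
  have hcont : ContinuousAt (fun ε : ℝ => phi (1, (ε : ℂ)) z) 0 := by
    simp only [phi_eq]
    fun_prop
  have hV : ∀ᶠ ε : ℝ in 𝓝 0, phi (1, (ε : ℂ)) z ∈ V :=
    hcont.eventually_mem (phi_zero.symm ▸ h.isAdmissible.1.mem_nhds h.mem)
  filter_upwards [hV] with ε hε
  change pullCovector J (ofCoeff _) ∈ generatorSpan e V W z J
  obtain rfl | h0 := eq_or_ne ε 0
  · rw [phi_zero, pullCovector_ofCoeff_congr hJ (q' := 0), map_zero, map_zero]
    · exact Submodule.zero_mem _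
    · rw [poissonMatrix_mulVec_holGrad hg h.mem, Prod.fst_zero, Matrix.mulVec_zero]
    · simp
  · have hl : ((1 : ℂ), (ε : ℂ)) ≠ 0 := fun h => one_ne_zero (congrArg Prod.fst h)
    have := pullCovector_ofCoeff_smul_mem_generatorSpan (V := V) (J := J) one_ne_zero
      (Complex.ofReal_ne_zero.2 h0) (h.isAdmissible_twist _ hl) (h.phi_mem _ hl)
      (poissonMatrix_mulVec_holGrad hg hε)
    rwa [one_smul] at this

theorem pullCovector_ofCoeff_mem_of_right (h : IsAdmissibleDomain e V W z)
    (hJ : Set.range J = complexOrbitTangent e z) {v w : ι → ℂ}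
    (hw : poissonMatrix e z *ᵥ w = 0)
    (hvw : poissonMatrix e z *ᵥ v + poissonMatrix e (star z) *ᵥ w = 0) :
    pullCovector J (ofCoeff (v, w)) ∈ generatorSpan e V W z J := by
  refine pullCovector_ofCoeff_mem_of_mem_span_right hJ ?_
    (h.isAdmissible.mem_span_holGrad h.mem hw) hvw
  rintro _ ⟨g, hg, rfl⟩
  refine ⟨star (tildeCoeff g z), ?_, h.pullCovector_ofCoeff_star_tildeCoeff_mem hJ hg⟩
  simpa only [star_star] using poissonMatrix_star_mulVec_add_star_eq_zero e
    (poissonMatrix_mulVec_tildeCoeff h.isAdmissible.1 hg h.mem)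

end IsAdmissibleDomain

namespace IsReductionAt

variable {Q : Type*} [NormedAddCommGroup Q] [NormedSpace ℝ Q] [FiniteDimensional ℝ Q]
  {P : T →L[ℝ] Q} {l : ℂ × ℂ} {α : Q →L[ℝ] ℂ}

theorem reducedPencil_eq_zero_iff (h : IsReductionAt e z J P) (hl : l.1 ≠ 0) :
    reducedPencil e z J P l α = 0 ↔
      ∃ t, (l.2 • poissonMatrix e z + l.1 • poissonMatrix e (star z)) *ᵥ t = 0 ∧
        poissonMatrix e z *ᵥ holCoeff (extendCovector J (pullCovector P α)) =
          poissonMatrix e z *ᵥ t := by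
  rw [reducedPencil_eq_pencilForm]
  exact h.isPencilReduction.pencilForm_eq_zero_iff hl α

theorem reducedPencil_eq_zero_iff_of_fst_eq_zero (h : IsReductionAt e z J P) (hl : l.2 ≠ 0)
    (hl1 : l.1 = 0) :
    reducedPencil e z J P l α = 0 ↔
      ∃ t, poissonMatrix e z *ᵥ t = 0 ∧
        poissonMatrix e (star z) *ᵥ antiholCoeff (extendCovector J (pullCovector P α)) =
          poissonMatrix e (star z) *ᵥ t := by
  rw [reducedPencil_eq_pencilForm, ← pencilForm_swap,
    h.isPencilReduction.symm.pencilForm_eq_zero_iff hl]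
  simp only [Prod.fst_swap, Prod.snd_swap, hl1, zero_smul, zero_add, Matrix.smul_mulVec,
    smul_eq_zero, hl, false_or]
  rfl

theorem reducedPencil_eq_zero (h : IsReductionAt e z J P) (hl : l.1 ≠ 0) {q : (ι → ℂ) × (ι → ℂ)}
    (hα : pullCovector P α = pullCovector J (ofCoeff q))
    (hq : (l.2 • poissonMatrix e z + l.1 • poissonMatrix e (star z)) *ᵥ q.1 = 0) :
    reducedPencil e z J P l α = 0 := by
  refine (h.reducedPencil_eq_zero_iff hl).2 ⟨q.1, hq, ?_⟩
  have hα' := (pullCovector_extendCovector h.inj (pullCovector P α)).trans hα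
  exact (holCoeff_ofCoeff q) ▸ ((pullCovector_eq_iff_of_range h.range).1 hα').1

theorem pullCovector_mem_generatorSpan (h : IsReductionAt e z J P)
    (hdom : IsAdmissibleDomain e V W z) (hl : l ≠ 0) (hα : reducedPencil e z J P l α = 0) :
    pullCovector P α ∈ generatorSpan e V W z J := by
  have hrel := h.isPencilReduction.rel α
  simp only [LinearMap.comp_apply] at hrel
  rw [← pullCovector_ofCoeff_extendCovector h.inj (pullCovector P α)]
  have hzero := h.reducedPencil_eq_zero_iff (l := l) (α := α)
  have hzero' := h.reducedPencil_eq_zero_iff_of_fst_eq_zero (l := l) (α := α)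
  generalize holCoeff (extendCovector J (pullCovector P α)) = a at *
  generalize antiholCoeff (extendCovector J (pullCovector P α)) = b at *
  obtain h1 | h1 := eq_or_ne l.1 0
  · obtain ⟨t, ht, hbt⟩ := (hzero' (fun h2 => hl (Prod.ext h1 h2)) h1).1 hα
    rw [pullCovector_ofCoeff_congr h.range (q := (a, b)) (q' := (a, t)) rfl hbt]
    exact hdom.pullCovector_ofCoeff_mem_of_right h.range ht (hbt ▸ hrel)
  obtain ⟨t, ht, hat⟩ := (hzero h1).1 hα
  rw [Matrix.add_mulVec, Matrix.smul_mulVec, Matrix.smul_mulVec] at ht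
  obtain h2 | h2 := eq_or_ne l.2 0
  · rw [h2, zero_smul, zero_add, smul_eq_zero, or_iff_right h1] at ht
    rw [pullCovector_ofCoeff_congr h.range (q := (a, b)) (q' := (t, b)) hat rfl]
    exact hdom.pullCovector_ofCoeff_mem_of_left h.range ht (hat ▸ hrel)
  · have hl' : (l.2, l.1) ≠ 0 := fun h0 => h2 (congrArg Prod.fst h0)
    have hu : poissonMatrix e (phi (l.2, l.1) z) *ᵥ (l.2⁻¹ • t) = 0 := by
      rw [poissonMatrix_phi, Matrix.mulVec_smul, Matrix.add_mulVec, Matrix.smul_mulVec,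
        Matrix.smul_mulVec, ht, smul_zero]
    convert pullCovector_ofCoeff_smul_mem_generatorSpan (V := V) (J := J) h2 h1
      (hdom.isAdmissible_twist _ hl') (hdom.phi_mem _ hl') hu using 1
    refine pullCovector_ofCoeff_congr h.range ?_ ?_
    · rw [smul_inv_smul₀ h2, hat]
    · rw [Matrix.mulVec_smul, Matrix.mulVec_smul, smul_comm, eq_neg_of_add_eq_zero_right ht,
        smul_neg, inv_smul_smul₀ h2, ← hat, eq_neg_of_add_eq_zero_right hrel]

theorem finrank_range_reducedPencil_eq (h : IsReductionAt e z J P)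
    (hdom : IsAdmissibleDomain e V W z) {l' : ℂ × ℂ} (hl : l ≠ 0) (hl' : l' ≠ 0) :
    Module.finrank ℂ (LinearMap.range (reducedPencil e z J P l)) =
      Module.finrank ℂ (LinearMap.range (reducedPencil e z J P l')) := by
  rw [reducedPencil_eq_pencilForm, reducedPencil_eq_pencilForm]
  refine h.isPencilReduction.finrank_range_pencilForm_eq
    (hdom.isAdmissible.exists_mulVec_add_mulVec_right_eq_zero hdom.mem)
    (hdom.isAdmissible.exists_mulVec_add_mulVec_left_eq_zero hdom.mem)
    (r := lieRank e) (fun l hl => ?_) hl hl'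
  rw [← poissonMatrix_phi]
  exact finrank_ker_poissonMatrix (hdom.phi_notMem_singSet hl)

end IsReductionAt

end Kernels

/-! ### Pencils of bivector fields -/

section Pencil

variable {B : Type*} [NormedAddCommGroup B] [NormedSpace ℝ B]
  {H : Type*} [TopologicalSpace H] {I : ModelWithCorners ℝ B H}
  {M : Type*} [TopologicalSpace M] [ChartedSpace H M]

/-- All nonzero members of the pencil spanned by `c₁` and `c₂` have the same pointwise ranks. -/
def IsEquirankPencil (c₁ c₂ : BivectorField I M) : Prop :=
  ∀ l l' : ℂ × ℂ, l ≠ 0 → l' ≠ 0 → ∀ y,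
    Module.finrank ℂ (LinearMap.range (l.1 • c₁ y + l.2 • c₂ y)) =
      Module.finrank ℂ (LinearMap.range (l'.1 • c₁ y + l'.2 • c₂ y))

theorem bivectorRank_zero : bivectorRank (0 : BivectorField I M) = 0 := by
  have h (x : M) : Module.finrank ℂ (LinearMap.range ((0 : BivectorField I M) x)) = 0 := by
    rw [Pi.zero_apply, LinearMap.range_zero, finrank_bot]
  exact le_bot_iff.1 (ciSup_le' fun x => (h x).le)

section Finite

variable [FiniteDimensional ℝ B]

theorem finite_complexCotangent (x : M) : Module.Finite ℂ (ComplexCotangent I x) :=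
  Module.Finite.of_restrictScalars_finite ℝ ℂ (B →L[ℝ] ℂ)

theorem finrank_range_le_bivectorRank (b : BivectorField I M) (x : M) :
    Module.finrank ℂ (LinearMap.range (b x)) ≤ bivectorRank b := by
  refine le_ciSup (f := fun x => Module.finrank ℂ (LinearMap.range (b x)))
    ⟨Module.finrank ℂ (B →L[ℝ] ℂ), Set.forall_mem_range.2 fun y => ?_⟩ x
  have := finite_complexCotangent (I := I) y
  exact LinearMap.finrank_range_le (b y)

theorem bivectorRank_eq_zero_iff {b : BivectorField I M} : bivectorRank b = 0 ↔ b = 0 := by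
  refine ⟨fun hb => funext fun x => ?_, fun hb => hb ▸ bivectorRank_zero⟩
  have := finite_complexCotangent (I := I) x
  have hx : Module.finrank ℂ (LinearMap.range (b x)) = 0 :=
    Nat.le_zero.1 (hb ▸ finrank_range_le_bivectorRank b x)
  exact LinearMap.range_eq_bot.1 (Submodule.finrank_eq_zero.1 hx)

end Finite

theorem cdiff_mem_of_mem_firstIntegrals {J : Submodule ℂ (BivectorField I M)} {x : M}
    {S : Submodule ℂ (ComplexCotangent I x)}
    (hS : ∀ b ∈ maximalRankPart J, ∀ f ∈ casimirs b, cdiff I f x ∈ S) {f : M → ℂ}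
    (hf : f ∈ firstIntegrals J) : cdiff I f x ∈ S := by
  suffices MDifferentiableAt I 𝓘(ℝ, ℂ) f x ∧ cdiff I f x ∈ S from this.2
  induction hf using Submodule.span_induction with
  | mem f hf =>
    obtain ⟨b, hb, hf⟩ := Set.mem_iUnion₂.1 hf
    exact ⟨(hf.1 x).mdifferentiableAt (by simp), hS b hb f hf⟩
  | zero =>
    have h0 : cdiff I (0 : M → ℂ) x = 0 := mfderiv_const
    exact ⟨mdifferentiableAt_const, h0 ▸ S.zero_mem⟩
  | add f g _ _ hf hg =>
    have hadd : cdiff I (f + g) x = cdiff I f x + cdiff I g x := mfderiv_add hf.1 hg.1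
    exact ⟨hf.1.add hg.1, hadd ▸ S.add_mem hf.2 hg.2⟩
  | smul a f _ hf =>
    have ha : HasFDerivAt (a * ·) (a • ContinuousLinearMap.id ℝ ℂ) (f x) :=
      (hasFDerivAt_id (f x)).const_mul a
    have hsmul : cdiff I (a • f) x = a • cdiff I f x :=
      (vecDeriv_comp hf.1 ha.differentiableAt).trans (by rw [ha.fderiv]; rfl)
    exact ⟨ha.differentiableAt.mdifferentiableAt.comp x hf.1, hsmul ▸ S.smul_mem a hf.2⟩

namespace IsEquirankPencil

variable {c₁ c₂ : BivectorField I M}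

theorem mem_maximalRankPart (h : IsEquirankPencil c₁ c₂) {l : ℂ × ℂ} (hl : l ≠ 0) :
    l.1 • c₁ + l.2 • c₂ ∈ maximalRankPart (Submodule.span ℂ {c₁, c₂}) := by
  refine ⟨Submodule.mem_span_pair.2 ⟨l.1, l.2, rfl⟩, fun b' hb' => ?_⟩
  obtain ⟨a₁, a₂, rfl⟩ := Submodule.mem_span_pair.1 hb'
  by_cases ha : ((a₁, a₂) : ℂ × ℂ) = 0
  · obtain ⟨rfl, rfl⟩ := Prod.mk_eq_zero.1 ha
    rw [zero_smul, zero_smul, add_zero, bivectorRank_zero]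
    exact Nat.zero_le _
  · exact (iSup_congr (h _ _ ha hl)).le

theorem casimirs_subset (h : IsEquirankPencil c₁ c₂) {l : ℂ × ℂ} (hl : l ≠ 0) :
    casimirs (l.1 • c₁ + l.2 • c₂) ⊆ firstIntegrals (Submodule.span ℂ {c₁, c₂}) := fun _ hf =>
  Submodule.subset_span (Set.mem_biUnion (h.mem_maximalRankPart hl) hf)

theorem exists_mem_casimirs [FiniteDimensional ℝ B] (h : IsEquirankPencil c₁ c₂)
    {b : BivectorField I M} (hb : b ∈ maximalRankPart (Submodule.span ℂ {c₁, c₂})) {f : M → ℂ}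
    (hf : f ∈ casimirs b) : ∃ l : ℂ × ℂ, l ≠ 0 ∧ f ∈ casimirs (l.1 • c₁ + l.2 • c₂) := by
  obtain ⟨a₁, a₂, rfl⟩ := Submodule.mem_span_pair.1 hb.1
  by_cases ha : ((a₁, a₂) : ℂ × ℂ) = 0
  · obtain ⟨rfl, rfl⟩ := Prod.mk_eq_zero.1 ha
    have hl : ((1 : ℂ), (0 : ℂ)) ≠ 0 := by simp
    have hrank := hb.2 _ (h.mem_maximalRankPart hl).1
    simp only [zero_smul, add_zero, bivectorRank_zero, Nat.le_zero, bivectorRank_eq_zero_iff]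
      at hrank hf
    exact ⟨(1, 0), hl, by simpa only [zero_smul, add_zero, hrank] using hf⟩
  · exact ⟨_, ha, hf⟩

end IsEquirankPencil

end Pencil

/-! ### Functions on the quotient -/

section Descent

open Filter Topology

variable {ι : Type*} [Fintype ι] [DecidableEq ι] {𝔤₀ : Type*} [LieRing 𝔤₀] [LieAlgebra ℝ 𝔤₀]
  {e : Module.Basis ι ℝ 𝔤₀}
  {d m : ℕ} {X : Type*} [TopologicalSpace X] [ChartedSpace (EuclideanSpace ℝ (Fin d)) X]
  [IsManifold (𝓡 d) ∞ X]
  {N : Type*} [TopologicalSpace N] [ChartedSpace (EuclideanSpace ℝ (Fin m)) N]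
  {z₀ : ι → ℂ} {j : X → ι → ℂ} {p : X → N} {f : X → ℂ}

theorem IsRealOrbitQuotient.eq_of_vecDeriv_eq_zero
    (hp : IsRealOrbitQuotient (d := d) (m := m) e j p) (hj : IsOpenInOrbit (d := d) e z₀ j)
    (hf : ContMDiff (𝓡 d) 𝓘(ℝ, ℂ) ∞ f)
    (hf₀ : ∀ x w, mapDeriv (𝓡 d) (𝓡 m) p x w = 0 → vecDeriv (𝓡 d) f x w = 0) {x₀ x₁ : X}
    (hx : p x₀ = p x₁) : f x₁ = f x₀ := by
  refine hj.eq_of_sameRealOrbitIn f (fun x _ => ?_) ((hp.fibre x₀ x₁).1 hx)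
  obtain ⟨F, hF, hFj⟩ := hj.exists_contDiffAt_eventually_apply_eq (hf x)
  have hF' : DifferentiableAt ℝ F (j x) := hF.differentiableAt (by simp)
  refine ⟨F, hF', fun v hv => ?_, hFj.mono fun _ h => h.symm⟩
  obtain ⟨w, rfl⟩ : v ∈ Set.range (vecDeriv (𝓡 d) j x) :=
    hj.range_vecDeriv x ▸ realOrbitTangent_subset_complexOrbitTangent e (j x) hv
  have hfw := hf₀ x w (((hp.isReductionAt hj x).ker w).2 hv)
  rwa [← vecDeriv_congr (f := F ∘ j) hFj, vecDeriv_comp (hj.mdifferentiableAt x) hF'] at hfw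

theorem IsRealOrbitQuotient.exists_comp_eq
    (hp : IsRealOrbitQuotient (d := d) (m := m) e j p) (hj : IsOpenInOrbit (d := d) e z₀ j)
    (hf : ContMDiff (𝓡 d) 𝓘(ℝ, ℂ) ∞ f)
    (hf₀ : ∀ x w, mapDeriv (𝓡 d) (𝓡 m) p x w = 0 → vecDeriv (𝓡 d) f x w = 0) :
    ∃ h : N → ℂ, ContMDiff (𝓡 m) 𝓘(ℝ, ℂ) ∞ h ∧ h ∘ p = f := by
  have hcomp (x : X) : f (Function.surjInv hp.surjective (p x)) = f x :=
    hp.eq_of_vecDeriv_eq_zero hj hf hf₀ (Function.surjInv_eq hp.surjective (p x)).symm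
  refine ⟨f ∘ Function.surjInv hp.surjective, hp.surjective.forall.2 fun x => ?_, funext hcomp⟩
  obtain ⟨s, hs, -, hps⟩ := exists_contMDiffAt_rightInverse_of_surjective_mfderiv (hp.smooth x)
    (by simp) (hp.submersion x)
  refine ((hf _).comp (p x) hs).congr_of_eventuallyEq (hps.mono fun y hy => ?_)
  have h := hcomp (s y)
  rwa [hy] at h

end Descent

/-! ### The reduced pencil -/

section ReducedPencil

variable {ι : Type*} [Fintype ι] [DecidableEq ι] {𝔤₀ : Type*} [LieRing 𝔤₀] [LieAlgebra ℝ 𝔤₀]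
  {d m : ℕ} {X : Type*} [TopologicalSpace X] [ChartedSpace (EuclideanSpace ℝ (Fin d)) X]
  {N : Type*} [TopologicalSpace N] [ChartedSpace (EuclideanSpace ℝ (Fin m)) N]

/-- `c₁` and `c₂` are the reductions to the quotient `N` of the linear Poisson bivector and of its
conjugate: at `p x` they are the forms induced by the values of these bivectors at `j x`. -/
structure IsReducedPencil (e : Module.Basis ι ℝ 𝔤₀) (j : X → ι → ℂ) (p : X → N)
    (c₁ c₂ : BivectorField (𝓡 m) N) : Prop where
  left : ∀ x, c₁ (p x) = reducedForm (lieBivector e (j x)) (vecDeriv (𝓡 d) j x)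
    (mapDeriv (𝓡 d) (𝓡 m) p x)
  right : ∀ x, c₂ (p x) = reducedForm (lieBivectorConj e (j x)) (vecDeriv (𝓡 d) j x)
    (mapDeriv (𝓡 d) (𝓡 m) p x)

variable {e : Module.Basis ι ℝ 𝔤₀} {z₀ : ι → ℂ} {j : X → ι → ℂ} {p : X → N} {V : Set (ι → ℂ)}
  {W : ℂ × ℂ → Set (ι → ℂ)} {c₁ c₂ : BivectorField (𝓡 m) N}

theorem IsRealOrbitQuotient.exists_isReducedPencil [IsManifold (𝓡 d) ∞ X] [IsManifold (𝓡 m) ∞ N]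
    (hp : IsRealOrbitQuotient (d := d) (m := m) e j p) (hj : IsOpenInOrbit (d := d) e z₀ j) :
    ∃ c₁ c₂ : BivectorField (𝓡 m) N, IsReducedPencil (d := d) e j p c₁ c₂ := by
  let s := Function.surjInv hp.surjective
  have hs (x : X) : p x = p (s (p x)) := (Function.surjInv_eq hp.surjective (p x)).symm
  exact ⟨fun y => reducedForm (lieBivector e (j (s y))) (vecDeriv (𝓡 d) j (s y))
      (mapDeriv (𝓡 d) (𝓡 m) p (s y)),
    fun y => reducedForm (lieBivectorConj e (j (s y))) (vecDeriv (𝓡 d) j (s y))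
      (mapDeriv (𝓡 d) (𝓡 m) p (s y)),
    fun x => hp.reducedForm_lieBivector_eq hj (hs x),
    fun x => hp.reducedForm_lieBivectorConj_eq hj (hs x)⟩

namespace IsReducedPencil

theorem isReduction (h : IsReducedPencil (d := d) e j p c₁ c₂)
    (hj : IsOpenInOrbit (d := d) e z₀ j) : IsReduction (d := d) e j p c₁ c₂ := by
  have hext (x : X) (α : (ι → ℂ) →L[ℝ] ℂ) :
      pullCovector (vecDeriv (𝓡 d) j x) α = pullCovector (vecDeriv (𝓡 d) j x)
        (extendCovector (vecDeriv (𝓡 d) j x) (pullCovector (vecDeriv (𝓡 d) j x) α)) :=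
    (pullCovector_extendCovector (hj.vecDeriv_injective x) _).symm
  exact ⟨fun x => (lieBivector e (j x)).compl₁₂ (extendCovector (vecDeriv (𝓡 d) j x))
      (extendCovector (vecDeriv (𝓡 d) j x)),
    fun x => (lieBivectorConj e (j x)).compl₁₂ (extendCovector (vecDeriv (𝓡 d) j x))
      (extendCovector (vecDeriv (𝓡 d) j x)),
    fun x α β => lieBivector_congr (hj.range_vecDeriv x) (hext x α) (hext x β),
    fun x α β => lieBivectorConj_congr (hj.range_vecDeriv x) (hext x α) (hext x β),
    fun x α β => congrArg (fun b => b α β) (h.left x),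
    fun x α β => congrArg (fun b => b α β) (h.right x)⟩

theorem apply_eq (h : IsReducedPencil (d := d) e j p c₁ c₂) (l : ℂ × ℂ) (x : X) :
    (l.1 • c₁ + l.2 • c₂) (p x) =
      reducedPencil e (j x) (vecDeriv (𝓡 d) j x) (mapDeriv (𝓡 d) (𝓡 m) p x) l :=
  congrArg₂ (l.1 • · + l.2 • ·) (h.left x) (h.right x)

theorem isEquirankPencil (h : IsReducedPencil (d := d) e j p c₁ c₂)
    (hp : IsRealOrbitQuotient (d := d) (m := m) e j p) (hj : IsOpenInOrbit (d := d) e z₀ j)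
    (hdom : ∀ x, IsAdmissibleDomain e V W (j x)) : IsEquirankPencil c₁ c₂ := by
  refine fun l l' hl hl' => hp.surjective.forall.2 fun x => ?_
  have h₁ := h.apply_eq l x
  have h₂ := h.apply_eq l' x
  simp only [Pi.add_apply, Pi.smul_apply] at h₁ h₂
  rw [h₁, h₂]
  exact (hp.isReductionAt hj x).finrank_range_reducedPencil_eq (hdom x) hl hl'

end IsReducedPencil

end ReducedPencil

/-! ### First integrals and generators -/

section FirstIntegrals

section Pointwise

variable {ι : Type*} [Fintype ι] [DecidableEq ι] {𝔤₀ : Type*} [LieRing 𝔤₀] [LieAlgebra ℝ 𝔤₀]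
  {e : Module.Basis ι ℝ 𝔤₀} {V : Set (ι → ℂ)} {W : ℂ × ℂ → Set (ι → ℂ)}

theorem IsReductionAt.apply_eq_zero_of_mem_generatorSpan {z : ι → ℂ}
    {T : Type*} [NormedAddCommGroup T] [NormedSpace ℝ T]
    {Q : Type*} [NormedAddCommGroup Q] [NormedSpace ℝ Q] {J : T →L[ℝ] (ι → ℂ)} {P : T →L[ℝ] Q}
    (h : IsReductionAt e z J P) (hdom : IsGeneratorDomain V W z) {α : T →L[ℝ] ℂ}
    (hα : α ∈ generatorSpan e V W z J) {w : T} (hw : P w = 0) : α w = 0 := by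
  induction hα using Submodule.span_induction with
  | mem α hα =>
    obtain ⟨G, hG, rfl⟩ := hα
    exact hdom.fderiv_eq_zero hG (J w) ((h.ker w).1 hw)
  | zero => rfl
  | add α β _ _ hα hβ => rw [_root_.add_apply, hα, hβ, add_zero]
  | smul c α _ hα => rw [_root_.smul_apply, hα, smul_zero]

theorem IsGeneratorDomain.generatorSpan_vecDeriv_eq {E : Type*} [NormedAddCommGroup E]
    [NormedSpace ℝ E] {H : Type*} [TopologicalSpace H] {I : ModelWithCorners ℝ E H}
    {M : Type*} [TopologicalSpace M] [ChartedSpace H M] {j : M → ι → ℂ} {x : M}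
    (h : IsGeneratorDomain V W (j x)) (hj : MDifferentiableAt I 𝓘(ℝ, ι → ℂ) j x) :
    generatorSpan e V W (j x) (vecDeriv I j x) =
      Submodule.span ℂ ((fun s => vecDeriv I s x) '' F1Generators e j V W) := by
  rw [F1Generators_eq_image, Set.image_image, generatorSpan]
  exact congrArg (Submodule.span ℂ) (Set.image_congr fun G hG =>
    (vecDeriv_comp hj ((h.contDiffAt hG).differentiableAt (by simp))).symm)

end Pointwise

variable {ι : Type*} [Fintype ι] [DecidableEq ι] {𝔤₀ : Type*} [LieRing 𝔤₀] [LieAlgebra ℝ 𝔤₀]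
  {e : Module.Basis ι ℝ 𝔤₀}
  {d m : ℕ} {X : Type*} [TopologicalSpace X] [ChartedSpace (EuclideanSpace ℝ (Fin d)) X]
  {N : Type*} [TopologicalSpace N] [ChartedSpace (EuclideanSpace ℝ (Fin m)) N]
  {z₀ : ι → ℂ} {j : X → ι → ℂ} {p : X → N} {V : Set (ι → ℂ)} {W : ℂ × ℂ → Set (ι → ℂ)}
  {c₁ c₂ : BivectorField (𝓡 m) N} {G : (ι → ℂ) → ℂ}

theorem IsRealOrbitQuotient.exists_pullCovector_vecDeriv_eq [IsManifold (𝓡 d) ∞ X]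
    (hp : IsRealOrbitQuotient (d := d) (m := m) e j p) (hj : IsOpenInOrbit (d := d) e z₀ j)
    (hdom : ∀ x, IsGeneratorDomain V W (j x)) (hG : G ∈ F1Generators e id V W) :
    ∃ s : N → ℂ, ContMDiff (𝓡 m) 𝓘(ℝ, ℂ) ∞ s ∧ ∀ x,
      pullCovector (mapDeriv (𝓡 d) (𝓡 m) p x) (vecDeriv (𝓡 m) s (p x)) =
        pullCovector (vecDeriv (𝓡 d) j x) (fderiv ℝ G (j x)) := by
  have hGj (x : X) : vecDeriv (𝓡 d) (G ∘ j) x =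
      pullCovector (vecDeriv (𝓡 d) j x) (fderiv ℝ G (j x)) :=
    vecDeriv_comp (hj.mdifferentiableAt x) (((hdom x).contDiffAt hG).differentiableAt (by simp))
  obtain ⟨s, hs, hsp⟩ := hp.exists_comp_eq hj (f := G ∘ j)
    (fun x => ((hdom x).contDiffAt hG).contMDiffAt.comp x (hj.smooth x)) fun x w hw => by
      rw [hGj]
      exact (hp.isReductionAt hj x).apply_eq_zero_of_mem_generatorSpan (hdom x)
        (Submodule.subset_span ⟨G, hG, rfl⟩) hw
  refine ⟨s, hs, fun x => ?_⟩
  rw [← hGj, ← hsp, vecDeriv_comp_map (hp.mdifferentiableAt x)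
    ((hs (p x)).mdifferentiableAt (by simp))]
  rfl

namespace IsReducedPencil

theorem exists_mem_casimirs_of_generator [IsManifold (𝓡 d) ∞ X]
    (h : IsReducedPencil (d := d) e j p c₁ c₂)
    (hp : IsRealOrbitQuotient (d := d) (m := m) e j p) (hj : IsOpenInOrbit (d := d) e z₀ j)
    (hdom : ∀ x, IsGeneratorDomain V W (j x)) (hG : G ∈ F1Generators e id V W)
    {l : ℂ × ℂ} (hl : l.1 ≠ 0)
    (hGl : ∀ x, ∃ q, pullCovector (vecDeriv (𝓡 d) j x) (fderiv ℝ G (j x)) =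
        pullCovector (vecDeriv (𝓡 d) j x) (ofCoeff q) ∧
      (l.2 • poissonMatrix e (j x) + l.1 • poissonMatrix e (star (j x))) *ᵥ q.1 = 0) :
    ∃ s ∈ casimirs (l.1 • c₁ + l.2 • c₂), ∀ x,
      pullCovector (mapDeriv (𝓡 d) (𝓡 m) p x) (vecDeriv (𝓡 m) s (p x)) =
        pullCovector (vecDeriv (𝓡 d) j x) (fderiv ℝ G (j x)) := by
  obtain ⟨s, hs, hsG⟩ := hp.exists_pullCovector_vecDeriv_eq hj hdom hG
  refine ⟨s, ⟨hs, hp.surjective.forall.2 fun x => ?_⟩, hsG⟩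
  obtain ⟨q, hGq, hq⟩ := hGl x
  rw [h.apply_eq]
  exact (hp.isReductionAt hj x).reducedPencil_eq_zero hl ((hsG x).trans hGq) hq

theorem exists_mem_firstIntegrals [IsManifold (𝓡 d) ∞ X]
    (h : IsReducedPencil (d := d) e j p c₁ c₂)
    (hp : IsRealOrbitQuotient (d := d) (m := m) e j p) (hj : IsOpenInOrbit (d := d) e z₀ j)
    (hdom : ∀ x, IsAdmissibleDomain e V W (j x)) (hG : G ∈ F1Generators e id V W) :
    ∃ s ∈ firstIntegrals (Submodule.span ℂ {c₁, c₂}), ∀ x,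
      pullCovector (mapDeriv (𝓡 d) (𝓡 m) p x) (vecDeriv (𝓡 m) s (p x)) =
        pullCovector (vecDeriv (𝓡 d) j x) (fderiv ℝ G (j x)) := by
  have hdom' (x : X) := (hdom x).isGeneratorDomain
  suffices ∃ l : ℂ × ℂ, l.1 ≠ 0 ∧ ∀ x, ∃ q,
      pullCovector (vecDeriv (𝓡 d) j x) (fderiv ℝ G (j x)) =
        pullCovector (vecDeriv (𝓡 d) j x) (ofCoeff q) ∧
      (l.2 • poissonMatrix e (j x) + l.1 • poissonMatrix e (star (j x))) *ᵥ q.1 = 0 by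
    obtain ⟨l, hl, hGl⟩ := this
    obtain ⟨s, hs, hsG⟩ := h.exists_mem_casimirs_of_generator hp hj hdom' hG hl hGl
    exact ⟨s, (h.isEquirankPencil hp hj hdom).casimirs_subset
      (fun h0 => hl (congrArg Prod.fst h0)) hs, hsG⟩
  obtain ⟨g, hg, rfl⟩ | ⟨g, hg, rfl⟩ | ⟨l, h1, h2, g, hg, rfl⟩ := mem_F1Generators_iff.1 hG
  · refine ⟨(1, 0), one_ne_zero, fun x => ⟨0, ?_, Matrix.mulVec_zero _⟩⟩
    obtain ⟨hV, hx, -, -⟩ := hdom' x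
    rw [Function.comp_id, (hasFDerivAt_holomorphic hV hg.1 hx).fderiv]
    refine pullCovector_ofCoeff_congr (hj.range_vecDeriv x) ?_ rfl
    rw [poissonMatrix_mulVec_holGrad hg hx, Prod.fst_zero, Matrix.mulVec_zero]
  · refine ⟨(1, 0), one_ne_zero, fun x => ⟨(star (holGrad g (j x)), tildeCoeff g (j x)), ?_, ?_⟩⟩
    · obtain ⟨hV, hx, -, -⟩ := hdom' x
      rw [Function.comp_id, (hasFDerivAt_tildeFun hV hg.1 hx).fderiv]
    · rw [zero_smul, zero_add, one_smul, poissonMatrix_star_mulVec,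
        poissonMatrix_mulVec_holGrad hg (hdom' x).mem, star_zero]
  · have hl : l ≠ 0 := fun h0 => h1 (congrArg Prod.fst h0)
    refine ⟨l.swap, h2, fun x =>
      ⟨(l.1 • holGrad g (phi l (j x)), l.2 • holGrad g (phi l (j x))), ?_, ?_⟩⟩
    · exact congrArg _ (hasFDerivAt_comp_phi ((hdom' x).isOpen_twist l hl) hg.1 l
        ((hdom' x).phi_mem l hl)).fderiv
    · rw [Prod.fst_swap, Prod.snd_swap, ← poissonMatrix_phi, Matrix.mulVec_smul,
        poissonMatrix_mulVec_holGrad hg ((hdom' x).phi_mem l hl), smul_zero]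

theorem pullCovector_vecDeriv_mem_generatorSpan (h : IsReducedPencil (d := d) e j p c₁ c₂)
    (hp : IsRealOrbitQuotient (d := d) (m := m) e j p) (hj : IsOpenInOrbit (d := d) e z₀ j)
    (hdom : ∀ x, IsAdmissibleDomain e V W (j x)) {s : N → ℂ}
    (hs : s ∈ firstIntegrals (Submodule.span ℂ {c₁, c₂})) (x : X) :
    pullCovector (mapDeriv (𝓡 d) (𝓡 m) p x) (vecDeriv (𝓡 m) s (p x)) ∈
      generatorSpan e V W (j x) (vecDeriv (𝓡 d) j x) := by
  let S : Submodule ℂ (EuclideanSpace ℝ (Fin m) →L[ℝ] ℂ) := (generatorSpan e V W (j x)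
    (vecDeriv (𝓡 d) j x)).comap (pullCovector (mapDeriv (𝓡 d) (𝓡 m) p x))
  refine cdiff_mem_of_mem_firstIntegrals (S := S) (fun b hb f hf => ?_) hs
  obtain ⟨l, hl, hf⟩ := (h.isEquirankPencil hp hj hdom).exists_mem_casimirs hb hf
  exact (hp.isReductionAt hj x).pullCovector_mem_generatorSpan (hdom x) hl
    (h.apply_eq l x ▸ hf.2 (p x))

theorem generatorSpan_eq_map [IsManifold (𝓡 d) ∞ X] (h : IsReducedPencil (d := d) e j p c₁ c₂)
    (hp : IsRealOrbitQuotient (d := d) (m := m) e j p) (hj : IsOpenInOrbit (d := d) e z₀ j)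
    (hdom : ∀ x, IsAdmissibleDomain e V W (j x)) (x : X) :
    generatorSpan e V W (j x) (vecDeriv (𝓡 d) j x) =
      (Submodule.span ℂ ((fun s => vecDeriv (𝓡 m) s (p x)) ''
        (firstIntegrals (Submodule.span ℂ {c₁, c₂}) : Set (N → ℂ)))).map
          (pullCovector (mapDeriv (𝓡 d) (𝓡 m) p x)) := by
  refine le_antisymm (Submodule.span_le.2 ?_) (Submodule.map_le_iff_le_comap.2 <|
    Submodule.span_le.2 <| Set.image_subset_iff.2 fun s hs =>
      h.pullCovector_vecDeriv_mem_generatorSpan hp hj hdom hs x)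
  rintro _ ⟨G, hG, rfl⟩
  obtain ⟨s, hs, hsG⟩ := h.exists_mem_firstIntegrals hp hj hdom hG
  exact ⟨_, Submodule.subset_span ⟨s, hs, rfl⟩, hsG x⟩

theorem image_functionallyGenerated [IsManifold (𝓡 d) ∞ X]
    (h : IsReducedPencil (d := d) e j p c₁ c₂)
    (hp : IsRealOrbitQuotient (d := d) (m := m) e j p) (hj : IsOpenInOrbit (d := d) e z₀ j)
    (hdom : ∀ x, IsAdmissibleDomain e V W (j x)) :
    (fun f => f ∘ p) '' functionallyGenerated (𝓡 m) Set.univ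
        (firstIntegrals (Submodule.span ℂ {c₁, c₂}) : Set (N → ℂ)) =
      functionallyGenerated (𝓡 d) Set.univ (F1Generators e j V W) := by
  have hspan (x : X) := (h.generatorSpan_eq_map hp hj hdom x).symm.trans
    ((hdom x).isGeneratorDomain.generatorSpan_vecDeriv_eq (hj.mdifferentiableAt x))
  have hcomp {f : N → ℂ} (hf : ContMDiff (𝓡 m) 𝓘(ℝ, ℂ) ∞ f) (x : X) :
      pullCovector (mapDeriv (𝓡 d) (𝓡 m) p x) (vecDeriv (𝓡 m) f (p x)) =
        vecDeriv (𝓡 d) (f ∘ p) x :=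
    (vecDeriv_comp_map (hp.mdifferentiableAt x) ((hf (p x)).mdifferentiableAt (by simp))).symm
  refine Set.Subset.antisymm ?_ fun f ⟨hf, hfS⟩ => ?_
  · rintro _ ⟨f, ⟨hf, hfS⟩, rfl⟩
    rw [contMDiffOn_univ] at hf
    refine ⟨(hf.comp hp.smooth).contMDiffOn, fun x _ => ?_⟩
    have hfx := Submodule.mem_map_of_mem (f := pullCovector (mapDeriv (𝓡 d) (𝓡 m) p x))
      (hfS (p x) trivial)
    exact (congrArg (· ∈ _) (hcomp hf x)).mp ((hspan x).le hfx)
  · have hfS' (x : X) : vecDeriv (𝓡 d) f x ∈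
        generatorSpan e V W (j x) (vecDeriv (𝓡 d) j x) :=
      ((hdom x).isGeneratorDomain.generatorSpan_vecDeriv_eq (hj.mdifferentiableAt x)).ge
        (hfS x trivial)
    obtain ⟨k, hk, rfl⟩ := hp.exists_comp_eq hj (contMDiffOn_univ.1 hf) fun x w hw =>
      (hp.isReductionAt hj x).apply_eq_zero_of_mem_generatorSpan (hdom x).isGeneratorDomain
        (hfS' x) hw
    refine ⟨k, ⟨hk.contMDiffOn, hp.surjective.forall.2 fun x _ => ?_⟩, rfl⟩
    obtain ⟨α, hα, hαk⟩ := (h.generatorSpan_eq_map hp hj hdom x).le (hfS' x)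
    have hα' : α = vecDeriv (𝓡 m) k (p x) :=
      pullCovector_injective (hp.submersion x) (hαk.trans (hcomp hk x).symm)
    exact (congrArg (· ∈ _) hα').mp hα

end IsReducedPencil

end FirstIntegrals

theorem mainTheorem3_general {ι : Type*} [Fintype ι] [DecidableEq ι]
    {𝔤₀ : Type*} [LieRing 𝔤₀] [LieAlgebra ℝ 𝔤₀] (e : Module.Basis ι ℝ 𝔤₀) :
    (∀ (U : Set (ι → ℂ)) (W : ℂ × ℂ → Set (ι → ℂ)), IsOpen U →
      (∀ l : ℂ × ℂ, l ≠ 0 → IsOpen (W l) ∧ phi l '' U ⊆ W l) →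
      ∀ f ∈ functionallyGenerated 𝓘(ℝ, ι → ℂ) U (F1Generators e id U W),
        IsRealInvariantOn e U f ∧
          ((∀ A ∈ realCoadjointGroup e, ∀ z ∈ U, A *ᵥ z ∈ U) →
            ∀ A ∈ realCoadjointGroup e, ∀ z ∈ U, f (A *ᵥ z) = f z)) ∧
    (∀ (d m : ℕ) (X : Type*) (N : Type*) [TopologicalSpace X]
      [ChartedSpace (EuclideanSpace ℝ (Fin d)) X] [IsManifold (𝓡 d) ∞ X] [TopologicalSpace N]
      [ChartedSpace (EuclideanSpace ℝ (Fin m)) N] [IsManifold (𝓡 m) ∞ N]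
      (z₀ : ι → ℂ) (j : X → ι → ℂ) (p : X → N) (V : Set (ι → ℂ)) (W : ℂ × ℂ → Set (ι → ℂ)),
      IsOpenInOrbit (d := d) e z₀ j → IsRealOrbitQuotient (d := d) (m := m) e j p →
      IsAdmissible e V → Set.range j ⊆ V →
      (∀ l : ℂ × ℂ, l ≠ 0 → IsAdmissible e (W l) ∧ phi l '' Set.range j ⊆ W l) →
      ∃ c₁ c₂ : BivectorField (𝓡 m) N, IsReduction (d := d) e j p c₁ c₂ ∧
        (fun f => f ∘ p) '' functionallyGenerated (𝓡 m) Set.univ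
            (firstIntegrals (Submodule.span ℂ {c₁, c₂}) : Set (N → ℂ)) =
          functionallyGenerated (𝓡 d) Set.univ (F1Generators e j V W)) := by
  refine ⟨fun U W hU hW f hf => ?_, fun d m X N _ _ _ _ _ _ z₀ j p V W hj hp hV hjV hW => ?_⟩
  · have hinv := isRealInvariantOn_of_mem_functionallyGenerated hU hW hf
    exact ⟨hinv, fun hA A hA' z hz => hinv.apply_mulVec hA hA' hz⟩
  · have hdom (x : X) : IsAdmissibleDomain e V W (j x) :=
      ⟨hV, hjV ⟨x, rfl⟩, fun l hl => (hW l hl).1, fun l hl => (hW l hl).2 ⟨_, ⟨x, rfl⟩, rfl⟩⟩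
    obtain ⟨c₁, c₂, h⟩ := hp.exists_isReducedPencil hj
    exact ⟨c₁, c₂, h.isReduction hj, h.image_functionallyGenerated hp hj hdom⟩

theorem mainTheorem3 {ι : Type*} [Fintype ι] [DecidableEq ι]
    {𝔤₀ : Type*} [LieRing 𝔤₀] [LieAlgebra ℝ 𝔤₀] (e : Module.Basis ι ℝ 𝔤₀)
    (hnonabelian : ¬ IsLieAbelian 𝔤₀)
    (hcodim : 3 ≤ (MvPolynomial.vanishingIdeal ℂ (singSet e)).height) :
    -- part (i)
    (∀ (U : Set (ι → ℂ)) (W : ℂ × ℂ → Set (ι → ℂ)), IsOpen U → IsStronglyAdmissible e U →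
      (∀ l : ℂ × ℂ, l ≠ 0 → IsAdmissible e (W l) ∧ phi l '' U ⊆ W l) →
      ∀ f ∈ functionallyGenerated 𝓘(ℝ, ι → ℂ) U (F1Generators e id U W),
        IsRealInvariantOn e U f ∧
          ((∀ A ∈ realCoadjointGroup e, ∀ z ∈ U, A *ᵥ z ∈ U) →
            ∀ A ∈ realCoadjointGroup e, ∀ z ∈ U, f (A *ᵥ z) = f z)) ∧
    -- part (ii)
    (∀ (d m : ℕ) (X : Type*) (N : Type*) [TopologicalSpace X] [ChartedSpace (EuclideanSpace ℝ (Fin d)) X]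
      [IsManifold (𝓡 d) ∞ X] [TopologicalSpace N] [T2Space N] [SecondCountableTopology N]
      [ChartedSpace (EuclideanSpace ℝ (Fin m)) N] [IsManifold (𝓡 m) ∞ N]
      (z₀ : ι → ℂ) (j : X → ι → ℂ) (p : X → N) (V : Set (ι → ℂ)) (W : ℂ × ℂ → Set (ι → ℂ)),
      IsOpenInOrbit (d := d) e z₀ j → IsRealOrbitQuotient (d := d) (m := m) e j p → IsStronglyAdmissible e (Set.range j) →
      IsAdmissible e V → Set.range j ⊆ V →
      (∀ l : ℂ × ℂ, l ≠ 0 → IsAdmissible e (W l) ∧ phi l '' Set.range j ⊆ W l) →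
      ∃ c₁ c₂ : BivectorField (𝓡 m) N, IsReduction (d := d) e j p c₁ c₂ ∧
        (fun f => f ∘ p) '' functionallyGenerated (𝓡 m) Set.univ
            (firstIntegrals (Submodule.span ℂ {c₁, c₂}) : Set (N → ℂ)) =
          functionallyGenerated (𝓡 d) Set.univ (F1Generators e j V W)) := by
  obtain ⟨invariant, reduction⟩ := mainTheorem3_general e
  exact ⟨fun U W hU _ hW => invariant U W hU fun l hl => ⟨(hW l hl).1.1, (hW l hl).2⟩,
    fun d m X N _ _ _ _ _ _ _ _ z₀ j p V W hj hp _ => reduction d m X N z₀ j p V W hj hp⟩
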